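/- Let $k, n \ge 0$ be integers. An instance consists of a set $F$ of $k$ facilities, all of which are open, a set $C$ of $n$ clients, a metric $d$ on the disjoint union $F \uplus C$ (distinct points may be at distance $0$), and capacities $u_i \in \mathbb{Z}_{\ge 0}$ for $i \in F$. Let $f : \mathbb{R}_{\ge 0}^n \to \mathbb{R}_{\ge 0}$ be a monotone symmetric norm: $f(x) = 0$ iff $x = 0$; $f(\lambda x) = \lambda f(x)$ for $\lambda \ge 0$; $f(x+y) \le f(x) + f(y)$; $f(x) \le f(y)$ whenever $x \le y$ coordinatewise; and $f$ is invariant under permutations of the coordinates. An assignment $\sigma : C \to F$ is feasible if $|\sigma^{-1}(i)| \le u_i$ for every $i \in F$, and its cost is $f\big((d(j, \sigma(j)))_{j \in C}\big)$. The model of computation is the real RAM with a value oracle for $f$: a program works with finitely many named arrays (with two indices, unbounded) of natural numbers and of real numbers, takes one step for each arithmetic operation ($+$, truncated $-$, $\times$ on natural numbers; $+, -, \times, /$ on real numbers, without rounding; conversion of a natural number to a real number), each memory access and each comparison or test, contains no constants other than natural numbers, and can ask for the exact value of $f$ at a vector stored in memory at a cost of $n+1$ steps. **Theorem.** There are a single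 deterministic program, a computable function $g : \mathbb{N}^2 \to \mathbb{N}$ and a polynomial $p$ with coefficients in $\mathbb{N}$ such that the following holds for every instance, every monotone symmetric norm $f$ on $\mathbb{R}_{\ge 0}^n$ and every real $\varepsilon > 0$. On input $k$, $n$, $\varepsilon$, the capacities and all pairwise distances of points of $F \uplus C$, and with oracle $f$, the program halts after at most $g(k, \lceil 1/\varepsilon \rceil) \cdot p(n)$ steps; and if a feasible assignment exists, then it outputs a feasible assignment $\sigma$ with $$f\big((d(j, \sigma(j)))_{j \in C}\big) \le (1+\varepsilon) \cdot f\big((d(j, \tau(j)))_{j \in C}\big) \quad \text{for every feasible assignment } \tau : C \to F.$$ -/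

import Mathlib

open scoped NNReal

noncomputable section

namespace CapClustering

/-! ### Monotone symmetric norms and the clustering problem -/

/-- A monotone symmetric norm on the nonnegative orthant of dimension `n`. -/
structure IsMonotoneSymmetricNorm {n : ℕ} (f : (Fin n → ℝ≥0) → ℝ≥0) : Prop where
  eq_zero_iff : ∀ x, f x = 0 ↔ x = 0
  homogeneous : ∀ (c : ℝ≥0) x, f (c • x) = c * f x
  subadditive : ∀ x y, f (x + y) ≤ f x + f y
  monotone : ∀ x y, x ≤ y → f x ≤ f y
  symmetric : ∀ x (π : Equiv.Perm (Fin n)), f (fun j => x (π j)) = f x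

/-- An instance with facility set `F = Fin k` (all of them open) and client set `C = Fin n`:
a metric on the disjoint union of `F` and `C` (distinct points may be at distance zero) and a
capacity for every facility. -/
structure Inst (k n : ℕ) where
  metric : PseudoMetricSpace (Fin k ⊕ Fin n)
  cap : Fin k → ℕ

variable {k n : ℕ}

/-- The distance between two points of the instance. -/
def Inst.d (I : Inst k n) (a b : Fin k ⊕ Fin n) : ℝ≥0 :=
  @nndist _ I.metric.toNNDist a b

/-- The vector of connection distances of an assignment. -/
def Inst.connection (I : Inst k n) (σ : Fin n → Fin k) : Fin n → ℝ≥0 :=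
  fun j => I.d (Sum.inr j) (Sum.inl (σ j))

/-- The assignment respects the capacities. -/
def Inst.Feasible (I : Inst k n) (σ : Fin n → Fin k) : Prop :=
  ∀ i, (Finset.univ.filter fun j => σ j = i).card ≤ I.cap i

/-- `σ` is feasible and its cost is at most `α` times the cost of every feasible assignment. -/
def Inst.IsApprox (I : Inst k n) (f : (Fin n → ℝ≥0) → ℝ≥0) (α : ℝ) (σ : Fin n → Fin k) : Prop :=
  I.Feasible σ ∧
    ∀ τ, I.Feasible τ → (f (I.connection σ) : ℝ) ≤ α * (f (I.connection τ) : ℝ)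

/-! ### The real RAM

The memory consists of arrays of natural numbers and arrays of real numbers. The name of an array
is a number that is fixed in the program; its entries have two indices, which are computed. -/

structure Memory where
  nat : ℕ → ℕ → ℕ → ℕ
  real : ℕ → ℕ → ℕ → ℝ

def Memory.setNat (m : Memory) (a i j v : ℕ) : Memory where
  nat := fun a' i' j' => if a' = a ∧ i' = i ∧ j' = j then v else m.nat a' i' j'
  real := m.real

def Memory.setReal (m : Memory) (a i j : ℕ) (v : ℝ) : Memory where
  nat := m.nat
  real := fun a' i' j' => if a' = a ∧ i' = i ∧ j' = j then v else m.real a' i' j'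

/-- Expressions with natural values; `sub` is truncated subtraction. -/
inductive NatExpr where
  | const (c : ℕ)
  | read (a : ℕ) (i j : NatExpr)
  | add (e₁ e₂ : NatExpr)
  | sub (e₁ e₂ : NatExpr)
  | mul (e₁ e₂ : NatExpr)

def NatExpr.eval (m : Memory) : NatExpr → ℕ
  | const c => c
  | read a i j => m.nat a (i.eval m) (j.eval m)
  | add e₁ e₂ => e₁.eval m + e₂.eval m
  | sub e₁ e₂ => e₁.eval m - e₂.eval m
  | mul e₁ e₂ => e₁.eval m * e₂.eval m

/-- The number of operations in the expression. -/
def NatExpr.cost : NatExpr → ℕ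
  | const _ => 1
  | read _ i j => i.cost + j.cost + 1
  | add e₁ e₂ => e₁.cost + e₂.cost + 1
  | sub e₁ e₂ => e₁.cost + e₂.cost + 1
  | mul e₁ e₂ => e₁.cost + e₂.cost + 1

/-- Expressions with real values. The only constants are natural numbers, there is no rounding,
and division by zero returns zero. -/
inductive RealExpr where
  | ofNat (e : NatExpr)
  | read (a : ℕ) (i j : NatExpr)
  | add (e₁ e₂ : RealExpr)
  | sub (e₁ e₂ : RealExpr)
  | mul (e₁ e₂ : RealExpr)
  | div (e₁ e₂ : RealExpr)

def RealExpr.eval (m : Memory) : RealExpr → ℝ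
  | ofNat e => (e.eval m : ℝ)
  | read a i j => m.real a (i.eval m) (j.eval m)
  | add e₁ e₂ => e₁.eval m + e₂.eval m
  | sub e₁ e₂ => e₁.eval m - e₂.eval m
  | mul e₁ e₂ => e₁.eval m * e₂.eval m
  | div e₁ e₂ => e₁.eval m / e₂.eval m

def RealExpr.cost : RealExpr → ℕ
  | ofNat e => e.cost + 1
  | read _ i j => i.cost + j.cost + 1
  | add e₁ e₂ => e₁.cost + e₂.cost + 1
  | sub e₁ e₂ => e₁.cost + e₂.cost + 1
  | mul e₁ e₂ => e₁.cost + e₂.cost + 1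
  | div e₁ e₂ => e₁.cost + e₂.cost + 1

/-- Conditions of branches and loops. -/
inductive Cond where
  | natLt (e₁ e₂ : NatExpr)
  | realLt (e₁ e₂ : RealExpr)
  | not (b : Cond)
  | and (b₁ b₂ : Cond)

def Cond.Holds (m : Memory) : Cond → Prop
  | natLt e₁ e₂ => e₁.eval m < e₂.eval m
  | realLt e₁ e₂ => e₁.eval m < e₂.eval m
  | not b => ¬ b.Holds m
  | and b₁ b₂ => b₁.Holds m ∧ b₂.Holds m

def Cond.cost : Cond → ℕ
  | natLt e₁ e₂ => e₁.cost + e₂.cost + 1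
  | realLt e₁ e₂ => e₁.cost + e₂.cost + 1
  | not b => b.cost + 1
  | and b₁ b₂ => b₁.cost + b₂.cost + 1

/-- Programs. `query a i j b r` stores in entry `(i, j)` of real array `a` the oracle's answer to
the vector that stands in row `r` of real array `b`. -/
inductive Program where
  | skip
  | writeNat (a : ℕ) (i j e : NatExpr)
  | writeReal (a : ℕ) (i j : NatExpr) (e : RealExpr)
  | query (a : ℕ) (i j : NatExpr) (b : ℕ) (r : NatExpr)
  | seq (p q : Program)
  | cond (b : Cond) (p q : Program)
  | loop (b : Cond) (p : Program)

/-- `Exec f p m t m'`: with value oracle `f` on vectors of length `n`, the program `p`, started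
with memory `m`, halts after `t` steps with memory `m'`. Each operation on numbers, each memory
access and each test takes one step, and a query takes `n + 1` steps. -/
inductive Exec {n : ℕ} (f : (Fin n → ℝ≥0) → ℝ≥0) : Program → Memory → ℕ → Memory → Prop where
  | skip (m : Memory) : Exec f .skip m 1 m
  | writeNat (m : Memory) (a : ℕ) (i j e : NatExpr) :
      Exec f (.writeNat a i j e) m (i.cost + j.cost + e.cost + 1)
        (m.setNat a (i.eval m) (j.eval m) (e.eval m))
  | writeReal (m : Memory) (a : ℕ) (i j : NatExpr) (e : RealExpr) :
      Exec f (.writeReal a i j e) m (i.cost + j.cost + e.cost + 1)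
        (m.setReal a (i.eval m) (j.eval m) (e.eval m))
  | query (m : Memory) (a : ℕ) (i j : NatExpr) (b : ℕ) (r : NatExpr) :
      Exec f (.query a i j b r) m (i.cost + j.cost + r.cost + (n + 1))
        (m.setReal a (i.eval m) (j.eval m)
          (f fun l => (m.real b (r.eval m) (l : ℕ)).toNNReal))
  | seq {p q : Program} {m m₁ m₂ : Memory} {t₁ t₂ : ℕ} :
      Exec f p m t₁ m₁ → Exec f q m₁ t₂ m₂ → Exec f (.seq p q) m (t₁ + t₂) m₂
  | cond_true {b : Cond} {p q : Program} {m m₁ : Memory} {t : ℕ} :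
      b.Holds m → Exec f p m t m₁ → Exec f (.cond b p q) m (b.cost + t) m₁
  | cond_false {b : Cond} {p q : Program} {m m₁ : Memory} {t : ℕ} :
      ¬ b.Holds m → Exec f q m t m₁ → Exec f (.cond b p q) m (b.cost + t) m₁
  | loop_done {b : Cond} {p : Program} {m : Memory} :
      ¬ b.Holds m → Exec f (.loop b p) m b.cost m
  | loop_step {b : Cond} {p : Program} {m m₁ m₂ : Memory} {t₁ t₂ : ℕ} :
      b.Holds m → Exec f p m t₁ m₁ → Exec f (.loop b p) m₁ t₂ m₂ →
        Exec f (.loop b p) m (b.cost + t₁ + t₂) m₂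

/-- Running times and results are unique. -/
theorem Exec.unique {f : (Fin n → ℝ≥0) → ℝ≥0} {p : Program} {m m₁ m₂ : Memory} {t₁ t₂ : ℕ}
    (h₁ : Exec f p m t₁ m₁) (h₂ : Exec f p m t₂ m₂) : t₁ = t₂ ∧ m₁ = m₂ := by
  induction h₁ generalizing t₂ m₂ with
  | skip | writeNat | writeReal | query => cases h₂; exact ⟨rfl, rfl⟩
  | seq _ _ ih₁ ih₂ =>
    cases h₂ with
    | seq g₁ g₂ =>
      obtain ⟨rfl, rfl⟩ := ih₁ g₁
      obtain ⟨rfl, rfl⟩ := ih₂ g₂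
      exact ⟨rfl, rfl⟩
  | cond_true hb _ ih =>
    cases h₂ with
    | cond_true _ g => obtain ⟨rfl, rfl⟩ := ih g; exact ⟨rfl, rfl⟩
    | cond_false hb' _ => exact absurd hb hb'
  | cond_false hb _ ih =>
    cases h₂ with
    | cond_true hb' _ => exact absurd hb' hb
    | cond_false _ g => obtain ⟨rfl, rfl⟩ := ih g; exact ⟨rfl, rfl⟩
  | loop_done hb =>
    cases h₂ with
    | loop_done _ => exact ⟨rfl, rfl⟩
    | loop_step hb' _ _ => exact absurd hb' hb
  | loop_step hb _ _ ih₁ ih₂ =>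
    cases h₂ with
    | loop_done hb' => exact absurd hb hb'
    | loop_step _ g₁ g₂ =>
      obtain ⟨rfl, rfl⟩ := ih₁ g₁
      obtain ⟨rfl, rfl⟩ := ih₂ g₂
      exact ⟨rfl, rfl⟩

/-! ### Input and output -/

/-- The point with number `a`: the facilities have the numbers `0, …, k - 1` and the clients the
numbers `k, …, k + n - 1`. -/
def point (k n a : ℕ) : Option (Fin k ⊕ Fin n) :=
  if h : a < k + n then some (finSumFinEquiv.symm ⟨a, h⟩) else none

/-- The memory at the start. Natural array `0` holds `k` and `n` in row `0`, natural array `1`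
holds the capacities in row `0`, real array `0` holds `ε` in its first entry, and real array `1`
holds the matrix of distances between all points. Everything else is zero. -/
def Inst.input (I : Inst k n) (ε : ℝ) : Memory where
  nat := fun a i j =>
    match a, i with
    | 0, 0 => if j = 0 then k else if j = 1 then n else 0
    | 1, 0 => if h : j < k then I.cap ⟨j, h⟩ else 0
    | _, _ => 0
  real := fun a i j =>
    match a with
    | 0 => if i = 0 ∧ j = 0 then ε else 0
    | 1 =>
      match point k n i, point k n j with
      | some x, some y => (I.d x y : ℝ)
      | _, _ => 0
    | _ => 0

/-- The assignment `σ` stands in row `0` of natural array `2`. -/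
def Outputs (m : Memory) (σ : Fin n → Fin k) : Prop :=
  ∀ j : Fin n, m.nat 2 0 (j : ℕ) = (σ j : ℕ)

end CapClustering

end

noncomputable section

namespace CapClustering

/-! ### Program logic -/

/-! Let `r j` be the distance from client `j` to its nearest facility, `δ = ε / (32 (1 + ε))`, `q =
1 + δ` and `h = q ^ 3`. The clients fall into types whose number depends on `k` and `ε` only.
Facilities that are nearest to the representative of a type up to the factor `q` cost each client of
the type its own `r j`, up to `h`; every other facility costs all clients of the type the same, up
to `h`. The number is bounded because the type of `j` can be read off from the comparisons of its
distances `c j i` with finitely many multiples of the distances between facilities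
(`SameSignature.similar`, `Inst.card_types_le`).

With costs rounded accordingly (`roundedCost`), take a cheapest feasible assignment `o` that no
exchange of two clients improves (`Inst.exists_minimizer`). Within a type, the clients that `o`
serves at near facilities then have the smallest `r j`, so a single threshold per type almost
separates them from the others. It suffices to know this threshold up to a factor `q`, relative to
the largest connection distance `M` of `o`; thresholds below `M / q ^ S`, where `n ≤ q ^ S * δ`, do
not matter, since `n` costs of size `δ * M / n` are paid for by one cost `δ * M`. The thresholds
split every type into three rows. If an assignment puts into each cell, that is a pair of a row and
a facility, at most `q` times as many clients as `o`, then its cost vector is bounded, up to factors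
near one and a negligible constant, by a substochastic matrix times the cost vector of `o`. By
Birkhoff's theorem no monotone symmetric norm can increase under such a matrix (`le_of_cells`,
`Inst.exists_guide`).

So the program tries every client-facility distance as `M`, every tuple of thresholds and every
table of cell bounds from `0, 1, q, …, q ^ S`. Given a guess, an assignment within the cell bounds
and the capacities is a transportation problem. It is solved by augmentation: a matrix of smaller
than possible sum can be improved by a move with entries in `{-1, 0, 1}`
(`CountMatrix.exists_augmentation`), and all moves can be tried. The oracle selects the best
assignment found. Every candidate is feasible, and the correct guess (`Inst.exists_guess`) produces
one that is good enough.

The number of guesses is `k * n * (S + 2) ^ N` with `N` depending on `k` and `ε` and with `S`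
logarithmic in `n`; it is fixed-parameter tractable because `l ^ N ≤ N ^ N * 2 ^ l` (`guesses_le`).
Running times are tracked by `WP`: if one number `H` bounds the lengths of all loops, the time is at
most `H` to a power that is read off from the program text. In the end `H` is a function of the
parameters times `n + 1`. -/

@[simp] theorem Memory.setNat_real (m : Memory) (a i j v : ℕ) : (m.setNat a i j v).real = m.real := rfl

@[simp] theorem Memory.setReal_nat (m : Memory) (a i j : ℕ) (v : ℝ) :
    (m.setReal a i j v).nat = m.nat := rfl

theorem Memory.setNat_nat_ne (m : Memory) {a a' : ℕ} (h : a' ≠ a) (i j v : ℕ) :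
    (m.setNat a i j v).nat a' = m.nat a' := by
  funext i' j'; simp [Memory.setNat, h]

theorem Memory.setReal_real_ne (m : Memory) {a a' : ℕ} (h : a' ≠ a) (i j : ℕ) (v : ℝ) :
    (m.setReal a i j v).real a' = m.real a' := by
  funext i' j'; simp [Memory.setReal, h]

@[simp] theorem Memory.setNat_nat (m : Memory) (a i j v a' i' j' : ℕ) :
    (m.setNat a i j v).nat a' i' j' =
      if a' = a ∧ i' = i ∧ j' = j then v else m.nat a' i' j' := rfl

@[simp] theorem Memory.setReal_real (m : Memory) (a i j : ℕ) (v : ℝ) (a' i' j' : ℕ) :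
    (m.setReal a i j v).real a' i' j' =
      if a' = a ∧ i' = i ∧ j' = j then v else m.real a' i' j' := rfl

/-- The memories agree on all arrays outside of `S`. -/
def Fr (S : List ℕ) (m m' : Memory) : Prop :=
  ∀ a ∉ S, m'.nat a = m.nat a ∧ m'.real a = m.real a

theorem Fr.refl (S : List ℕ) (m : Memory) : Fr S m m := fun _ _ => ⟨rfl, rfl⟩

theorem Fr.nat {S : List ℕ} {m m' : Memory} (h : Fr S m m') (a : ℕ) (ha : a ∉ S) :
    m'.nat a = m.nat a := (h a ha).1

theorem Fr.real {S : List ℕ} {m m' : Memory} (h : Fr S m m') (a : ℕ) (ha : a ∉ S) :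
    m'.real a = m.real a := (h a ha).2

theorem Fr.mono {S S' : List ℕ} {m m' : Memory} (h : Fr S m m') (hS : S ⊆ S') : Fr S' m m' :=
  fun a ha => h a fun h' => ha (hS h')

theorem Fr.trans {S S' : List ℕ} {m m' m'' : Memory} (h : Fr S m m') (h' : Fr S' m' m'')
    (hS : S' ⊆ S) : Fr S m m'' := fun a ha =>
  have ha' : a ∉ S' := fun h' => ha (hS h')
  ⟨(h' a ha').1.trans (h a ha).1, (h' a ha').2.trans (h a ha).2⟩

theorem Fr.setNat {S : List ℕ} {a : ℕ} {m m' : Memory} (h : Fr S m m') (ha : a ∈ S) (i j v : ℕ) :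
    Fr S m (m'.setNat a i j v) := fun b hb =>
  have hab : b ≠ a := by rintro rfl; exact hb ha
  ⟨(Memory.setNat_nat_ne _ hab _ _ _).trans (h b hb).1, (h b hb).2⟩

theorem Fr.setReal {S : List ℕ} {a : ℕ} {m m' : Memory} (h : Fr S m m') (ha : a ∈ S) (i j : ℕ)
    (v : ℝ) : Fr S m (m'.setReal a i j v) := fun b hb =>
  have hab : b ≠ a := by rintro rfl; exact hb ha
  ⟨(h b hb).1, (Memory.setReal_real_ne _ hab _ _ _).trans (h b hb).2⟩

/-- A bound for the degree of the running time in the numbers of iterations of the loops. -/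
def Program.deg : Program → ℕ
  | .skip => 1
  | .writeNat _ i j e => i.cost + j.cost + e.cost + 1
  | .writeReal _ i j e => i.cost + j.cost + e.cost + 1
  | .query _ i j _ r => i.cost + j.cost + r.cost + 1
  | .seq p q => p.deg + q.deg + 1
  | .cond b p q => b.cost + p.deg + q.deg + 1
  | .loop b p => b.cost + p.deg + 3

/-- The program halts in a memory with the property `Q` after at most `H ^ p.deg` steps. -/
def WP (H : ℕ) {n : ℕ} (f : (Fin n → ℝ≥0) → ℝ≥0) (p : Program) (Q : Memory → Prop)
    (m : Memory) : Prop :=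
  ∃ t m', Exec f p m t m' ∧ t ≤ H ^ p.deg ∧ Q m'

section

variable {H n : ℕ} {f : (Fin n → ℝ≥0) → ℝ≥0} {Q Q' : Memory → Prop} {m : Memory}

theorem le_pow_self_of_two_le (hH : 2 ≤ H) (c : ℕ) : c ≤ H ^ c :=
  (Nat.lt_pow_self (by omega)).le

theorem WP.mono {p : Program} (h : WP H f p Q m) (hQ : ∀ m', Q m' → Q' m') : WP H f p Q' m := by
  obtain ⟨t, m', h1, h2, h3⟩ := h
  exact ⟨t, m', h1, h2, hQ _ h3⟩

theorem wp_skip (hH : 2 ≤ H) (h : Q m) : WP H f .skip Q m :=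
  ⟨_, _, .skip m, le_pow_self_of_two_le hH _, h⟩

theorem wp_writeNat (hH : 2 ≤ H) {a : ℕ} {i j e : NatExpr}
    (h : Q (m.setNat a (i.eval m) (j.eval m) (e.eval m))) : WP H f (.writeNat a i j e) Q m :=
  ⟨_, _, .writeNat m a i j e, le_pow_self_of_two_le hH _, h⟩

theorem wp_writeReal (hH : 2 ≤ H) {a : ℕ} {i j : NatExpr} {e : RealExpr}
    (h : Q (m.setReal a (i.eval m) (j.eval m) (e.eval m))) : WP H f (.writeReal a i j e) Q m :=
  ⟨_, _, .writeReal m a i j e, le_pow_self_of_two_le hH _, h⟩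

/-- The cost `n + 1` of a query is absorbed by one factor `H`, so that the degree does not depend on
`n`. -/
theorem wp_query (hH : 2 ≤ H) (hn : n + 1 ≤ H) {a b : ℕ} {i j r : NatExpr}
    (h : Q (m.setReal a (i.eval m) (j.eval m)
      (f fun l => (m.real b (r.eval m) (l : ℕ)).toNNReal))) : WP H f (.query a i j b r) Q m := by
  refine ⟨_, _, .query m a i j b r, ?_, h⟩
  have h1 : i.cost + j.cost + r.cost + 1 ≤ H ^ (i.cost + j.cost + r.cost) :=
    Nat.lt_pow_self (by omega)
  have h2 : H ^ (i.cost + j.cost + r.cost) * 2 ≤ H ^ (i.cost + j.cost + r.cost) * H :=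
    Nat.mul_le_mul_left _ hH
  simp only [Program.deg, pow_succ]
  nlinarith

theorem wp_seq (hH : 2 ≤ H) {p q : Program} (h : WP H f p (fun m' => WP H f q Q m') m) :
    WP H f (.seq p q) Q m := by
  obtain ⟨t, m', h1, h2, t', m'', h3, h4, h5⟩ := h
  refine ⟨_, _, .seq h1 h3, ?_, h5⟩
  have e1 : 1 ≤ H ^ p.deg := Nat.one_le_pow _ _ (by omega)
  have e2 : 1 ≤ H ^ q.deg := Nat.one_le_pow _ _ (by omega)
  calc t + t' ≤ H ^ p.deg + H ^ q.deg := by omega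
    _ ≤ H ^ p.deg * H ^ q.deg * 2 := by nlinarith
    _ ≤ H ^ p.deg * H ^ q.deg * H := Nat.mul_le_mul_left _ hH
    _ = _ := by simp only [Program.deg, pow_add, pow_one]

theorem wp_cond (hH : 2 ≤ H) {b : Cond} {p q : Program} (h1 : b.Holds m → WP H f p Q m)
    (h2 : ¬ b.Holds m → WP H f q Q m) : WP H f (.cond b p q) Q m := by
  have e1 : 1 ≤ H ^ p.deg := Nat.one_le_pow _ _ (by omega)
  have e2 : 1 ≤ H ^ q.deg := Nat.one_le_pow _ _ (by omega)
  have e3 : b.cost ≤ H ^ b.cost := le_pow_self_of_two_le hH _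
  have e4 : 1 ≤ H ^ b.cost := Nat.one_le_pow _ _ (by omega)
  have key : ∀ x, x = H ^ p.deg ∨ x = H ^ q.deg → b.cost + x ≤ H ^ (Program.cond b p q).deg := by
    intro x hx
    have hx1 : 1 ≤ x := by rcases hx with rfl | rfl <;> assumption
    have hx2 : x ≤ H ^ p.deg * H ^ q.deg := by
      rcases hx with rfl | rfl
      · exact Nat.le_mul_of_pos_right _ e2
      · exact Nat.le_mul_of_pos_left _ e1
    calc b.cost + x ≤ H ^ b.cost + x := by omega
      _ ≤ H ^ b.cost * x * 2 := by nlinarith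
      _ ≤ H ^ b.cost * (H ^ p.deg * H ^ q.deg) * H := by gcongr
      _ = _ := by simp only [Program.deg, pow_add, pow_one]; ring
  by_cases hb : b.Holds m
  · obtain ⟨t, m', g1, g2, g3⟩ := h1 hb
    exact ⟨_, _, .cond_true hb g1, (Nat.add_le_add_left g2 _).trans (key _ (.inl rfl)), g3⟩
  · obtain ⟨t, m', g1, g2, g3⟩ := h2 hb
    exact ⟨_, _, .cond_false hb g1, (Nat.add_le_add_left g2 _).trans (key _ (.inr rfl)), g3⟩

/-- A loop with a variant that is at most `H` at the start. -/
theorem wp_loop (hH : 2 ≤ H) {b : Cond} {p : Program} (I : Memory → Prop) (V : Memory → ℕ)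
    (h0 : I m) (hV : V m ≤ H)
    (hs : ∀ m, I m → b.Holds m → WP H f p (fun m' => I m' ∧ V m' < V m) m) :
    WP H f (.loop b p) (fun m' => I m' ∧ ¬ b.Holds m') m := by
  have key : ∀ v, ∀ m, I m → V m ≤ v → ∃ t m', Exec f (.loop b p) m t m' ∧
      t ≤ b.cost + v * (b.cost + H ^ p.deg) ∧ I m' ∧ ¬ b.Holds m' := by
    intro v
    induction v with
    | zero =>
      intro m hI hv
      by_cases hb : b.Holds m
      · obtain ⟨t, m', g1, g2, g3, g4⟩ := hs m hI hb
        omega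
      · exact ⟨_, _, .loop_done hb, Nat.le_add_right _ _, hI, hb⟩
    | succ v ih =>
      intro m hI hv
      by_cases hb : b.Holds m
      · obtain ⟨t, m', g1, g2, g3, g4⟩ := hs m hI hb
        obtain ⟨t', m'', k1, k2, k3⟩ := ih m' g3 (by omega)
        refine ⟨_, _, .loop_step hb g1 k1, ?_, k3⟩
        nlinarith
      · exact ⟨_, _, .loop_done hb, Nat.le_add_right _ _, hI, hb⟩
  obtain ⟨t, m', g1, g2, g3⟩ := key H m h0 hV
  refine ⟨t, m', g1, g2.trans ?_, g3⟩
  have e1 : 1 ≤ H ^ p.deg := Nat.one_le_pow _ _ (by omega)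
  have e3 : b.cost ≤ H ^ b.cost := le_pow_self_of_two_le hH _
  have e4 : 1 ≤ H ^ b.cost := Nat.one_le_pow _ _ (by omega)
  calc b.cost + H * (b.cost + H ^ p.deg) ≤ H ^ b.cost + H * (H ^ b.cost + H ^ p.deg) := by gcongr
    _ ≤ H ^ b.cost * H ^ p.deg + H * (H ^ b.cost * H ^ p.deg * 2) := by
      gcongr
      · exact Nat.le_mul_of_pos_right _ e1
      · nlinarith
    _ ≤ H * (H ^ b.cost * H ^ p.deg) + H * (H ^ b.cost * H ^ p.deg * H) := by
      exact Nat.add_le_add (Nat.le_mul_of_pos_left _ (by omega))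
        (Nat.mul_le_mul_left _ (Nat.mul_le_mul_left _ hH))
    _ ≤ H * (H ^ b.cost * H ^ p.deg * H) * 2 := by
      have : H * (H ^ b.cost * H ^ p.deg) ≤ H * (H ^ b.cost * H ^ p.deg * H) :=
        Nat.mul_le_mul_left _ (Nat.le_mul_of_pos_right _ (by omega))
      omega
    _ ≤ H * (H ^ b.cost * H ^ p.deg * H) * H := Nat.mul_le_mul_left _ hH
    _ = _ := by simp only [Program.deg, pow_add]; ring

/-- The scalar variable that stands in the first entry of array `a`. -/
abbrev NatExpr.var (a : ℕ) : NatExpr := .read a (.const 0) (.const 0)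

/-- Entry `j` of row `0` of array `a`. -/
abbrev NatExpr.item (a : ℕ) (j : NatExpr) : NatExpr := .read a (.const 0) j

abbrev RealExpr.var (a : ℕ) : RealExpr := .read a (.const 0) (.const 0)

abbrev RealExpr.item (a : ℕ) (j : NatExpr) : RealExpr := .read a (.const 0) j

abbrev Program.set (a : ℕ) (e : NatExpr) : Program := .writeNat a (.const 0) (.const 0) e

abbrev Program.setItem (a : ℕ) (j e : NatExpr) : Program := .writeNat a (.const 0) j e

abbrev Program.setR (a : ℕ) (e : RealExpr) : Program := .writeReal a (.const 0) (.const 0) e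

abbrev Program.setRItem (a : ℕ) (j : NatExpr) (e : RealExpr) : Program :=
  .writeReal a (.const 0) j e

/-- `for v = 0, …, e - 1 do p`. -/
def Program.for (v : ℕ) (e : NatExpr) (p : Program) : Program :=
  .seq (.set v (.const 0))
    (.loop (.natLt (.var v) e) (.seq p (.set v (.add (.var v) (.const 1)))))

/-- The arrays `S` of the body exclude the counter, so the body cannot disturb it. The invariant may
mention the counter, which is why it is demanded of the memory after the increment. -/
theorem wp_for (hH : 2 ≤ H) {v : ℕ} {e : NatExpr} {p : Program} {N : ℕ} (S : List ℕ)
    (I : ℕ → Memory → Prop) (hv : v ∉ S) (hN : N ≤ H) (h0 : I 0 (m.setNat v 0 0 0))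
    (he : ∀ m', Fr (v :: S) m m' → e.eval m' = N)
    (hs : ∀ i < N, ∀ m', Fr (v :: S) m m' → m'.nat v 0 0 = i → I i m' →
      WP H f p (fun m'' => Fr S m' m'' ∧ I (i + 1) (m''.setNat v 0 0 (i + 1))) m') :
    WP H f (.for v e p) (fun m' => Fr (v :: S) m m' ∧ I N m') m := by
  refine wp_seq hH (wp_writeNat hH ?_)
  refine (wp_loop hH (fun m' => Fr (v :: S) m m' ∧ m'.nat v 0 0 ≤ N ∧ I (m'.nat v 0 0) m')
    (fun m' => N - m'.nat v 0 0) ?_ ?_ ?_).mono ?_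
  · refine ⟨(Fr.refl _ _).setNat List.mem_cons_self _ _ _, ?_⟩
    simpa [NatExpr.eval] using h0
  · exact (Nat.sub_le _ _).trans hN
  · rintro m' ⟨hF, hle, hI⟩ hb
    simp only [Cond.Holds, NatExpr.eval, he m' hF] at hb
    refine wp_seq hH ((hs _ hb m' hF rfl hI).mono ?_)
    rintro m'' ⟨hF', hI'⟩
    have e1 : m''.nat v 0 0 = m'.nat v 0 0 := by rw [hF'.nat v hv]
    refine wp_writeNat hH ?_
    simp only [NatExpr.eval, e1]
    refine ⟨⟨(hF.trans hF' (List.subset_cons_self _ _)).setNat List.mem_cons_self _ _ _, ?_⟩, ?_⟩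
    · simpa using ⟨hb, hI'⟩
    · simp; omega
  · rintro m' ⟨⟨hF, hle, hI⟩, hb⟩
    simp only [Cond.Holds, NatExpr.eval, he m' hF] at hb
    have : m'.nat v 0 0 = N := by omega
    exact ⟨hF, this ▸ hI⟩

end

/-! ### Monotone symmetric norms -/

namespace IsMonotoneSymmetricNorm

variable {n : ℕ} {f : (Fin n → ℝ≥0) → ℝ≥0}

theorem map_zero (hf : IsMonotoneSymmetricNorm f) : f 0 = 0 := (hf.eq_zero_iff 0).2 rfl

theorem sum_le (hf : IsMonotoneSymmetricNorm f) {ι : Type*} (s : Finset ι)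
    (x : ι → Fin n → ℝ≥0) : f (∑ i ∈ s, x i) ≤ ∑ i ∈ s, f (x i) := by
  classical
  induction s using Finset.induction_on with
  | empty => simp [hf.map_zero]
  | insert a s ha ih =>
    rw [Finset.sum_insert ha, Finset.sum_insert ha]
    exact (hf.subadditive _ _).trans (add_le_add le_rfl ih)

/-- By Birkhoff, the matrix is a convex combination of permutation matrices; subadditivity,
homogeneity and symmetry then bound the norm of the image by a convex combination of copies of `f
v`. -/
theorem le_of_mem_doublyStochastic (hf : IsMonotoneSymmetricNorm f)
    {A : Matrix (Fin n) (Fin n) ℝ} (hA : A ∈ doublyStochastic ℝ (Fin n)) {x v : Fin n → ℝ≥0}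
    (hx : ∀ j, (x j : ℝ) ≤ ∑ l, A j l * v l) : f x ≤ f v := by
  obtain ⟨w, hw, hw1, rfl⟩ := exists_eq_sum_perm_of_mem_doublyStochastic hA
  have h1 : x ≤ ∑ π : Equiv.Perm (Fin n), (w π).toNNReal • fun j => v (π j) := by
    intro j
    rw [← NNReal.coe_le_coe]
    refine (hx j).trans (le_of_eq ?_)
    simp only [Finset.sum_apply, Pi.smul_apply, smul_eq_mul, NNReal.coe_sum, NNReal.coe_mul,
      Matrix.sum_apply, Matrix.smul_apply, Finset.sum_mul]
    rw [Finset.sum_comm]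
    refine Finset.sum_congr rfl fun π _ => ?_
    simp [Equiv.Perm.permMatrix, PEquiv.toMatrix_apply, Real.coe_toNNReal _ (hw π)]
  refine (hf.monotone _ _ h1).trans ((hf.sum_le _ _).trans ?_)
  simp only [hf.homogeneous, hf.symmetric, ← Finset.sum_mul]
  rw [← Real.toNNReal_sum_of_nonneg fun π _ => hw π, hw1]
  simp

/-- The row deficits `a` and the column deficits `b` have the same total `s`, so adding the
nonnegative matrix `a j * b l / s` makes `D` doubly stochastic. -/
theorem le_of_substochastic (hf : IsMonotoneSymmetricNorm f) {D : Fin n → Fin n → ℝ}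
    (h0 : ∀ j l, 0 ≤ D j l) (hr : ∀ j, ∑ l, D j l ≤ 1) (hc : ∀ l, ∑ j, D j l ≤ 1)
    {x v : Fin n → ℝ≥0} (hx : ∀ j, (x j : ℝ) ≤ ∑ l, D j l * v l) : f x ≤ f v := by
  set a : Fin n → ℝ := fun j => 1 - ∑ l, D j l with ha
  set b : Fin n → ℝ := fun l => 1 - ∑ j, D j l with hb
  have ha0 : ∀ j, 0 ≤ a j := fun j => sub_nonneg.2 (hr j)
  have hb0 : ∀ j, 0 ≤ b j := fun j => sub_nonneg.2 (hc j)
  have hab : ∑ j, b j = ∑ j, a j := by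
    simp only [ha, hb, Finset.sum_sub_distrib]
    rw [Finset.sum_comm]
  set s := ∑ j, a j with hs
  have hs0 : 0 ≤ s := Finset.sum_nonneg fun j _ => ha0 j
  -- If `s = 0` then all deficits vanish, and the convention for division by zero gives the correct
  -- value.
  have ha1 : ∀ j, a j * s / s = a j := by
    intro j
    by_cases h : s = 0
    · have := (Finset.sum_eq_zero_iff_of_nonneg fun j _ => ha0 j).1 (hs ▸ h) j (Finset.mem_univ _)
      simp [this]
    · field_simp
  have hb1 : ∀ j, s * b j / s = b j := by
    intro j
    by_cases h : s = 0
    · have := (Finset.sum_eq_zero_iff_of_nonneg fun j _ => hb0 j).1 (hab.trans h) j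
        (Finset.mem_univ _)
      simp [this]
    · field_simp
  refine hf.le_of_mem_doublyStochastic (A := fun j l => D j l + a j * b l / s) ?_ fun j =>
    (hx j).trans (Finset.sum_le_sum fun l _ => ?_)
  · refine mem_doublyStochastic_iff_sum.2 ⟨fun j l => ?_, fun j => ?_, fun l => ?_⟩
    · have := h0 j l
      have := ha0 j
      have := hb0 l
      positivity
    · rw [Finset.sum_add_distrib, ← Finset.sum_div, ← Finset.mul_sum, hab, ha1]
      simp [ha]
    · rw [Finset.sum_add_distrib, ← Finset.sum_div, ← Finset.sum_mul, ← hs, hb1]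
      simp [hb]
  · have := ha0 j
    have := hb0 l
    gcongr
    simp only [le_add_iff_nonneg_right]
    positivity

theorem single_eq (hf : IsMonotoneSymmetricNorm f) (j l : Fin n) (a : ℝ≥0) :
    f (Pi.single j a) = f (Pi.single l a) := by
  rw [← hf.symmetric (Pi.single l a) (Equiv.swap j l)]
  congr 1
  funext i
  simp only [Pi.single_apply, Equiv.swap_apply_eq_iff, Equiv.swap_apply_right]

/-- A constant vector is the sum of `n` single-entry vectors, and these all have the same norm. This
is what makes costs of size `δ * M / n` negligible against one cost `M`. -/
theorem const_le (hf : IsMonotoneSymmetricNorm f) (j : Fin n) (a : ℝ≥0) :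
    f (fun _ => a) ≤ n * f (Pi.single j a) := by
  have : (fun _ => a) = ∑ l : Fin n, (Pi.single l a : Fin n → ℝ≥0) := by
    funext i
    simp [Finset.sum_apply, Pi.single_apply]
  rw [this]
  refine (hf.sum_le _ _).trans ?_
  rw [Finset.sum_congr rfl fun l _ => hf.single_eq l j a]
  simp

end IsMonotoneSymmetricNorm

/-! ### The structure of near-optimal assignments -/

section

variable {k n : ℕ} {f : (Fin n → ℝ≥0) → ℝ≥0}

theorem Inst.Feasible.comp_perm {I : Inst k n} {σ : Fin n → Fin k} (h : I.Feasible σ)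
    (π : Equiv.Perm (Fin n)) : I.Feasible (σ ∘ π) := by
  intro i
  refine le_trans (le_of_eq ?_) (h i)
  refine Finset.card_bij (fun j _ => π j) (by simp) (by simp) fun j hj => ⟨π.symm j, ?_, by simp⟩
  simpa using hj

/-- A cheapest feasible assignment that no exchange of two facilities improves. -/
theorem Inst.exists_minimizer (I : Inst k n) (hf : IsMonotoneSymmetricNorm f)
    (hI : ∃ τ, I.Feasible τ) (v : Fin n → Fin k → ℝ≥0) :
    ∃ o, I.Feasible o ∧ (∀ τ, I.Feasible τ → f (fun j => v j (o j)) ≤ f fun j => v j (τ j)) ∧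
      ∀ j j', v j (o j') ≤ v j' (o j') → v j (o j) ≤ v j' (o j) := by
  classical
  -- The norm need not be strictly monotone, so an exchange that lowers one coordinate may leave it
  -- unchanged. Ties are broken by the sum of the costs, which does drop.
  obtain ⟨o, ho, hmin⟩ := Finset.exists_min_image
    (Finset.univ.filter fun τ : Fin n → Fin k => I.Feasible τ)
    (fun τ => toLex (f fun j => v j (τ j), ∑ j, v j (τ j)))
    (by obtain ⟨τ, hτ⟩ := hI; exact ⟨τ, by simpa using hτ⟩)
  simp only [Finset.mem_filter, Finset.mem_univ, true_and, Prod.Lex.toLex_le_toLex] at ho hmin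
  refine ⟨o, ho, fun τ hτ => ?_, fun j j' h => ?_⟩
  · rcases hmin τ hτ with h | h
    · exact h.le
    · exact h.1.le
  · by_contra! hlt
    have hne : j ≠ j' := by rintro rfl; exact lt_irrefl _ hlt
    set π := Equiv.swap j j' with hπ
    have hle : ∀ l, v l (o (π l)) ≤ v (π l) (o (π l)) := by
      intro l
      rcases eq_or_ne l j with rfl | h1
      · simpa [hπ] using h
      rcases eq_or_ne l j' with rfl | h2
      · simpa [hπ] using hlt.le
      · simp [hπ, Equiv.swap_apply_of_ne_of_ne h1 h2]
    have h1 : f (fun l => v l (o (π l))) ≤ f fun j => v j (o j) :=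
      (hf.monotone _ (fun l => v (π l) (o (π l))) hle).trans
        (hf.symmetric (fun l => v l (o l)) π).le
    have h2 : ∑ l, v l (o (π l)) < ∑ l, v l (o l) := by
      rw [← Equiv.sum_comp π fun l => v l (o l)]
      exact Finset.sum_lt_sum (fun l _ => hle l) ⟨j', Finset.mem_univ _, by simpa [hπ] using hlt⟩
    rcases hmin _ (ho.comp_perm π) with h3 | h3
    · exact absurd h1 (not_le.2 h3)
    · exact absurd h2 (not_lt.2 h3.2)

/-- The value of client `j` at facility `i` in terms of the representative `p` of `j`: clients of
the same kind pay the same, except at the facilities that are nearest up to a factor `q`. -/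
def roundedCost (c : Fin n → Fin k → ℝ≥0) (r : Fin n → ℝ≥0) (q : ℝ≥0) (P : Fin n → Fin n)
    (j : Fin n) (i : Fin k) : ℝ≥0 :=
  open Classical in if c (P j) i ≤ q * r (P j) then r j else c (P j) i

/-- The client `j` behaves up to a factor of `h` like the client `p`. -/
def Similar (c : Fin n → Fin k → ℝ≥0) (r : Fin n → ℝ≥0) (q h : ℝ≥0) (j p : Fin n) : Prop :=
  ∀ i, (c p i ≤ q * r p → c j i ≤ h * r j) ∧
    (¬ c p i ≤ q * r p → c j i ≤ h * c p i ∧ c p i ≤ h * c j i)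

/-- The clients of a type are split into those with a small, a medium and a large minimum
distance. -/
def rowOf (r : Fin n → ℝ≥0) (q M : ℝ≥0) (typ : Fin n → ℕ) (s : ℕ → ℕ) (j : Fin n) : ℕ :=
  open Classical in
  3 * typ j + if r j * (q ^ s (typ j) * q) ≤ M then 0 else if r j * q ^ s (typ j) ≤ M then 1 else 2

/-- The remainder of the row number modulo three determines both tests, because for `1 ≤ q` the
first test implies the second. -/
theorem rowOf_eq_iff {r : Fin n → ℝ≥0} {q M : ℝ≥0} {typ : Fin n → ℕ} {s : ℕ → ℕ} {j l : Fin n}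
    (h : rowOf r q M typ s j = rowOf r q M typ s l) (hq : 1 ≤ q) : typ j = typ l ∧
      (r j * (q ^ s (typ j) * q) ≤ M ↔ r l * (q ^ s (typ l) * q) ≤ M) ∧
      (r j * q ^ s (typ j) ≤ M ↔ r l * q ^ s (typ l) ≤ M) := by
  have key : ∀ j, r j * (q ^ s (typ j) * q) ≤ M → r j * q ^ s (typ j) ≤ M := fun j hj =>
    le_trans (by gcongr; exact le_mul_of_one_le_right' hq) hj
  have := key j
  have := key l
  unfold rowOf at h
  split_ifs at h <;> first | omega | (refine ⟨by omega, ?_, ?_⟩ <;> tauto)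

variable {c : Fin n → Fin k → ℝ≥0} {r : Fin n → ℝ≥0} {q h : ℝ≥0} {P : Fin n → Fin n}

theorem cost_le_roundedCost (hsim : ∀ j, Similar c r q h j (P j)) (j : Fin n) (i : Fin k) :
    c j i ≤ h * roundedCost c r q P j i := by
  unfold roundedCost
  split_ifs with hb
  · exact (hsim j i).1 hb
  · exact ((hsim j i).2 hb).1

theorem roundedCost_le_cost (hh : 1 ≤ h) (hr : ∀ j i, r j ≤ c j i)
    (hsim : ∀ j, Similar c r q h j (P j)) (j : Fin n) (i : Fin k) :
    roundedCost c r q P j i ≤ h * c j i := by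
  unfold roundedCost
  split_ifs with hb
  · exact (hr j i).trans (le_mul_of_one_le_left' hh)
  · exact ((hsim j i).2 hb).2

/-- If in every cell `σ` has at most `q` times as many clients as `o`, then the costs of `σ` are
dominated by the costs of `o`, apart from small costs. -/
theorem le_of_cells (hf : IsMonotoneSymmetricNorm f) (hq : 1 ≤ q) {row : Fin n → ℕ}
    {σ o : Fin n → Fin k}
    (hcell : ∀ ρ i, ((Finset.univ.filter fun j => row j = ρ ∧ σ j = i).card : ℝ≥0) ≤
      q * (Finset.univ.filter fun j => row j = ρ ∧ o j = i).card)
    {x v : Fin n → ℝ≥0} {b : ℝ≥0} {special : ℕ → Prop}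
    (hspec : ∀ j, special (row j) → x j ≤ v j)
    (hcom : ∀ j l, ¬ special (row j) → row l = row j → o l = σ j → x j ≤ q * v l + b) :
    f x ≤ q * (q * f v) + f fun _ => b := by
  classical
  set X : Fin n → Finset (Fin n) := fun j => Finset.univ.filter fun l => row l = row j ∧ o l = σ j
    with hX
  have hq0 : (0 : ℝ) < q := by exact_mod_cast lt_of_lt_of_le one_pos hq
  have hX0 : ∀ j, 0 < (X j).card := by
    intro j
    by_contra! h0
    have h1 := hcell (row j) (σ j)
    have h2 : (Finset.univ.filter fun l => row l = row j ∧ o l = σ j).card = 0 := by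
      simpa [hX] using h0
    rw [h2] at h1
    have h3 : (Finset.univ.filter fun l => row l = row j ∧ σ l = σ j).card = 0 := by
      have : ((Finset.univ.filter fun l => row l = row j ∧ σ l = σ j).card : ℝ≥0) = 0 := by
        simpa using h1
      exact_mod_cast this
    rw [Finset.card_eq_zero] at h3
    have : j ∈ (∅ : Finset (Fin n)) := by rw [← h3]; simp
    simp at this
  -- Client `j` distributes the weight `1 / q` evenly among the clients of `o` in the cell to which
  -- `σ` assigns `j`. In special rows it keeps the weight, since there its cost is compared with its
  -- own cost under `o`.
  set D : Fin n → Fin n → ℝ := fun j l =>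
    if special (row j) then if l = j then 1 / (q : ℝ) else 0
    else if l ∈ X j then 1 / (q * (X j).card : ℝ) else 0 with hD
  have hsum : ∀ j, ∑ l, D j l = 1 / q := by
    intro j
    simp only [hD]
    split_ifs with hs
    · simp
    · rw [← Finset.sum_filter, Finset.sum_const]
      have : (Finset.univ.filter fun l => l ∈ X j) = X j := by ext; simp
      have h0 : ((X j).card : ℝ) ≠ 0 := by exact_mod_cast (hX0 j).ne'
      rw [this]
      field_simp
      simp
      field_simp
  have hq1 : 1 / (q : ℝ) ≤ 1 := by
    rw [div_le_one hq0]; exact_mod_cast hq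
  have hcol : ∀ l, ∑ j, D j l ≤ 1 := by
    intro l
    by_cases hs : special (row l)
    · calc ∑ j, D j l = ∑ j, if j = l then 1 / (q : ℝ) else 0 := by
            refine Finset.sum_congr rfl fun j _ => ?_
            simp only [hD]
            by_cases hj : j = l
            · subst hj; simp [hs]
            · rw [if_neg hj]
              split_ifs with h1 h2 h2
              · exact absurd h2.symm hj
              · rfl
              · simp only [hX, Finset.mem_filter] at h2
                exact absurd (h2.2.1 ▸ hs) h1
              · rfl
        _ ≤ 1 := by simpa using hq1
    -- Weight arrives at `l` only from the clients `Y` that `σ` puts into the cell of `l`. There are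
    -- at most `q * Z.card` of them, and each sends `1 / (q * Z.card)`.
    · set Y := Finset.univ.filter fun j => row j = row l ∧ σ j = o l with hY
      set Z := Finset.univ.filter fun j => row j = row l ∧ o j = o l with hZ
      calc ∑ j, D j l = ∑ j, if j ∈ Y then 1 / (q * Z.card : ℝ) else 0 := by
            refine Finset.sum_congr rfl fun j _ => ?_
            simp only [hD]
            by_cases hj : row j = row l
            · rw [if_neg (hj ▸ hs)]
              by_cases hj2 : σ j = o l
              · have e1 : l ∈ X j := by simp [hX, hj, hj2]
                have e2 : j ∈ Y := by simp [hY, hj, hj2]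
                have e3 : X j = Z := by ext; simp [hX, hZ, hj, hj2]
                rw [if_pos e1, if_pos e2, e3]
              · have e1 : l ∉ X j := by
                  simp only [hX, Finset.mem_filter, not_and]; exact fun _ _ h => hj2 h.symm
                have e2 : j ∉ Y := by simp [hY, hj2]
                rw [if_neg e1, if_neg e2]
            · have e1 : l ∉ X j := by
                simp only [hX, Finset.mem_filter, not_and]; exact fun _ h => absurd h.symm hj
              have e2 : j ∉ Y := by simp [hY, hj]
              have e3 : l ≠ j := by rintro rfl; exact hj rfl
              rw [if_neg e1, if_neg e2, if_neg e3, ite_self]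
        _ = Y.card / (q * Z.card : ℝ) := by
            rw [← Finset.sum_filter, Finset.sum_const]
            have : (Finset.univ.filter fun j => j ∈ Y) = Y := by ext; simp
            rw [this]; simp [div_eq_mul_inv]
        _ ≤ 1 := by
            refine div_le_one_of_le₀ ?_ (by positivity)
            exact_mod_cast hcell (row l) (o l)
  have h0 : ∀ j l, 0 ≤ D j l := by
    intro j l
    simp only [hD]
    split_ifs <;> positivity
  -- One factor `q` makes up for the row sums `1 / q`, the other is the loss in `hcom`.
  have key : ∀ j, (x j : ℝ) ≤ q * (q * ∑ l, D j l * v l) + b := by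
    intro j
    by_cases hs : special (row j)
    · have e : ∑ l, D j l * v l = 1 / q * v j := by
        simp [hD, hs, ite_mul]
      rw [e]
      have e1 : (x j : ℝ) ≤ v j := by exact_mod_cast hspec j hs
      have e2 : (1 : ℝ) ≤ q := by exact_mod_cast hq
      have e3 : (q : ℝ) * (q * (1 / q * v j)) = q * v j := by field_simp
      rw [e3]
      nlinarith [(v j).2, b.2, mul_le_mul_of_nonneg_right e2 (v j).2]
    · have e : (x j : ℝ) = q * ∑ l, D j l * x j := by
        rw [← Finset.sum_mul, hsum]; field_simp
      have e' : (b : ℝ) = q * ∑ l, D j l * b := by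
        rw [← Finset.sum_mul, hsum]; field_simp
      have e'' : q * ∑ l, D j l * (v l : ℝ) = ∑ l, D j l * (q * v l) := by
        rw [Finset.mul_sum]; exact Finset.sum_congr rfl fun l _ => by ring
      rw [e, e', ← mul_add, e'', ← Finset.sum_add_distrib]
      gcongr with l
      by_cases hl : l ∈ X j
      · simp only [hX, Finset.mem_filter] at hl
        have : (x j : ℝ) ≤ q * v l + b := by exact_mod_cast hcom j l hs hl.2.1 hl.2.2
        rw [← mul_add]
        exact mul_le_mul_of_nonneg_left this (h0 j l)
      · simp [hD, hs, hl]
  let y : Fin n → ℝ≥0 := fun j => (∑ l, D j l * (v l : ℝ)).toNNReal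
  have hy : ∀ j, (y j : ℝ) = ∑ l, D j l * v l := fun j =>
    Real.coe_toNNReal _ (Finset.sum_nonneg fun l _ => mul_nonneg (h0 j l) (v l).2)
  have h1 : f y ≤ f v :=
    hf.le_of_substochastic h0 (fun j => (hsum j).trans_le hq1) hcol fun j => (hy j).le
  have h2 : x ≤ q • q • y + fun _ => b := by
    intro j
    rw [← NNReal.coe_le_coe]
    simpa [hy] using key j
  calc f x ≤ f (q • q • y + fun _ => b) := hf.monotone _ _ h2
    _ ≤ f (q • q • y) + f fun _ => b := hf.subadditive _ _
    _ ≤ _ := by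
      rw [hf.homogeneous, hf.homogeneous]
      gcongr

/-- The assignments that are worth a guess. -/
theorem Inst.exists_guide (I : Inst k n) (hf : IsMonotoneSymmetricNorm f) (hn : 0 < n)
    (hI : ∃ τ, I.Feasible τ) {δ : ℝ≥0} (hq : 1 ≤ q) (hh : 1 ≤ h)
    (hc : ∀ j i, c j i = I.d (Sum.inr j) (Sum.inl i)) (hr : ∀ j i, r j ≤ c j i)
    {typ : Fin n → ℕ} (htyp : ∀ j l, typ j = typ l → P j = P l)
    (hsim : ∀ j, Similar c r q h j (P j)) {S : ℕ} (hS : (n : ℝ≥0) ≤ q ^ S * δ) :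
    ∃ (j₀ : Fin n) (i₀ : Fin k) (s : ℕ → ℕ) (o : Fin n → Fin k), (∀ t, s t ≤ S) ∧ I.Feasible o ∧
      ∀ σ : Fin n → Fin k,
        (∀ ρ i,
          ((Finset.univ.filter fun j => rowOf r q (c j₀ i₀) typ s j = ρ ∧ σ j = i).card : ℝ≥0) ≤
            q * (Finset.univ.filter fun j => rowOf r q (c j₀ i₀) typ s j = ρ ∧ o j = i).card) →
        ∀ τ, I.Feasible τ →
          f (I.connection σ) ≤ h * (h * (q * q + δ * h)) * f (I.connection τ) := by
  classical
  obtain ⟨o, ho, hmin, hex⟩ := I.exists_minimizer hf hI (roundedCost c r q P)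
  have : Nonempty (Fin n) := ⟨⟨0, hn⟩⟩
  obtain ⟨j₀, hj₀⟩ := Finite.exists_max fun j => c j (o j)
  set M := c j₀ (o j₀) with hM
  let B : Fin n → Prop := fun j => c (P j) (o j) ≤ q * r (P j)
  let T : ℕ → ℕ → Prop := fun t e => ∀ j, typ j = t → B j → r j * q ^ e ≤ M
  -- The threshold of type `t`: up to a factor `q`, the number `M / q ^ s t` is the largest `r j`
  -- among the clients of the type at near facilities, unless that is below `M / q ^ S`.
  let s : ℕ → ℕ := fun t => Nat.findGreatest (T t) S
  have hs0 : ∀ t, T t (s t) := by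
    intro t
    refine Nat.findGreatest_spec (P := T t) (Nat.zero_le S) ?_
    intro j _ _
    simpa using (hr j (o j)).trans (hj₀ j)
  have hs1 : ∀ t, s t < S → ∃ j, typ j = t ∧ B j ∧ M < r j * q ^ (s t + 1) := by
    intro t ht
    have := Nat.findGreatest_is_greatest (P := T t) (Nat.lt_succ_self (s t)) ht
    simp only [T] at this
    push Not at this
    exact this
  -- At the far facility of `l` both clients pay the same rounded cost, so stability of `o` forbids
  -- that `l` would be cheaper than `j` at the near facility of `j`.
  have hexch : ∀ j l, typ j = typ l → B j → ¬ B l → r j ≤ r l := by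
    intro j l hjl hj hl
    have hP := htyp j l hjl
    have e1 : roundedCost c r q P j (o l) = roundedCost c r q P l (o l) := by
      simp only [roundedCost, hP]
      rw [if_neg hl, if_neg hl]
    have e2 := hex j l e1.le
    have hj' : c (P l) (o j) ≤ q * r (P l) := hP ▸ hj
    simpa only [roundedCost, if_pos hj', if_pos (show c (P j) (o j) ≤ q * r (P j) from hj)] using e2
  refine ⟨j₀, o j₀, s, o, fun t => Nat.findGreatest_le S, ho, fun σ hσ τ hτ => ?_⟩
  rw [← hM] at hσ
  set row := rowOf r q M typ s with hrow
  -- By maximality of `s` some client of the type at a near facility exceeds the next threshold. A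
  -- small client at a far facility would have an even larger `r` by `hexch`.
  have hlow : ∀ j, r j * (q ^ s (typ j) * q) ≤ M → s (typ j) < S → B j := by
    intro j hj hlt
    by_contra hB
    obtain ⟨l, hl1, hl2, hl3⟩ := hs1 _ hlt
    have h1 := hexch l j hl1 hl2 hB
    have h2 : r l * q ^ (s (typ j) + 1) ≤ r j * (q ^ s (typ j) * q) := by
      rw [pow_succ]; gcongr
    exact absurd (hl3.trans_le (h2.trans hj)) (lt_irrefl _)
  have hnc : (0 : ℝ≥0) < n := by exact_mod_cast hn
  have main := le_of_cells (x := fun j => roundedCost c r q P j (σ j))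
    (v := fun j => roundedCost c r q P j (o j)) (b := δ * M / n)
    (special := fun ρ => ∃ l, row l = ρ ∧ r l * (q ^ s (typ l) * q) ≤ M ∧ s (typ l) < S) hf hq hσ
    (by
      rintro j ⟨l, h1, h2, h3⟩
      have e := rowOf_eq_iff h1 hq
      rw [e.1] at h3
      have hj := e.2.1.1 h2
      have hBj := hlow j hj h3
      -- The cell of `j` under `σ` is nonempty, hence so is the same cell under `o`. Its clients are
      -- small and thus at a near facility, so `σ j` is near as well, and `j` pays `r j` under both
      -- assignments.
      have hpos : 0 < (Finset.univ.filter fun l => row l = row j ∧ o l = σ j).card := by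
        by_contra! h0
        have h1 := hσ (row j) (σ j)
        rw [Nat.le_zero.1 h0] at h1
        have h3 : (Finset.univ.filter fun l => row l = row j ∧ σ l = σ j).card = 0 := by
          have : ((Finset.univ.filter fun l => row l = row j ∧ σ l = σ j).card : ℝ≥0) = 0 := by
            simpa using h1
          exact_mod_cast this
        rw [Finset.card_eq_zero] at h3
        have : j ∈ (∅ : Finset (Fin n)) := by rw [← h3]; simp
        simp at this
      obtain ⟨l', hl'⟩ := Finset.card_pos.1 hpos
      simp only [Finset.mem_filter, Finset.mem_univ, true_and] at hl'
      have e' := rowOf_eq_iff hl'.1 hq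
      have hB' := hlow l' (e'.2.1.2 hj) (e'.1 ▸ h3)
      have hB'' : c (P j) (σ j) ≤ q * r (P j) := by
        have := htyp _ _ e'.1
        simp only [B, hl'.2, this] at hB'
        exact hB'
      simp only [roundedCost, if_pos hB'', if_pos (show c (P j) (o j) ≤ q * r (P j) from hBj)]
      exact le_rfl)
    (by
      intro j l hj hl1 hl2
      have e := rowOf_eq_iff hl1 hq
      have hP := htyp _ _ e.1
      simp only [roundedCost, hl2, hP]
      split_ifs with hb
      · have hBl : B l := by simp only [B, hl2, hP]; exact hb
        have h1 := e.2.2.1 (hs0 _ l rfl hBl)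
        -- For `s < S` the row is the medium one, where all `r` agree up to the factor `q`. For `s =
        -- S` the cost itself is at most `M / q ^ S ≤ δ * M / n`.
        by_cases hlt : s (typ j) < S
        · have h2 : ¬ r j * (q ^ s (typ j) * q) ≤ M := fun h => hj ⟨j, rfl, h, hlt⟩
          have h3 : ¬ r l * (q ^ s (typ l) * q) ≤ M := fun h => h2 (e.2.1.1 h)
          rw [e.1] at h3
          push Not at h3
          have h4 : r j * q ^ s (typ j) ≤ (q * r l) * q ^ s (typ j) :=
            h1.trans (h3.le.trans (le_of_eq (by ring)))
          have h5 : 0 < q ^ s (typ j) := pow_pos (lt_of_lt_of_le one_pos hq) _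
          exact (le_of_mul_le_mul_right h4 h5).trans le_self_add
        · have hS' : s (typ j) = S := le_antisymm (Nat.findGreatest_le S) (not_lt.1 hlt)
          rw [hS'] at h1
          refine le_trans ?_ le_add_self
          rw [le_div_iff₀ hnc]
          calc r j * n ≤ r j * (q ^ S * δ) := by gcongr
            _ = δ * (r j * q ^ S) := by ring
            _ ≤ δ * M := by gcongr
      · exact (le_mul_of_one_le_left' hq).trans le_self_add)
  have hM1 : M * f (Pi.single j₀ 1) ≤ f fun j => c j (o j) := by
    rw [← hf.homogeneous]
    refine hf.monotone _ _ fun j => ?_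
    by_cases hj : j = j₀
    · subst hj; simp [hM]
    · simp [hj]
  have hb : f (fun _ => δ * M / n) ≤ δ * (h * f fun j => roundedCost c r q P j (o j)) := by
    have e1 : (Pi.single j₀ (δ * M / n) : Fin n → ℝ≥0) = (δ * M / n) • Pi.single j₀ 1 := by
      rw [← Pi.single_smul]; simp
    calc f (fun _ => δ * M / n) ≤ n * f (Pi.single j₀ (δ * M / n)) := hf.const_le j₀ _
      _ = δ * (M * f (Pi.single j₀ 1)) := by
        rw [e1, hf.homogeneous]; field_simp
      _ ≤ δ * f (fun j => c j (o j)) := by gcongr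
      _ ≤ δ * f (h • fun j => roundedCost c r q P j (o j)) := by
        gcongr
        exact hf.monotone _ _ fun j => cost_le_roundedCost hsim j (o j)
      _ = _ := by rw [hf.homogeneous]
  calc f (I.connection σ) ≤ f (h • fun j => roundedCost c r q P j (σ j)) :=
        hf.monotone _ _ fun j => by
          have := cost_le_roundedCost hsim j (σ j)
          rw [hc] at this
          exact this
    _ = h * f fun j => roundedCost c r q P j (σ j) := hf.homogeneous _ _
    _ ≤ h * (q * (q * f fun j => roundedCost c r q P j (o j)) +
          δ * (h * f fun j => roundedCost c r q P j (o j))) := by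
        gcongr
        exact main.trans (by gcongr)
    _ = h * (q * q + δ * h) * f fun j => roundedCost c r q P j (o j) := by ring
    _ ≤ h * (q * q + δ * h) * f (h • I.connection τ) := by
        gcongr
        refine (hmin τ hτ).trans (hf.monotone _ _ fun j => ?_)
        have := roundedCost_le_cost hh hr hsim j (τ j)
        rw [hc] at this
        exact this
    _ = _ := by rw [hf.homogeneous]; ring

end

/-! ### Augmentation of count matrices -/

/-- The moves in direction of `z` that change every entry by at most one. -/
def Conformal {A B : Type*} (z δ : A → B → ℤ) : Prop :=
  ∀ a b, δ a b = 0 ∨ (δ a b = 1 ∧ 0 < z a b) ∨ (δ a b = -1 ∧ z a b < 0)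

section

variable {A B : Type*} [Fintype A] [Fintype B] [DecidableEq A] [DecidableEq B]

/-- The columns from which a unit can be shifted to a column in `C` by `m` conformal exchanges
within rows. -/
def reachCols (z : A → B → ℤ) (C : Set B) : ℕ → Set B
  | 0 => C
  | m + 1 => reachCols z C m ∪ {b | ∃ a, ∃ b' ∈ reachCols z C m, z a b < 0 ∧ 0 < z a b'}

/-- An exchange path is built backwards from a column of `C`. When a new column `b` is put in front,
the move so far vanishes in column `b`; in the old first column it is nonpositive, so at the entry
with positive `z` it vanishes by conformality. Hence the new exchange changes two untouched entries.
-/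
theorem exists_shift (z : A → B → ℤ) (C : Set B) (m : ℕ) :
    ∀ b ∈ reachCols z C m, ∃ δ : A → B → ℤ, Conformal z δ ∧
      (∀ a, ∀ b' ∉ reachCols z C m, δ a b' = 0) ∧ (∀ a, δ a b ≤ 0) ∧ (∀ a, ∑ l, δ a l = 0) ∧
      ∃ e ∈ C, ∀ l, ∑ a, δ a l = (if l = e then 1 else 0) - if l = b then 1 else 0 := by
  induction m with
  | zero =>
    intro b hb
    exact ⟨fun _ _ => 0, fun _ _ => .inl rfl, by simp, by simp, by simp, b, hb, by simp⟩
  | succ m ih =>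
    intro b hb
    by_cases hbm : b ∈ reachCols z C m
    · obtain ⟨δ, h1, h2, h3⟩ := ih b hbm
      exact ⟨δ, h1, fun a b' hb' => h2 a b' fun h => hb' (.inl h), h3⟩
    obtain ⟨a₀, b₁, hb₁, hz, hz₁⟩ := hb.resolve_left hbm
    obtain ⟨δ, h1, h2, h3, h4, e, he, h5⟩ := ih b₁ hb₁
    have hne : b ≠ b₁ := by rintro rfl; exact hbm hb₁
    refine ⟨fun a l => δ a l + ((if a = a₀ ∧ l = b₁ then 1 else 0) -
      if a = a₀ ∧ l = b then 1 else 0), ?_, ?_, ?_, ?_, e, he, ?_⟩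
    · intro a l
      by_cases c1 : a = a₀ ∧ l = b₁
      · obtain ⟨rfl, rfl⟩ := c1
        have e1 : δ a l = 0 := by
          rcases h1 a l with h | h | h
          · exact h
          · have := h3 a; omega
          · omega
        simp [e1, hne.symm, hz₁]
      · by_cases c2 : a = a₀ ∧ l = b
        · obtain ⟨rfl, rfl⟩ := c2
          have e1 := h2 a l hbm
          simp [e1, hne, hz]
        · simpa [c1, c2] using h1 a l
    · intro a l hl
      have e1 : l ≠ b := by rintro rfl; exact hl hb
      have e2 : l ≠ b₁ := by rintro rfl; exact hl (.inl hb₁)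
      simp [e1, e2, h2 a l fun h => hl (.inl h)]
    · intro a
      have := h2 a b hbm
      simp only [this, hne, and_false, if_false, and_true]
      split_ifs <;> simp
    · intro a
      rw [Finset.sum_add_distrib, h4, Finset.sum_sub_distrib]
      by_cases ha : a = a₀ <;> simp [ha]
    · intro l
      rw [Finset.sum_add_distrib, h5, Finset.sum_sub_distrib]
      have e1 : ∀ c, ∑ a, (if a = a₀ ∧ l = c then (1 : ℤ) else 0) = if l = c then 1 else 0 := by
        intro c
        by_cases hl : l = c <;> simp [hl]
      rw [e1, e1]
      ring

/-- This is the augmenting path theorem for transportation problems: a unit is added in a row with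
slack, at a column from which the excess can be shifted to a column with slack. Without such a path,
the reachable columns give a cut that contradicts the larger sum of `y`. -/
theorem exists_augmentation {x y : A → B → ℤ} {N : A → ℤ} {u : B → ℤ}
    (hxN : ∀ a, ∑ b, x a b ≤ N a) (hyN : ∀ a, ∑ b, y a b ≤ N a)
    (hxu : ∀ b, ∑ a, x a b ≤ u b) (hyu : ∀ b, ∑ a, y a b ≤ u b)
    (hlt : ∑ a, ∑ b, x a b < ∑ a, ∑ b, y a b) :
    ∃ δ : A → B → ℤ, Conformal (fun a b => y a b - x a b) δ ∧
      (∀ a, ∑ b, (x a b + δ a b) ≤ N a) ∧ (∀ b, ∑ a, (x a b + δ a b) ≤ u b) ∧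
      ∑ a, ∑ b, (x a b + δ a b) = ∑ a, ∑ b, x a b + 1 := by
  classical
  set z : A → B → ℤ := fun a b => y a b - x a b with hz
  set C : Set B := {b | ∑ a, x a b < u b} with hC
  by_cases hex : ∃ a₀, ∑ b, x a₀ b < N a₀ ∧ ∃ m, ∃ b ∈ reachCols z C m, 0 < z a₀ b
  · obtain ⟨a₀, ha₀, m, b₀, hb₀, hz₀⟩ := hex
    obtain ⟨δ, h1, h2, h3, h4, e, he, h5⟩ := exists_shift z C m b₀ hb₀
    have hs : ∀ a, ∑ l, (if a = a₀ ∧ l = b₀ then (1 : ℤ) else 0) = if a = a₀ then 1 else 0 := by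
      intro a
      by_cases ha : a = a₀ <;> simp [ha]
    have hs' : ∀ l, ∑ a, (if a = a₀ ∧ l = b₀ then (1 : ℤ) else 0) = if l = b₀ then 1 else 0 := by
      intro l
      by_cases hl : l = b₀ <;> simp [hl]
    refine ⟨fun a l => δ a l + if a = a₀ ∧ l = b₀ then 1 else 0, ?_, ?_, ?_, ?_⟩
    · intro a l
      by_cases c1 : a = a₀ ∧ l = b₀
      · obtain ⟨rfl, rfl⟩ := c1
        have e1 : δ a l = 0 := by
          rcases h1 a l with h | h | h
          · exact h
          · have := h3 a; omega
          · omega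
        simp [e1, hz₀]
      · simpa [c1] using h1 a l
    · intro a
      rw [Finset.sum_add_distrib, Finset.sum_add_distrib, h4, hs]
      have := hxN a
      split_ifs with ha
      · subst ha; omega
      · omega
    · intro b
      rw [Finset.sum_add_distrib, Finset.sum_add_distrib, h5, hs']
      have := hxu b
      by_cases hb : b = e
      · subst hb
        have : ∑ a, x a b < u b := he
        split_ifs <;> omega
      · rw [if_neg hb]
        split_ifs <;> omega
    · simp only [Finset.sum_add_distrib, h4, hs]
      simp
  · exfalso
    push Not at hex
    set D : Set B := {b | ∃ m, b ∈ reachCols z C m} with hD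
    have hmono : ∀ m, reachCols z C m ⊆ reachCols z C (m + 1) := fun m => Set.subset_union_left
    set R : Set A := {a | ∃ b ∈ D, 0 < z a b} with hR
    have hR1 : ∀ a ∈ R, ∑ b, z a b ≤ 0 := by
      rintro a ⟨b, ⟨m, hb⟩, hab⟩
      have h1 : N a ≤ ∑ b, x a b := by
        by_contra! h
        exact absurd hab (not_lt.2 (hex a h m b hb))
      have h2 := hyN a
      simp only [hz, Finset.sum_sub_distrib]
      omega
    have hD1 : ∀ b ∉ D, ∑ a, z a b ≤ 0 := by
      intro b hb
      have h1 : ¬ ∑ a, x a b < u b := fun h => hb ⟨0, h⟩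
      have h2 := hyu b
      simp only [hz, Finset.sum_sub_distrib]
      omega
    have hRD : ∀ a ∈ R, ∀ b ∉ D, 0 ≤ z a b := by
      rintro a ⟨b', ⟨m, hb'⟩, hab'⟩ b hb
      by_contra! h
      exact hb ⟨m + 1, .inr ⟨a, b', hb', h, hab'⟩⟩
    have hRD' : ∀ a ∉ R, ∀ b ∈ D, z a b ≤ 0 := by
      intro a ha b hb
      by_contra! h
      exact ha ⟨b, hb, h⟩
    have htot : 0 < ∑ a, ∑ b, z a b := by
      simp only [hz, Finset.sum_sub_distrib]
      omega
    -- Rows in `R` and columns outside `D` are saturated by `x`. Their contributions cover every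
    -- entry except those outside `R` in `D`, which are nonpositive, and count those in `R` outside
    -- `D` twice, which are nonnegative.
    have hpt : ∀ a b, z a b ≤ (if a ∈ R then z a b else 0) + (if b ∈ D then 0 else z a b) := by
      intro a b
      by_cases ha : a ∈ R <;> by_cases hb : b ∈ D <;> simp only [ha, hb, if_true, if_false]
      · omega
      · have := hRD a ha b hb; omega
      · have := hRD' a ha b hb; omega
      · omega
    have h1 : ∑ a, ∑ b, (if a ∈ R then z a b else 0) ≤ 0 := by
      refine Finset.sum_nonpos fun a _ => ?_
      by_cases ha : a ∈ R
      · simpa [ha] using hR1 a ha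
      · simp [ha]
    have h2 : ∑ a, ∑ b, (if b ∈ D then 0 else z a b) ≤ 0 := by
      rw [Finset.sum_comm]
      refine Finset.sum_nonpos fun b _ => ?_
      by_cases hb : b ∈ D
      · simp [hb]
      · simpa [hb] using hD1 b hb
    have h3 : ∑ a, ∑ b, z a b ≤ ∑ a, ∑ b, (if a ∈ R then z a b else 0) +
        ∑ a, ∑ b, (if b ∈ D then 0 else z a b) := by
      simp only [← Finset.sum_add_distrib]
      exact Finset.sum_le_sum fun a _ => Finset.sum_le_sum fun b _ => hpt a b
    omega

end

/-- `x` respects the bounds `U` of its entries, `N` of its row sums and `u` of its column sums. -/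
structure CountMatrix (R k : ℕ) (U : ℕ → ℕ → ℕ → Prop) (N u : ℕ → ℕ) (x : ℕ → ℕ → ℕ) : Prop where
  entry : ∀ a < R, ∀ b < k, U a b (x a b)
  row : ∀ a < R, ∑ b ∈ Finset.range k, x a b ≤ N a
  col : ∀ b < k, ∑ a ∈ Finset.range R, x a b ≤ u b

/-- The sum of all entries. -/
def total (R k : ℕ) (x : ℕ → ℕ → ℕ) : ℕ := ∑ a ∈ Finset.range R, ∑ b ∈ Finset.range k, x a b

/-- A move is stored as digits `e = δ + 1`, and `1 ≤ x + e` keeps the truncated subtraction honest.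
Conformality places each new entry between `x` and `y`, so downward closed bounds `U` of the entries
are preserved. -/
theorem CountMatrix.exists_augmentation {R k : ℕ} {U : ℕ → ℕ → ℕ → Prop} {N u : ℕ → ℕ}
    {x y : ℕ → ℕ → ℕ} (hU : ∀ a b v w, v ≤ w → U a b w → U a b v) (hx : CountMatrix R k U N u x)
    (hy : CountMatrix R k U N u y) (hlt : total R k x < total R k y) :
    ∃ e : ℕ → ℕ → ℕ, (∀ a b, e a b < 3) ∧ (∀ a < R, ∀ b < k, 1 ≤ x a b + e a b) ∧
      CountMatrix R k U N u (fun a b => x a b + e a b - 1) ∧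
      total R k x < total R k fun a b => x a b + e a b - 1 := by
  obtain ⟨δ, h1, h2, h3, h4⟩ := CapClustering.exists_augmentation (A := Fin R) (B := Fin k)
    (x := fun a b => (x a b : ℤ)) (y := fun a b => (y a b : ℤ)) (N := fun a => N a)
    (u := fun b => u b)
    (fun a => by
      have := hx.row a a.2; rw [Finset.sum_range] at this; exact_mod_cast this)
    (fun a => by
      have := hy.row a a.2; rw [Finset.sum_range] at this; exact_mod_cast this)
    (fun b => by
      have := hx.col b b.2; rw [Finset.sum_range] at this; exact_mod_cast this)
    (fun b => by
      have := hy.col b b.2; rw [Finset.sum_range] at this; exact_mod_cast this)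
    (by
      simp only [total, Finset.sum_range] at hlt
      exact_mod_cast hlt)
  let e : ℕ → ℕ → ℕ := fun a b =>
    if h : a < R ∧ b < k then (δ ⟨a, h.1⟩ ⟨b, h.2⟩ + 1).toNat else 0
  have he : ∀ (a : Fin R) (b : Fin k), e a b = (δ a b + 1).toNat := fun a b => by
    simp [e, a.2, b.2]
  have hval : ∀ (a : Fin R) (b : Fin k), ((x a b + e a b - 1 : ℕ) : ℤ) = x a b + δ a b ∧
      1 ≤ x a b + e a b := by
    intro a b
    rw [he]
    have := h1 a b
    simp only at this
    omega
  refine ⟨e, ?_, fun a ha b hb => (hval ⟨a, ha⟩ ⟨b, hb⟩).2, ⟨?_, ?_, ?_⟩, ?_⟩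
  · intro a b
    by_cases h : a < R ∧ b < k
    · have := h1 ⟨a, h.1⟩ ⟨b, h.2⟩
      simp only [e, dif_pos h]
      omega
    · simp [e, h]
  · intro a ha b hb
    have e1 := (hval ⟨a, ha⟩ ⟨b, hb⟩).1
    have e2 := h1 ⟨a, ha⟩ ⟨b, hb⟩
    simp only at e1 e2
    by_cases hle : x a b + e a b - 1 ≤ x a b
    · exact hU _ _ _ _ hle (hx.entry a ha b hb)
    · exact hU _ _ _ _ (by omega) (hy.entry a ha b hb)
  · intro a ha
    have := h2 ⟨a, ha⟩
    rw [Finset.sum_congr rfl fun b _ => (hval ⟨a, ha⟩ b).1.symm] at this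
    rw [Finset.sum_range]
    exact_mod_cast this
  · intro b hb
    have := h3 ⟨b, hb⟩
    rw [Finset.sum_congr rfl fun a _ => (hval a ⟨b, hb⟩).1.symm] at this
    rw [Finset.sum_range]
    exact_mod_cast this
  · simp only [← (hval _ _).1] at h4
    simp only [total, Finset.sum_range]
    have : ((∑ a : Fin R, ∑ b : Fin k, (x a b + e a b - 1) : ℕ) : ℤ) =
      ((∑ a : Fin R, ∑ b : Fin k, x a b : ℕ) : ℤ) + 1 := by
      rw [Nat.cast_sum, Nat.cast_sum]
      simp only [Nat.cast_sum]
      exact h4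
    omega

/-! ### The number of types of clients -/

section

variable {k n : ℕ} {c : Fin n → Fin k → ℝ} {D : Fin k → Fin k → ℝ} {δ : ℝ} {K : ℕ}

/-- The distances of `j` and `p` to the facilities compare in the same way with the multiples of
the distances between facilities. -/
def SameSignature (c : Fin n → Fin k → ℝ) (D : Fin k → Fin k → ℝ) (δ : ℝ) (K : ℕ) (j p : Fin n) :
    Prop :=
  ∀ i l, ∀ s ≤ K, δ / 4 * (1 + δ) ^ s * D i l ≤ c j i ↔ δ / 4 * (1 + δ) ^ s * D i l ≤ c p i

theorem SameSignature.symm {j p : Fin n} (h : SameSignature c D δ K j p) :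
    SameSignature c D δ K p j := fun i l s hs => (h i l s hs).symm

/-- A distance in the window between the first and the last multiple of `D i l` lies between two
consecutive multiples, and the signature pins `c p i` from below by the lower one. -/
theorem SameSignature.le_mul {j p : Fin n} (h : SameSignature c D δ K j p) {i l : Fin k}
    (h0 : δ / 4 * D i l ≤ c j i) (hK : c j i < δ / 4 * (1 + δ) ^ K * D i l) (hδ : 0 < δ) :
    c j i ≤ (1 + δ) * c p i := by
  classical
  have hex : ∃ s, c j i < δ / 4 * (1 + δ) ^ s * D i l := ⟨K, hK⟩
  have hle : Nat.find hex ≤ K := Nat.find_min' hex hK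
  have hpos : Nat.find hex ≠ 0 := by
    intro h0'
    have := Nat.find_spec hex
    rw [h0'] at this
    simp only [pow_zero, mul_one] at this
    linarith
  obtain ⟨s, hs⟩ := Nat.exists_eq_succ_of_ne_zero hpos
  have h1 := Nat.find_spec hex
  have h2 := Nat.find_min hex (m := s) (by omega)
  rw [hs, Nat.succ_eq_add_one, pow_succ] at h1
  have h3 := (h i l s (by omega)).1 (not_lt.1 h2)
  nlinarith

/-- If `c j i` is tiny compared with `D i l`, then `l` is much farther away than `i`. If it is huge,
then `D i l` is at most `δ / 4 * c j i` and both facilities are almost equally far. In either case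
`i` loses almost nothing against `l`, so a facility outside all windows is nearly a nearest one. -/
theorem le_mul_of_far {j : Fin n} {i : Fin k} (hδ : 0 < δ) (hδ1 : δ ≤ 1 / 16)
    (h1 : ∀ j i l, c j i ≤ D i l + c j l) (h2 : ∀ j i l, D i l ≤ c j i + c j l)
    (hc : ∀ j i, 0 ≤ c j i) (hK : 16 ≤ δ ^ 2 * (1 + δ) ^ K)
    (hfar : ∀ l, c j i < δ / 4 * D i l ∨ δ / 4 * (1 + δ) ^ K * D i l ≤ c j i) (l : Fin k) :
    c j i ≤ (1 + δ) * c j l := by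
  have e1 := h1 j i l
  have e2 := h2 j i l
  have e3 := hc j l
  have e4 := hc j i
  rcases hfar l with h | h
  · nlinarith
  · have hD : 4 * D i l ≤ δ * c j i := by
      by_cases hD : D i l ≤ 0
      · nlinarith [mul_nonneg hδ.le e4]
      · push Not at hD
        nlinarith [mul_le_mul_of_nonneg_right hK hD.le, mul_le_mul_of_nonneg_left h hδ.le]
    have e5 : c j i * (1 - δ / 4) ≤ c j l := by linarith
    have e6 : 0 ≤ δ * c j i * (3 / 4 - δ / 4) := by
      have : 0 ≤ 3 / 4 - δ / 4 := by linarith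
      positivity
    nlinarith [mul_le_mul_of_nonneg_left e5 (show 0 ≤ 1 + δ by linarith)]

/-- Outside all windows of `j` the facility `i` is nearly nearest anyway. Inside one, `c j i` is
compared with `c p i`, then with `c p l`, then with `c j l`, each at a loss of `1 + δ`, provided `c
j l` lies in the window of `D l i`. -/
theorem SameSignature.le_of_near {j p : Fin n} (h : SameSignature c D δ K j p) (hδ : 0 < δ)
    (hδ1 : δ ≤ 1 / 16) (h1 : ∀ j i l, c j i ≤ D i l + c j l)
    (h2 : ∀ j i l, D i l ≤ c j i + c j l) (hD : ∀ i l, D i l = D l i)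
    (hc : ∀ j i, 0 ≤ c j i) (hK : 16 ≤ δ ^ 2 * (1 + δ) ^ K) {i l : Fin k}
    (hp : c p i ≤ (1 + δ) * c p l) :
    c j i ≤ (1 + δ) * (1 + δ) * (1 + δ) * c j l := by
  have e3 := hc j l
  have e4 := hc j i
  have e5 : 1 ≤ (1 + δ) * (1 + δ) := by nlinarith
  have e6 : (1 + δ) * c j l ≤ (1 + δ) * (1 + δ) * (1 + δ) * c j l := by
    have : 0 ≤ (1 + δ) * c j l := by positivity
    nlinarith
  by_cases hi : ∀ l, c j i < δ / 4 * D i l ∨ δ / 4 * (1 + δ) ^ K * D i l ≤ c j i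
  · exact (le_mul_of_far hδ hδ1 h1 h2 hc hK hi l).trans e6
  push Not at hi
  obtain ⟨a, ha1, ha2⟩ := hi
  have g1 : c j i ≤ (1 + δ) * c p i := h.le_mul ha1 ha2 hδ
  by_cases hl : c j l < δ / 4 * D l i ∨ δ / 4 * (1 + δ) ^ K * D l i ≤ c j l
  · have t1 := h1 j i l
    rw [hD i l] at t1
    rcases hl with hl | hl
    -- This case is impossible: both distances of `p` would be far smaller than `D l i`, against the
    -- triangle inequality.
    · have hl' : c p l < δ / 4 * D l i := by
        have := h l i 0 (Nat.zero_le _)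
        simp only [pow_zero, mul_one] at this
        by_contra! hcon
        exact absurd (this.2 hcon) (not_le.2 hl)
      have t2 := h2 p l i
      have e7 := hc p l
      nlinarith
    · refine le_trans ?_ e6
      have hD : 4 * D l i ≤ δ * c j l := by
        by_cases hD : D l i ≤ 0
        · nlinarith [mul_nonneg hδ.le e3]
        · push Not at hD
          nlinarith [mul_le_mul_of_nonneg_right hK hD.le, mul_le_mul_of_nonneg_left hl hδ.le]
      nlinarith
  · push Not at hl
    have hl1 : δ / 4 * D l i ≤ c p l := by
      have := h l i 0 (Nat.zero_le _)
      simp only [pow_zero, mul_one] at this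
      exact this.1 hl.1
    have hl2 : c p l < δ / 4 * (1 + δ) ^ K * D l i := by
      by_contra! hcon
      exact absurd ((h l i K le_rfl).2 hcon) (not_le.2 hl.2)
    have g2 := h.symm.le_mul hl1 hl2 hδ
    have e8 : 0 < 1 + δ := by linarith
    calc c j i ≤ (1 + δ) * c p i := g1
      _ ≤ (1 + δ) * ((1 + δ) * c p l) := by gcongr
      _ ≤ (1 + δ) * ((1 + δ) * ((1 + δ) * c j l)) := by gcongr
      _ = _ := by ring

/-- For a facility that is not near `p`, `le_mul_of_far` yields a window that contains `c p i`, and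
equal signatures put `c j i` into the same window. Near facilities are handled by
`SameSignature.le_of_near`, with `l` a nearest facility of `j`. -/
theorem SameSignature.similar {c : Fin n → Fin k → ℝ≥0} {r : Fin n → ℝ≥0} {δ : ℝ≥0} {j p : Fin n}
    (h : SameSignature (fun j i => (c j i : ℝ)) D δ K j p) (hδ : 0 < δ)
    (hδ1 : (δ : ℝ) ≤ 1 / 16) (h1 : ∀ j i l, c j i ≤ D i l + c j l)
    (h2 : ∀ j i l, D i l ≤ c j i + c j l) (hD : ∀ i l, D i l = D l i)
    (hK : 16 ≤ (δ : ℝ) ^ 2 * (1 + δ) ^ K) (hr : ∀ j i, r j ≤ c j i)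
    (hr' : ∀ j (_ : Fin k), ∃ l, r j = c j l) :
    Similar c r (1 + δ) ((1 + δ) * (1 + δ) * (1 + δ)) j p := by
  have hδ' : (0 : ℝ) < δ := hδ
  refine fun i => ⟨fun hi => ?_, fun hi => ?_⟩
  · obtain ⟨l, hl⟩ := hr' j i
    rw [hl]
    have hp : c p i ≤ (1 + δ) * c p l := hi.trans (by gcongr; exact hr p l)
    exact_mod_cast h.le_of_near hδ' hδ1 h1 h2 hD (fun j i => (c j i).2) hK (i := i) (l := l)
      (by exact_mod_cast hp)
  · have hfar : ¬ ∀ l, (c p i : ℝ) < δ / 4 * D i l ∨ δ / 4 * (1 + δ) ^ K * D i l ≤ (c p i : ℝ) := by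
      intro hfar
      obtain ⟨l, hl⟩ := hr' p i
      refine hi ?_
      rw [hl]
      exact_mod_cast le_mul_of_far (c := fun j i => (c j i : ℝ)) hδ' hδ1 h1 h2
        (fun j i => (c j i).2) hK hfar l
    push Not at hfar
    obtain ⟨l, hl1, hl2⟩ := hfar
    have hl1' : (δ : ℝ) / 4 * D i l ≤ c j i := by
      have := h i l 0 (Nat.zero_le _)
      simp only [pow_zero, mul_one] at this
      exact this.2 hl1
    have hl2' : (c j i : ℝ) < δ / 4 * (1 + δ) ^ K * D i l := by
      by_contra! hcon
      exact absurd ((h i l K le_rfl).1 hcon) (not_le.2 hl2)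
    have g1 : c j i ≤ (1 + δ) * c p i := by exact_mod_cast h.le_mul hl1' hl2' hδ'
    have g2 : c p i ≤ (1 + δ) * c j i := by exact_mod_cast h.symm.le_mul hl1 hl2 hδ'
    have e1 : 1 + δ ≤ (1 + δ) * (1 + δ) * (1 + δ) := by
      have : 1 ≤ (1 + δ) * (1 + δ) := one_le_mul le_self_add le_self_add
      exact le_mul_of_one_le_left' this
    exact ⟨g1.trans (by gcongr), g2.trans (by gcongr)⟩

/-- Dissimilar representatives have different signatures, and a signature consists of `k * k * (16 *
W ^ 3 + 1)` bits. The exponent range `16 * W ^ 3` is long enough by Bernoulli's inequality and `1 ≤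
δ * W`. -/
theorem Inst.card_types_le (I : Inst k n) {c : Fin n → Fin k → ℝ≥0} {r : Fin n → ℝ≥0} {δ : ℝ≥0}
    (hcd : ∀ j i, c j i = I.d (Sum.inr j) (Sum.inl i)) (hδ : 0 < δ) (hδ1 : (δ : ℝ) ≤ 1 / 16)
    {W : ℕ} (hW : 1 ≤ δ * W) (hr : ∀ j i, r j ≤ c j i)
    (hr' : ∀ j (_ : Fin k), ∃ l, r j = c j l) {T : ℕ} {rep : ℕ → Fin n}
    (hrep : ∀ t t', t < t' → t' < T →
      ¬ Similar c r (1 + δ) ((1 + δ) * (1 + δ) * (1 + δ)) (rep t') (rep t)) :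
    T ≤ 2 ^ (k * k * (16 * W ^ 3 + 1)) := by
  classical
  let _ := I.metric
  have hcd' : ∀ j i, (c j i : ℝ) = dist (Sum.inr j : Fin k ⊕ Fin n) (Sum.inl i) := by
    intro j i; rw [hcd]; rfl
  set D : Fin k → Fin k → ℝ := fun i l => dist (Sum.inl i : Fin k ⊕ Fin n) (Sum.inl l) with hD
  have hW' : (1 : ℝ) ≤ δ * W := by exact_mod_cast hW
  have hK : 16 ≤ (δ : ℝ) ^ 2 * (1 + δ) ^ (16 * W ^ 3) := by
    have hb : 1 + ((16 * W ^ 3 : ℕ) : ℝ) * δ ≤ (1 + δ) ^ (16 * W ^ 3) :=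
      one_add_mul_le_pow (by have := δ.2; linarith) _
    have h3 : (1 : ℝ) ≤ (δ * W) ^ 3 := one_le_pow₀ hW'
    calc (16 : ℝ) ≤ 16 * (δ * W) ^ 3 := by linarith
      _ = δ ^ 2 * (((16 * W ^ 3 : ℕ) : ℝ) * δ) := by push_cast; ring
      _ ≤ _ := by gcongr; linarith
  let sig : Fin T → Fin k → Fin k → Fin (16 * W ^ 3 + 1) → Bool := fun t i l s =>
    decide ((δ : ℝ) / 4 * (1 + δ) ^ (s : ℕ) * D i l ≤ c (rep t) i)
  have hinj : Function.Injective sig := by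
    have key : ∀ t t' : Fin T, sig t = sig t' → ¬ t < t' := by
      intro t t' h hlt
      refine hrep t t' hlt t'.2 (SameSignature.similar (D := D) (K := 16 * W ^ 3) ?_ hδ hδ1
        ?_ ?_ ?_ hK hr hr')
      · intro i l s hs
        have := congrFun (congrFun (congrFun h i) l) ⟨s, by omega⟩
        simp only [sig, decide_eq_decide] at this
        exact this.symm
      · intro j i l
        rw [hcd', hcd', add_comm]
        exact (dist_triangle _ (Sum.inl l) _).trans (by rw [dist_comm (Sum.inl l)])
      · intro j i l
        rw [hcd', hcd', dist_comm (Sum.inr j) (Sum.inl i)]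
        exact dist_triangle _ (Sum.inr j) _
      · intro i l
        exact dist_comm _ _
    intro t t' h
    rcases lt_trichotomy t t' with h1 | h1 | h1
    · exact absurd h1 (key _ _ h)
    · exact h1
    · exact absurd h1 (key _ _ h.symm)
  have := Fintype.card_le_of_injective sig hinj
  simp only [Fintype.card_fin, Fintype.card_fun, Fintype.card_bool, ← pow_mul] at this
  refine this.trans (le_of_eq ?_)
  congr 1
  ring

end

/-! ### The program -/

/-! ### Integer division, digits and powers -/

section

variable {H n : ℕ} {f : (Fin n → ℝ≥0) → ℝ≥0} {m : Memory}

/-- Repeated subtraction: leaves the remainder in `a` and the quotient in `a + 1`. -/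
def divMod (a : ℕ) (B : NatExpr) : Program :=
  .seq (.set (a + 1) (.const 0))
    (.loop (.not (.natLt (.var a) B))
      (.seq (.set a (.sub (.var a) B)) (.set (a + 1) (.add (.var (a + 1)) (.const 1)))))

theorem wp_divMod (hH : 2 ≤ H) {a : ℕ} {B : NatExpr} {b : ℕ} (hb : 1 ≤ b)
    (hB : ∀ m', Fr [a, a + 1] m m' → B.eval m' = b) (hv : m.nat a 0 0 ≤ H) :
    WP H f (divMod a B) (fun m' => Fr [a, a + 1] m m' ∧ m'.nat a 0 0 = m.nat a 0 0 % b ∧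
      m'.nat (a + 1) 0 0 = m.nat a 0 0 / b) m := by
  refine wp_seq hH (wp_writeNat hH ?_)
  refine (wp_loop hH (fun m' => Fr [a, a + 1] m m' ∧
    m'.nat a 0 0 + b * m'.nat (a + 1) 0 0 = m.nat a 0 0) (fun m' => m'.nat a 0 0) ?_ ?_ ?_).mono ?_
  · exact ⟨(Fr.refl _ _).setNat (by simp) _ _ _, by simp [NatExpr.eval]⟩
  · simpa [NatExpr.eval] using hv
  · rintro m' ⟨hF, hI⟩ hb'
    simp only [Cond.Holds, NatExpr.eval, hB m' hF, not_lt] at hb'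
    refine wp_seq hH (wp_writeNat hH (wp_writeNat hH ⟨⟨?_, ?_⟩, ?_⟩))
    · exact (hF.setNat (by simp) _ _ _).setNat (by simp) _ _ _
    · simp only [NatExpr.eval, hB m' hF, Memory.setNat_nat]
      simp [mul_add]
      omega
    · simp [NatExpr.eval, hB m' hF]
      omega
  · rintro m' ⟨⟨hF, hI⟩, hb'⟩
    simp only [Cond.Holds, NatExpr.eval, hB m' hF, not_not] at hb'
    refine ⟨hF, ?_, ?_⟩
    · rw [← hI, Nat.add_mul_mod_self_left, Nat.mod_eq_of_lt hb']
    · rw [← hI, Nat.add_mul_div_left _ _ (by omega), Nat.div_eq_of_lt hb', zero_add]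

/-- Writes the digits of `g` to base `B` into the array `a + 3`. -/
def digits (a : ℕ) (g N B : NatExpr) : Program :=
  .seq (.set (a + 1) g)
    (.for a N (.seq (divMod (a + 1) B)
      (.seq (.setItem (a + 3) (.var a) (.var (a + 1))) (.set (a + 1) (.var (a + 2))))))

theorem wp_digits (hH : 2 ≤ H) {a : ℕ} {g N B : NatExpr} {w N' b : ℕ} (hb : 1 ≤ b)
    (hg : g.eval m = w) (hw : w ≤ H) (hN' : N' ≤ H)
    (hN : ∀ m', Fr [a, a + 1, a + 2, a + 3] m m' → N.eval m' = N')
    (hB : ∀ m', Fr [a, a + 1, a + 2, a + 3] m m' → B.eval m' = b) :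
    WP H f (digits a g N B) (fun m' => Fr [a, a + 1, a + 2, a + 3] m m' ∧
      ∀ i < N', m'.nat (a + 3) 0 i = w / b ^ i % b) m := by
  refine wp_seq hH (wp_writeNat hH ?_)
  set m₁ := m.setNat (a + 1) ((NatExpr.const 0).eval m) ((NatExpr.const 0).eval m) (g.eval m) with hm₁
  have hF₁ : Fr [a, a + 1, a + 2, a + 3] m m₁ := (Fr.refl _ _).setNat (by simp) _ _ _
  refine (wp_for hH [a + 1, a + 2, a + 3] (fun i m' => m'.nat (a + 1) 0 0 = w / b ^ i ∧
    ∀ l < i, m'.nat (a + 3) 0 l = w / b ^ l % b) (by simp) hN' ?_ ?_ ?_).mono ?_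
  · simp [hm₁, NatExpr.eval, hg]
  · exact fun m' hF => hN _ (hF₁.trans hF (by simp))
  · rintro i hi m' hF hi' ⟨h1, h2⟩
    have hFt : Fr [a, a + 1, a + 2, a + 3] m m' := hF₁.trans hF (by simp)
    refine wp_seq hH ((wp_divMod hH hb (fun m'' hF' => hB _ (hFt.trans hF' (by simp))) ?_).mono ?_)
    · rw [h1]; exact (Nat.div_le_self _ _).trans hw
    rintro m'' ⟨hF', h3, h4⟩
    have ea : m''.nat a 0 0 = i := by rw [hF'.nat a (by simp; omega), hi']
    refine wp_seq hH (wp_writeNat hH (wp_writeNat hH ⟨?_, ?_, ?_⟩))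
    · exact ((hF'.mono (by simp)).setNat (by simp) _ _ _).setNat (by simp) _ _ _
    · simp [NatExpr.eval, h4, h1, Nat.div_div_eq_div_mul, pow_succ]
    · intro l hl
      simp [NatExpr.eval, h3, h1, ea]
      split_ifs with hl'
      · rw [hl']
      · rw [hF'.nat (a + 3) (by simp)]
        exact h2 l (by omega)
  · rintro m' ⟨hF, -, h⟩
    exact ⟨hF₁.trans hF (by simp), h⟩

/-- Writes the power `B ^ N` into the variable `a + 1`. -/
def power (a : ℕ) (B N : NatExpr) : Program :=
  .seq (.set (a + 1) (.const 1)) (.for a N (.set (a + 1) (.mul (.var (a + 1)) B)))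

theorem wp_power (hH : 2 ≤ H) {a : ℕ} {N B : NatExpr} {N' b : ℕ} (hN' : N' ≤ H)
    (hN : ∀ m', Fr [a, a + 1] m m' → N.eval m' = N')
    (hB : ∀ m', Fr [a, a + 1] m m' → B.eval m' = b) :
    WP H f (power a B N) (fun m' => Fr [a, a + 1] m m' ∧ m'.nat (a + 1) 0 0 = b ^ N') m := by
  refine wp_seq hH (wp_writeNat hH ?_)
  set m₁ := m.setNat (a + 1) ((NatExpr.const 0).eval m) ((NatExpr.const 0).eval m)
    ((NatExpr.const 1).eval m) with hm₁
  have hF₁ : Fr [a, a + 1] m m₁ := (Fr.refl _ _).setNat (by simp) _ _ _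
  refine (wp_for hH [a + 1] (fun i m' => m'.nat (a + 1) 0 0 = b ^ i) (by simp) hN' ?_ ?_ ?_).mono ?_
  · simp [hm₁, NatExpr.eval]
  · exact fun m' hF => hN _ (hF₁.trans hF (by simp))
  · rintro i hi m' hF hi' h1
    have hFt : Fr [a, a + 1] m m' := hF₁.trans hF (by simp)
    refine wp_writeNat hH ⟨(Fr.refl _ _).setNat (by simp) _ _ _, ?_⟩
    simp [NatExpr.eval, h1, hB m' hFt, pow_succ]
  · rintro m' ⟨hF, h⟩
    exact ⟨hF₁.trans hF (by simp), h⟩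

end

/-! ### Preparations: parameters, minimum distances, powers of `q`, types -/

section

variable {H n k : ℕ} {f : (Fin n → ℝ≥0) → ℝ≥0} {m : Memory}

abbrev kE : NatExpr := .item 0 (.const 0)

abbrev nE : NatExpr := .item 0 (.const 1)

/-- The distance between client `j` and facility `i`. -/
abbrev distE (j i : NatExpr) : RealExpr := .read 1 (.add kE j) i

/-- The parameters `δ`, `q`, `h` are written into the arrays `3`, `4`, `5`. -/
def parameters : Program :=
  .seq (.setR 3 (.div (.var 0) (.mul (.ofNat (.const 32)) (.add (.ofNat (.const 1)) (.var 0)))))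
    (.seq (.setR 4 (.add (.ofNat (.const 1)) (.var 3)))
      (.setR 5 (.mul (.mul (.var 4) (.var 4)) (.var 4))))

theorem wp_parameters (hH : 2 ≤ H) {ε : ℝ} (hε : m.real 0 0 0 = ε) :
    WP H f parameters (fun m' => Fr [3, 4, 5] m m' ∧ m'.real 3 0 0 = ε / (32 * (1 + ε)) ∧
      m'.real 4 0 0 = 1 + ε / (32 * (1 + ε)) ∧
      m'.real 5 0 0 = (1 + ε / (32 * (1 + ε))) * (1 + ε / (32 * (1 + ε))) *
        (1 + ε / (32 * (1 + ε)))) m := by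
  refine wp_seq hH (wp_writeReal hH (wp_seq hH (wp_writeReal hH (wp_writeReal hH ⟨?_, ?_⟩))))
  · exact (((Fr.refl _ _).setReal (by simp) _ _ _).setReal (by simp) _ _ _).setReal (by simp) _ _ _
  · simp [NatExpr.eval, RealExpr.eval, hε]

/-- Array `8` gets the distances from the clients to their nearest facilities. -/
def minima : Program :=
  .for 6 nE (.seq (.setRItem 8 (.var 6) (distE (.var 6) (.const 0)))
    (.for 7 kE (.cond (.realLt (distE (.var 6) (.var 7)) (.item 8 (.var 6)))
      (.setRItem 8 (.var 6) (distE (.var 6) (.var 7))) .skip)))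

theorem wp_minima (hH : 2 ≤ H) (hnH : n ≤ H) (hkH : k ≤ H) {c : ℕ → ℕ → ℝ}
    (hk : m.nat 0 0 0 = k) (hn : m.nat 0 0 1 = n) (hc : ∀ j i, m.real 1 (k + j) i = c j i) :
    WP H f minima (fun m' => Fr [6, 7, 8] m m' ∧ ∀ j < n, (∀ i < k, m'.real 8 0 j ≤ c j i) ∧
      (0 < k → ∃ i < k, m'.real 8 0 j = c j i)) m := by
  refine wp_for hH [7, 8] (fun a m' => ∀ j < a, (∀ i < k, m'.real 8 0 j ≤ c j i) ∧
      (0 < k → ∃ i < k, m'.real 8 0 j = c j i)) (by simp) hnH (by simp) ?_ ?_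
  · intro m' hF
    simp [NatExpr.eval, hF.nat 0 (by simp), hn]
  intro j hj m' hF hj' hI
  have hk' : m'.nat 0 0 0 = k := by rw [hF.nat 0 (by simp), hk]
  have hc' : ∀ j i, m'.real 1 (k + j) i = c j i := by rw [hF.real 1 (by simp)]; exact hc
  refine wp_seq hH (wp_writeReal hH ?_)
  simp only [NatExpr.eval, RealExpr.eval, hj', hk', hc']
  -- The initial value is the entry for facility `0`, which exists only if `0 < k`; hence the
  -- separate alternative, and the hypothesis in the second claim.
  refine (wp_for hH [8] (fun a m'' => (∀ l ≠ j, m''.real 8 0 l = m'.real 8 0 l) ∧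
    (∀ i < a, m''.real 8 0 j ≤ c j i) ∧ ((m''.real 8 0 j = c j 0) ∨ ∃ i < k, m''.real 8 0 j = c j i))
    (by simp) hkH ?_ ?_ ?_).mono ?_
  · simp +contextual
  · intro m'' hF'
    simp [NatExpr.eval, hF'.nat 0 (by simp), hk']
  · rintro i hi m'' hF' hi' ⟨h1, h2, h3⟩
    have ej : m''.nat 6 0 0 = j := by rw [hF'.nat 6 (by simp)]; simpa using hj'
    have ek : m''.nat 0 0 0 = k := by rw [hF'.nat 0 (by simp)]; simpa using hk'
    have ec : ∀ j i, m''.real 1 (k + j) i = c j i := by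
      rw [hF'.real 1 (by simp)]; simpa using hc'
    refine wp_cond hH (fun hb => ?_) (fun hb => ?_)
    · simp only [Cond.Holds, NatExpr.eval, RealExpr.eval, ej, ek, ec, hi'] at hb
      refine wp_writeReal hH ⟨(Fr.refl _ _).setReal (by simp) _ _ _, ?_⟩
      simp only [NatExpr.eval, RealExpr.eval, ej, ek, ec, hi', Memory.setNat_real,
        Memory.setReal_real]
      refine ⟨fun l hl => by simpa [hl] using h1 l hl, fun l hl => ?_, .inr ⟨i, hi, by simp⟩⟩
      simp only [and_self, if_true]
      rcases Nat.lt_succ_iff_lt_or_eq.1 hl with h | rfl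
      · exact hb.le.trans (h2 l h)
      · exact le_rfl
    · simp only [Cond.Holds, NatExpr.eval, RealExpr.eval, ej, ek, ec, hi', not_lt] at hb
      refine wp_skip hH ⟨Fr.refl _ _, ?_⟩
      simp only [Memory.setNat_real]
      refine ⟨h1, fun l hl => ?_, h3⟩
      rcases Nat.lt_succ_iff_lt_or_eq.1 hl with h | rfl
      · exact h2 l h
      · exact hb
  · rintro m'' ⟨hF', h1, h2, h3⟩
    refine ⟨((Fr.refl [7, 8] m').setReal (by simp) _ _ _).trans hF' (by simp), ?_⟩
    simp only [Memory.setNat_real]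
    intro l hl
    rcases Nat.lt_succ_iff_lt_or_eq.1 hl with h | rfl
    · rw [h1 l h.ne]; exact hI l h
    · refine ⟨h2, fun hk0 => ?_⟩
      rcases h3 with h3 | h3
      · exact ⟨0, hk0, h3⟩
      · exact h3

/-- Array `9` gets the numbers `0, 1, q, …, q ^ S`, where `S` is the least exponent with
`n ≤ q ^ S * δ`. -/
def powerTable : Program :=
  .seq (.setRItem 9 (.const 0) (.ofNat (.const 0)))
    (.seq (.setRItem 9 (.const 1) (.ofNat (.const 1)))
      (.seq (.set 10 (.const 0))
        (.loop (.realLt (.mul (.item 9 (.add (.var 10) (.const 1))) (.var 3)) (.ofNat nE))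
          (.seq (.setRItem 9 (.add (.var 10) (.const 2))
              (.mul (.item 9 (.add (.var 10) (.const 1))) (.var 4)))
            (.set 10 (.add (.var 10) (.const 1)))))))

theorem wp_powerTable (hH : 2 ≤ H) {δ q : ℝ} (hδ : m.real 3 0 0 = δ) (hq : m.real 4 0 0 = q)
    (hn : m.nat 0 0 1 = n) {S₀ : ℕ} (hS₀ : n ≤ q ^ S₀ * δ) (hSH : S₀ ≤ H) :
    WP H f powerTable (fun m' => Fr [9, 10] m m' ∧ m'.real 9 0 0 = 0 ∧ m'.nat 10 0 0 ≤ S₀ ∧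
      (∀ u ≤ m'.nat 10 0 0, m'.real 9 0 (u + 1) = q ^ u) ∧ n ≤ q ^ m'.nat 10 0 0 * δ) m := by
  refine wp_seq hH (wp_writeReal hH (wp_seq hH (wp_writeReal hH (wp_seq hH (wp_writeNat hH ?_)))))
  refine (wp_loop hH (fun m' => Fr [9, 10] m m' ∧ m'.real 9 0 0 = 0 ∧ m'.nat 10 0 0 ≤ S₀ ∧
      (∀ u ≤ m'.nat 10 0 0, m'.real 9 0 (u + 1) = q ^ u)) (fun m' => S₀ - m'.nat 10 0 0)
      ?_ ?_ ?_).mono ?_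
  · refine ⟨(((Fr.refl _ _).setReal (by simp) _ _ _).setReal (by simp) _ _ _).setNat
      (by simp) _ _ _, ?_⟩
    simp [NatExpr.eval, RealExpr.eval]
  · exact (Nat.sub_le _ _).trans hSH
  · rintro m' ⟨hF, h0, h1, h2⟩ hb
    simp only [Cond.Holds, NatExpr.eval, RealExpr.eval, hF.nat 0 (by simp), hn,
      hF.real 3 (by simp), hδ, h2 _ le_rfl] at hb
    -- The test fails at exponent `S₀` by `hS₀`, so the loop cannot go beyond it; this bounds the
    -- variant.
    have hlt : m'.nat 10 0 0 < S₀ := by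
      refine lt_of_le_of_ne h1 fun h => ?_
      rw [h] at hb
      exact absurd hS₀ (not_le.2 hb)
    refine wp_seq hH (wp_writeReal hH (wp_writeNat hH ⟨⟨?_, ?_⟩, ?_⟩))
    · exact (hF.setReal (by simp) _ _ _).setNat (by simp) _ _ _
    · simp [NatExpr.eval, RealExpr.eval, h0, h2 _ le_rfl, hF.real 4 (by simp), hq]
      refine ⟨hlt, fun u hu => ?_⟩
      split_ifs with h
      · have : u = m'.nat 10 0 0 + 1 := by omega
        rw [this, pow_succ]
      · exact h2 u (by omega)
    · simp [NatExpr.eval]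
      omega
  · rintro m' ⟨⟨hF, h0, h1, h2⟩, hb⟩
    simp only [Cond.Holds, NatExpr.eval, RealExpr.eval, hF.nat 0 (by simp), hn,
      hF.real 3 (by simp), hδ, h2 _ le_rfl, not_lt] at hb
    exact ⟨hF, h0, h1, h2, hb⟩

/-- Similarity of clients in terms of the memory. -/
def SimilarAt (c : ℕ → ℕ → ℝ) (r : ℕ → ℝ) (q h : ℝ) (j p i : ℕ) : Prop :=
  (c p i ≤ q * r p → c j i ≤ h * r j) ∧ (¬ c p i ≤ q * r p → c j i ≤ h * c p i ∧ c p i ≤ h * c j i)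

/-- The variable `17` becomes positive if the clients `j` and `p` are similar and zero otherwise. -/
def testSimilar (j p : NatExpr) : Program :=
  .seq (.set 17 (.const 1))
    (.for 13 kE (.cond (.not (.realLt (.mul (.var 4) (.item 8 p)) (distE p (.var 13))))
      (.cond (.realLt (.mul (.var 5) (.item 8 j)) (distE j (.var 13))) (.set 17 (.const 0)) .skip)
      (.cond (.and (.not (.realLt (.mul (.var 5) (distE p (.var 13))) (distE j (.var 13))))
          (.not (.realLt (.mul (.var 5) (distE j (.var 13))) (distE p (.var 13)))))
        .skip (.set 17 (.const 0)))))

theorem wp_testSimilar (hH : 2 ≤ H) (hkH : k ≤ H) {c : ℕ → ℕ → ℝ} {r : ℕ → ℝ} {q h : ℝ}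
    (hk : m.nat 0 0 0 = k) (hc : ∀ j i, m.real 1 (k + j) i = c j i) (hr : ∀ j, m.real 8 0 j = r j)
    (hq : m.real 4 0 0 = q) (hh : m.real 5 0 0 = h) {jE pE : NatExpr} {j p : ℕ}
    (hj : ∀ m', Fr [13, 17] m m' → jE.eval m' = j) (hp : ∀ m', Fr [13, 17] m m' → pE.eval m' = p) :
    WP H f (testSimilar jE pE) (fun m' => Fr [13, 17] m m' ∧
      (0 < m'.nat 17 0 0 ↔ ∀ i < k, SimilarAt c r q h j p i)) m := by
  refine wp_seq hH (wp_writeNat hH ?_)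
  set m₁ := m.setNat 17 _ _ _ with hm₁
  have hF₁ : Fr [13, 17] m m₁ := (Fr.refl _ _).setNat (by simp) _ _ _
  refine (wp_for hH [17] (fun a m' => 0 < m'.nat 17 0 0 ↔ ∀ i < a, SimilarAt c r q h j p i)
    (by simp) hkH ?_ ?_ ?_).mono ?_
  · simp [hm₁, NatExpr.eval]
  · intro m' hF
    simp [NatExpr.eval, (hF₁.trans hF (by simp)).nat 0 (by simp), hk]
  · intro i hi m' hF hi' hI
    have hFt : Fr [13, 17] m m' := hF₁.trans hF (by simp)
    have ek : m'.nat 0 0 0 = k := by rw [hFt.nat 0 (by simp), hk]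
    have ec : ∀ j i, m'.real 1 (k + j) i = c j i := by rw [hFt.real 1 (by simp)]; exact hc
    have er : ∀ j, m'.real 8 0 j = r j := by rw [hFt.real 8 (by simp)]; exact hr
    have eq : m'.real 4 0 0 = q := by rw [hFt.real 4 (by simp), hq]
    have eh : m'.real 5 0 0 = h := by rw [hFt.real 5 (by simp), hh]
    have ej := hj _ hFt
    have ep := hp _ hFt
    have good : SimilarAt c r q h j p i → WP H f .skip (fun m'' => Fr [17] m' m'' ∧
        (0 < (m''.setNat 13 0 0 (i + 1)).nat 17 0 0 ↔ ∀ l < i + 1, SimilarAt c r q h j p l)) m' := by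
      intro hs
      refine wp_skip hH ⟨Fr.refl _ _, ?_⟩
      simp only [Memory.setNat_nat, Nat.reduceEqDiff, false_and, if_false, hI]
      refine ⟨fun h l hl => ?_, fun h l hl => h l (by omega)⟩
      rcases Nat.lt_succ_iff_lt_or_eq.1 hl with h' | rfl
      · exact h l h'
      · exact hs
    have bad : ¬ SimilarAt c r q h j p i → WP H f (.set 17 (.const 0)) (fun m'' => Fr [17] m' m'' ∧
        (0 < (m''.setNat 13 0 0 (i + 1)).nat 17 0 0 ↔ ∀ l < i + 1, SimilarAt c r q h j p l)) m' := by
      intro hs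
      refine wp_writeNat hH ⟨(Fr.refl _ _).setNat (by simp) _ _ _, ?_⟩
      simp only [NatExpr.eval, Memory.setNat_nat, Nat.reduceEqDiff, false_and, if_false, and_self,
        if_true]
      exact ⟨fun h => absurd h (by simp), fun h => absurd (h i (by omega)) hs⟩
    refine wp_cond hH (fun hb => ?_) (fun hb => ?_)
    · simp only [Cond.Holds, NatExpr.eval, RealExpr.eval, ep, ek, ec, er, eq, hi', not_lt] at hb
      refine wp_cond hH (fun hb' => bad ?_) (fun hb' => good ?_) <;>
      simp only [Cond.Holds, NatExpr.eval, RealExpr.eval, ej, ek, ec, er, eh, hi', not_lt] at hb'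
      · exact fun hs => absurd (hs.1 hb) (not_le.2 hb')
      · exact ⟨fun _ => hb', fun hn => absurd hb hn⟩
    · simp only [Cond.Holds, NatExpr.eval, RealExpr.eval, ep, ek, ec, er, eq, hi', not_lt] at hb
      refine wp_cond hH (fun hb' => good ?_) (fun hb' => bad ?_) <;>
      simp only [Cond.Holds, NatExpr.eval, RealExpr.eval, ej, ep, ek, ec, eh, hi', not_lt] at hb'
      · exact ⟨fun h => absurd h hb, fun _ => hb'⟩
      · exact fun hs => hb' (hs.2 hb)
  · rintro m' ⟨hF, h⟩
    exact ⟨hF₁.trans hF (by simp), h⟩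

/-- Computes the number `T` of types, the representatives of the types and the types of the
clients. -/
def types : Program :=
  .seq (.set 14 (.const 0))
    (.for 11 nE (.seq (.setItem 16 (.var 11) (.var 14))
      (.seq (.for 12 (.var 14) (.seq (testSimilar (.var 11) (.item 15 (.var 12)))
          (.cond (.natLt (.const 0) (.var 17)) (.setItem 16 (.var 11) (.var 12)) .skip)))
        (.cond (.natLt (.item 16 (.var 11)) (.var 14)) .skip
          (.seq (.setItem 15 (.var 14) (.var 11)) (.set 14 (.add (.var 14) (.const 1))))))))

theorem wp_types (hH : 2 ≤ H) (hkH : k ≤ H) (hnH : n ≤ H) {c : ℕ → ℕ → ℝ} {r : ℕ → ℝ} {q h : ℝ}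
    (hk : m.nat 0 0 0 = k) (hn : m.nat 0 0 1 = n) (hc : ∀ j i, m.real 1 (k + j) i = c j i)
    (hr : ∀ j, m.real 8 0 j = r j) (hq : m.real 4 0 0 = q) (hh : m.real 5 0 0 = h)
    (hrefl : ∀ j < n, ∀ i < k, SimilarAt c r q h j j i) :
    WP H f types (fun m' => Fr [11, 12, 13, 14, 15, 16, 17] m m' ∧ m'.nat 14 0 0 ≤ n ∧
      (∀ t < m'.nat 14 0 0, m'.nat 15 0 t < n) ∧
      (∀ j < n, m'.nat 16 0 j < m'.nat 14 0 0 ∧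
        ∀ i < k, SimilarAt c r q h j (m'.nat 15 0 (m'.nat 16 0 j)) i) ∧
      ∀ t t', t < t' → t' < m'.nat 14 0 0 →
        ¬ ∀ i < k, SimilarAt c r q h (m'.nat 15 0 t') (m'.nat 15 0 t) i) m := by
  refine wp_seq hH (wp_writeNat hH ?_)
  set m₁ := m.setNat 14 _ _ _ with hm₁
  have hF₁ : Fr [11, 12, 13, 14, 15, 16, 17] m m₁ := (Fr.refl _ _).setNat (by simp) _ _ _
  refine (wp_for hH [12, 13, 14, 15, 16, 17] (fun a m' => m'.nat 14 0 0 ≤ a ∧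
      (∀ t < m'.nat 14 0 0, m'.nat 15 0 t < a) ∧
      (∀ j < a, m'.nat 16 0 j < m'.nat 14 0 0 ∧
        ∀ i < k, SimilarAt c r q h j (m'.nat 15 0 (m'.nat 16 0 j)) i) ∧
      ∀ t t', t < t' → t' < m'.nat 14 0 0 →
        ¬ ∀ i < k, SimilarAt c r q h (m'.nat 15 0 t') (m'.nat 15 0 t) i)
    (by simp) hnH ?_ ?_ ?_).mono ?_
  · simp [hm₁, NatExpr.eval]
  · intro m' hF
    simp [NatExpr.eval, (hF₁.trans hF (by simp)).nat 0 (by simp), hn]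
  · rintro j hj m' hF hj' ⟨h1, h2, h3, h4⟩
    have hFt : Fr [11, 12, 13, 14, 15, 16, 17] m m' := hF₁.trans hF (by simp)
    set T := m'.nat 14 0 0 with hT
    refine wp_seq hH (wp_writeNat hH (wp_seq hH ?_))
    simp only [NatExpr.eval, hj']
    -- The type of `j` is preset to `T`, which no earlier type has as its number. If this value
    -- survives, `j` is similar to no representative and founds type `T`.
    refine (wp_for hH [13, 16, 17] (fun b m'' => (∀ l ≠ j, m''.nat 16 0 l = m'.nat 16 0 l) ∧
      ((m''.nat 16 0 j = T ∧ ∀ t < b, ¬ ∀ i < k, SimilarAt c r q h j (m'.nat 15 0 t) i) ∨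
        (m''.nat 16 0 j < T ∧
          ∀ i < k, SimilarAt c r q h j (m'.nat 15 0 (m''.nat 16 0 j)) i)))
      (by simp) (N := T) (h1.trans (hj.le.trans hnH)) ?_ ?_ ?_).mono ?_
    · simp +contextual [hT]
    · intro m'' hF'
      simp [NatExpr.eval, hF'.nat 14 (by simp), hT]
    · rintro t ht m'' hF' ht' ⟨g1, g2⟩
      have hF'' : Fr [11, 12, 13, 14, 15, 16, 17] m m'' :=
        (hFt.setNat (by simp) 0 j (m'.nat 14 0 0)).trans hF' (by simp)
      have ej : m''.nat 11 0 0 = j := by rw [hF'.nat 11 (by simp)]; simpa using hj'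
      have e15 : m''.nat 15 = m'.nat 15 := by
        rw [hF'.nat 15 (by simp), Memory.setNat_nat_ne _ (by simp)]
      refine wp_seq hH ((wp_testSimilar hH hkH (c := c) (r := r) (q := q) (h := h) (j := j)
        (p := m'.nat 15 0 t) ?_ ?_ ?_ ?_ ?_ ?_ ?_).mono ?_)
      · rw [hF''.nat 0 (by simp), hk]
      · rw [hF''.real 1 (by simp)]; exact hc
      · rw [hF''.real 8 (by simp)]; exact hr
      · rw [hF''.real 4 (by simp), hq]
      · rw [hF''.real 5 (by simp), hh]
      · intro m₃ hF₃
        simp [NatExpr.eval, hF₃.nat 11 (by simp), ej]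
      · intro m₃ hF₃
        simp [NatExpr.eval, hF₃.nat 12 (by simp), hF₃.nat 15 (by simp), e15, ht']
      · rintro m₃ ⟨hF₃, g3⟩
        have ej₃ : m₃.nat 11 0 0 = j := by rw [hF₃.nat 11 (by simp), ej]
        have et₃ : m₃.nat 12 0 0 = t := by rw [hF₃.nat 12 (by simp), ht']
        have e16 : m₃.nat 16 = m''.nat 16 := hF₃.nat 16 (by simp)
        refine wp_cond hH (fun hb => ?_) (fun hb => ?_) <;>
        simp only [Cond.Holds, NatExpr.eval, g3] at hb
        · refine wp_writeNat hH ⟨(hF₃.mono (by simp)).setNat (by simp) _ _ _, ?_⟩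
          simp only [NatExpr.eval, ej₃, et₃]
          refine ⟨fun l hl => by simpa [hl, e16] using g1 l hl, .inr ⟨?_, ?_⟩⟩
          · simpa using ht
          · simpa using hb
        · refine wp_skip hH ⟨hF₃.mono (by simp), ?_⟩
          simp only [Memory.setNat_nat, Nat.reduceEqDiff, false_and, if_false, e16]
          refine ⟨g1, ?_⟩
          rcases g2 with ⟨g2, g4⟩ | g2
          · refine .inl ⟨g2, fun l hl => ?_⟩
            rcases Nat.lt_succ_iff_lt_or_eq.1 hl with h | rfl
            · exact g4 l h
            · exact hb
          · exact .inr g2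
    · rintro m'' ⟨hF', g1, g2⟩
      have ej : m''.nat 11 0 0 = j := by rw [hF'.nat 11 (by simp)]; simpa using hj'
      have e15 : m''.nat 15 = m'.nat 15 := by
        rw [hF'.nat 15 (by simp), Memory.setNat_nat_ne _ (by simp)]
      have e14 : m''.nat 14 0 0 = T := by
        rw [hF'.nat 14 (by simp), Memory.setNat_nat_ne _ (by simp)]
      have hF'' : Fr [12, 13, 14, 15, 16, 17] m' m'' :=
        ((Fr.refl _ m').setNat (by simp) 0 j T).trans hF' (by simp)
      refine wp_cond hH (fun hb => ?_) (fun hb => ?_) <;>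
      simp only [Cond.Holds, NatExpr.eval, ej, e14] at hb
      · refine wp_skip hH ⟨hF'', ?_⟩
        simp only [Memory.setNat_nat, Nat.reduceEqDiff, false_and, if_false, e14, e15]
        refine ⟨by omega, fun t ht => (h2 t ht).trans (by omega), fun l hl => ?_, h4⟩
        rcases Nat.lt_succ_iff_lt_or_eq.1 hl with h | rfl
        · rw [g1 l h.ne]; exact h3 l h
        · rcases g2 with g2 | g2
          · omega
          · exact g2
      · rcases g2 with ⟨g2, g3⟩ | g2
        swap
        · omega
        refine wp_seq hH (wp_writeNat hH (wp_writeNat hH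
          ⟨(hF''.setNat (by simp) _ _ _).setNat (by simp) _ _ _, ?_⟩))
        have key : ∀ t, (if t = T then j else m''.nat 15 0 t) = if t = T then j else m'.nat 15 0 t := by
          rw [e15]; simp
        simp [NatExpr.eval, ej, e14, key]
        refine ⟨by omega, fun t ht => ?_, fun l hl => ?_, fun t t' htt ht' => ?_⟩
        · split_ifs with h
          · omega
          · exact (h2 t (by omega)).le
        · rcases Nat.lt_or_eq_of_le hl with h | rfl
          · rw [g1 l h.ne, if_neg (h3 l h).1.ne]
            exact ⟨by have := (h3 l h).1; omega, (h3 l h).2⟩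
          · rw [g2]
            simpa using hrefl l hj
        · rw [if_neg (show t ≠ T by omega)]
          split_ifs with h
          · simpa using g3 t (by omega)
          · simpa using h4 t t' htt (by omega)
  · rintro m' ⟨hF, h1, h2⟩
    exact ⟨hF₁.trans hF (by simp), h1, h2⟩

end

/-! ### Rows of a guess and the tests of a move -/

section

variable {H n k : ℕ} {f : (Fin n → ℝ≥0) → ℝ≥0} {m : Memory}

/-- The number of rows of the count matrices. -/
abbrev rowsE : NatExpr := .mul (.const 3) (.var 14)

/-- The number of the digits, their base, the number of entries of a count matrix, the number of
guesses and the number of moves. -/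
def sizes : Program :=
  .seq (.set 20 (.mul rowsE kE))
    (.seq (.set 18 (.add (.var 14) (.var 20)))
      (.seq (.set 19 (.add (.var 10) (.const 2)))
        (.seq (power 21 (.var 19) (.var 18)) (power 23 (.const 3) (.var 20)))))

theorem wp_sizes (hH : 2 ≤ H) {T S : ℕ} (hk : m.nat 0 0 0 = k) (hT : m.nat 14 0 0 = T)
    (hS : m.nat 10 0 0 = S) (hTH : T + 3 * T * k ≤ H) :
    WP H f sizes (fun m' => Fr [18, 19, 20, 21, 22, 23, 24] m m' ∧ m'.nat 18 0 0 = T + 3 * T * k ∧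
      m'.nat 19 0 0 = S + 2 ∧ m'.nat 20 0 0 = 3 * T * k ∧
      m'.nat 22 0 0 = (S + 2) ^ (T + 3 * T * k) ∧ m'.nat 24 0 0 = 3 ^ (3 * T * k)) m := by
  refine wp_seq hH (wp_writeNat hH (wp_seq hH (wp_writeNat hH (wp_seq hH (wp_writeNat hH ?_)))))
  have hF : Fr [18, 19, 20] m (((m.setNat 20 0 0 (3 * T * k)).setNat 18 0 0
      (T + 3 * T * k)).setNat 19 0 0 (S + 2)) :=
    (((Fr.refl _ _).setNat (by simp) _ _ _).setNat (by simp) _ _ _).setNat (by simp) _ _ _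
  simp only [NatExpr.eval, Memory.setNat_nat, hk, hT, hS, Nat.reduceEqDiff, false_and, if_false,
    and_self, if_true]
  refine wp_seq hH ((wp_power (N' := T + 3 * T * k) (b := S + 2) hH hTH ?_ ?_).mono ?_)
  · intro m' hF'
    simp [NatExpr.eval, hF'.nat 18 (by simp)]
  · intro m' hF'
    simp [NatExpr.eval, hF'.nat 19 (by simp)]
  rintro m₂ ⟨hF₂, h₂⟩
  refine (wp_power (N' := 3 * T * k) (b := 3) hH (by omega) ?_ ?_).mono ?_
  · intro m' hF'
    simp [NatExpr.eval, hF'.nat 20 (by simp), hF₂.nat 20 (by simp)]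
  · intro m' hF'
    simp [NatExpr.eval]
  rintro m₃ ⟨hF₃, h₃⟩
  refine ⟨((hF.mono (by simp)).trans hF₂ (by simp)).trans hF₃ (by simp), ?_, ?_, ?_, ?_, h₃⟩
  · simp [hF₃.nat 18 (by simp), hF₂.nat 18 (by simp)]
  · simp [hF₃.nat 19 (by simp), hF₂.nat 19 (by simp)]
  · simp [hF₃.nat 20 (by simp), hF₂.nat 20 (by simp)]
  · simpa [hF₃.nat 22 (by simp)] using h₂

/-- The rows of the clients are written into array `36` and the numbers of clients in the rows into
array `37`. -/
def rows : Program :=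
  .seq (.for 35 rowsE (.setItem 37 (.var 35) (.const 0)))
    (.for 35 nE
      (.seq (.cond (.realLt (.var 30) (.mul (.item 8 (.var 35))
            (.mul (.item 9 (.add (.item 34 (.item 16 (.var 35))) (.const 1))) (.var 4))))
          (.cond (.realLt (.var 30) (.mul (.item 8 (.var 35))
              (.item 9 (.add (.item 34 (.item 16 (.var 35))) (.const 1)))))
            (.setItem 36 (.var 35) (.add (.mul (.const 3) (.item 16 (.var 35))) (.const 2)))
            (.setItem 36 (.var 35) (.add (.mul (.const 3) (.item 16 (.var 35))) (.const 1))))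
          (.setItem 36 (.var 35) (.mul (.const 3) (.item 16 (.var 35)))))
        (.setItem 37 (.item 36 (.var 35)) (.add (.item 37 (.item 36 (.var 35))) (.const 1)))))

theorem card_filter_range_succ (row : ℕ → ℕ) (j ρ : ℕ) :
    ((Finset.range (j + 1)).filter fun l => row l = ρ).card =
      ((Finset.range j).filter fun l => row l = ρ).card + if ρ = row j then 1 else 0 := by
  rw [Finset.range_add_one, Finset.filter_insert]
  by_cases h : row j = ρ
  · rw [if_pos h, if_pos h.symm, Finset.card_insert_of_notMem (by simp)]
  · rw [if_neg h, if_neg fun h' => h h'.symm, add_zero]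

theorem wp_rows (hH : 2 ≤ H) (hnH : n ≤ H) {T : ℕ} {typ G row : ℕ → ℕ} {r tab : ℕ → ℝ} {q M : ℝ}
    (hTH : 3 * T ≤ H) (hn : m.nat 0 0 1 = n) (hT : m.nat 14 0 0 = T)
    (htyp : ∀ j, m.nat 16 0 j = typ j) (hG : ∀ j, m.nat 34 0 j = G j)
    (hr : ∀ j, m.real 8 0 j = r j) (htab : ∀ j, m.real 9 0 j = tab j) (hq : m.real 4 0 0 = q)
    (hM : m.real 30 0 0 = M)
    (hrow : ∀ j < n, (r j * (tab (G (typ j) + 1) * q) ≤ M → row j = 3 * typ j) ∧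
      (M < r j * (tab (G (typ j) + 1) * q) → r j * tab (G (typ j) + 1) ≤ M →
        row j = 3 * typ j + 1) ∧
      (M < r j * (tab (G (typ j) + 1) * q) → M < r j * tab (G (typ j) + 1) →
        row j = 3 * typ j + 2)) :
    WP H f rows (fun m' => Fr [35, 36, 37] m m' ∧ (∀ j < n, m'.nat 36 0 j = row j) ∧
      ∀ ρ < 3 * T, m'.nat 37 0 ρ = ((Finset.range n).filter fun l => row l = ρ).card) m := by
  refine wp_seq hH ((wp_for hH [37] (fun a m' => ∀ ρ < a, m'.nat 37 0 ρ = 0) (by simp) hTH (by simp)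
    ?_ ?_).mono ?_)
  · intro m' hF
    simp [NatExpr.eval, hF.nat 14 (by simp), hT]
  · intro a ha m' hF ha' hI
    refine wp_writeNat hH ⟨(Fr.refl _ _).setNat (by simp) _ _ _, fun ρ hρ => ?_⟩
    simp only [NatExpr.eval, ha', Memory.setNat_nat, Nat.reduceEqDiff, false_and, if_false,
      true_and]
    split_ifs with h
    · rfl
    · exact hI ρ (by omega)
  rintro m₁ ⟨hF₁, h₁⟩
  refine (wp_for hH [36, 37] (fun a m' => (∀ j < a, m'.nat 36 0 j = row j) ∧
    ∀ ρ < 3 * T, m'.nat 37 0 ρ = ((Finset.range a).filter fun l => row l = ρ).card)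
    (by simp) hnH ?_ ?_ ?_).mono ?_
  · simpa using h₁
  · intro m' hF
    simp [NatExpr.eval, (hF₁.mono (by simp) |>.trans hF (by simp) : Fr [35, 36, 37] m m').nat 0
      (by simp), hn]
  · rintro j hj m' hF hj' ⟨h2, h3⟩
    have hFt : Fr [35, 36, 37] m m' := (hF₁.mono (by simp)).trans hF (by simp)
    have e16 : m'.nat 16 = m.nat 16 := hFt.nat 16 (by simp)
    have e34 : m'.nat 34 = m.nat 34 := hFt.nat 34 (by simp)
    have e8 : m'.real 8 = m.real 8 := hFt.real 8 (by simp)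
    have e9 : m'.real 9 = m.real 9 := hFt.real 9 (by simp)
    have e4 : m'.real 4 = m.real 4 := hFt.real 4 (by simp)
    have e30 : m'.real 30 = m.real 30 := hFt.real 30 (by simp)
    have key : ∀ v, v = row j → WP H f
        (.setItem 37 (.item 36 (.var 35)) (.add (.item 37 (.item 36 (.var 35))) (.const 1)))
        (fun m'' => Fr [36, 37] m' m'' ∧ (∀ l < j + 1, (m''.setNat 35 0 0 (j + 1)).nat 36 0 l = row l) ∧
          ∀ ρ < 3 * T, (m''.setNat 35 0 0 (j + 1)).nat 37 0 ρ =
            ((Finset.range (j + 1)).filter fun l => row l = ρ).card) (m'.setNat 36 0 j v) := by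
      rintro v rfl
      refine wp_writeNat hH ⟨((Fr.refl _ _).setNat (by simp) _ _ _).setNat (by simp) _ _ _, ?_, ?_⟩
      · intro l hl
        simp only [NatExpr.eval, Memory.setNat_nat, Nat.reduceEqDiff, false_and, if_false,
          true_and]
        split_ifs with h
        · rw [h]
        · exact h2 l (by omega)
      · intro ρ hρ
        rw [card_filter_range_succ]
        simp only [NatExpr.eval, hj', Memory.setNat_nat, Nat.reduceEqDiff, false_and, if_false,
          true_and, and_self, if_true]
        split_ifs with h
        · rw [h, h3 _ (h ▸ hρ)]
        · exact h3 ρ hρ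
    refine wp_seq hH (wp_cond hH (fun hb => wp_cond hH (fun hb' => ?_) fun hb' => ?_) fun hb => ?_)
    all_goals
      refine wp_writeNat hH ?_
      simp only [NatExpr.eval, hj', e16, htyp]
      refine key _ ?_
      simp only [Cond.Holds, NatExpr.eval, RealExpr.eval, hj', e16, e34, e8, e9, e4, e30, htyp, hG,
        hr, htab, hq, hM, not_lt] at hb
      try simp only [Cond.Holds, NatExpr.eval, RealExpr.eval, hj', e16, e34, e8, e9, e30,
        htyp, hG, hr, htab, hM, not_lt] at hb'
    · exact ((hrow j hj).2.2 hb hb').symm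
    · exact ((hrow j hj).2.1 hb hb').symm
    · exact ((hrow j hj).1 hb).symm
  · rintro m' ⟨hF, h⟩
    exact ⟨(hF₁.mono (by simp)).trans hF (by simp), h⟩

/-- Adds the move in array `44` to the count matrix in array `40` and tests the bounds for the
entries and for the row sums. -/
def rowPass : Program :=
  .seq (.set 47 (.const 1)) (.seq (.set 48 (.const 0))
    (.for 45 rowsE (.seq (.set 49 (.const 0))
      (.seq (.for 46 kE
          (.seq (.writeNat 50 (.var 45) (.var 46)
              (.sub (.add (.read 40 (.var 45) (.var 46))
                (.item 44 (.add (.mul (.var 45) kE) (.var 46)))) (.const 1)))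
            (.seq (.set 49 (.add (.var 49) (.read 50 (.var 45) (.var 46))))
              (.cond (.and (.natLt (.const 0) (.add (.read 40 (.var 45) (.var 46))
                    (.item 44 (.add (.mul (.var 45) kE) (.var 46)))))
                  (.not (.realLt
                    (.item 9 (.item 34 (.add (.var 14) (.add (.mul (.var 45) kE) (.var 46)))))
                    (.ofNat (.read 50 (.var 45) (.var 46))))))
                .skip (.set 47 (.const 0))))))
        (.seq (.set 48 (.add (.var 48) (.var 49)))
          (.cond (.natLt (.item 37 (.var 45)) (.var 49)) (.set 47 (.const 0)) .skip))))))

/-- Positivity of `x + e` is tested together with the bounds, because truncated subtraction would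
hide a decrease of a zero entry. -/
theorem wp_rowPass (hH : 2 ≤ H) (hkH : k ≤ H) {T : ℕ} (hTH : 3 * T ≤ H) {x : ℕ → ℕ → ℕ}
    {e G N : ℕ → ℕ} {tab : ℕ → ℝ} (hk : m.nat 0 0 0 = k) (hT : m.nat 14 0 0 = T)
    (hx : ∀ a b, m.nat 40 a b = x a b) (he : ∀ c, m.nat 44 0 c = e c) (hG : ∀ j, m.nat 34 0 j = G j)
    (htab : ∀ j, m.real 9 0 j = tab j) (hN : ∀ a, m.nat 37 0 a = N a) :
    WP H f rowPass (fun m' => Fr [45, 46, 47, 48, 49, 50] m m' ∧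
      (0 < m'.nat 47 0 0 ↔ ∀ a < 3 * T, (∀ b < k, 0 < x a b + e (a * k + b) ∧
          ((x a b + e (a * k + b) - 1 : ℕ) : ℝ) ≤ tab (G (T + (a * k + b)))) ∧
        ∑ b ∈ Finset.range k, (x a b + e (a * k + b) - 1) ≤ N a) ∧
      m'.nat 48 0 0 = total (3 * T) k (fun a b => x a b + e (a * k + b) - 1) ∧
      ∀ a < 3 * T, ∀ b < k, m'.nat 50 a b = x a b + e (a * k + b) - 1) m := by
  set Y : ℕ → ℕ → ℕ := fun a b => x a b + e (a * k + b) - 1 with hY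
  refine wp_seq hH (wp_writeNat hH (wp_seq hH (wp_writeNat hH ?_)))
  set m₁ := (m.setNat 47 _ _ _).setNat 48 _ _ _ with hm₁
  have hF₁ : Fr [45, 46, 47, 48, 49, 50] m m₁ :=
    ((Fr.refl _ _).setNat (by simp) _ _ _).setNat (by simp) _ _ _
  refine (wp_for hH [46, 47, 48, 49, 50] (fun a m' =>
    (0 < m'.nat 47 0 0 ↔ ∀ a' < a, (∀ b < k, 0 < x a' b + e (a' * k + b) ∧
          (Y a' b : ℝ) ≤ tab (G (T + (a' * k + b)))) ∧ ∑ b ∈ Finset.range k, Y a' b ≤ N a') ∧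
      m'.nat 48 0 0 = ∑ a' ∈ Finset.range a, ∑ b ∈ Finset.range k, Y a' b ∧
      ∀ a' < a, ∀ b < k, m'.nat 50 a' b = Y a' b) (by simp) hTH ?_ ?_ ?_).mono ?_
  · simp [hm₁, NatExpr.eval]
  · intro m' hF
    simp [NatExpr.eval, (hF₁.trans hF (by simp)).nat 14 (by simp), hT]
  · rintro a ha m' hF ha' ⟨h1, h2, h3⟩
    have hFt : Fr [45, 46, 47, 48, 49, 50] m m' := hF₁.trans hF (by simp)
    refine wp_seq hH (wp_writeNat hH (wp_seq hH ?_))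
    set m₂ := m'.setNat 49 _ _ _ with hm₂
    have hF₂ : Fr [46, 47, 48, 49, 50] m' m₂ := (Fr.refl _ _).setNat (by simp) _ _ _
    refine (wp_for hH [47, 49, 50] (fun b m'' =>
      (0 < m''.nat 47 0 0 ↔ 0 < m'.nat 47 0 0 ∧ ∀ b' < b, 0 < x a b' + e (a * k + b') ∧
          (Y a b' : ℝ) ≤ tab (G (T + (a * k + b')))) ∧
      m''.nat 49 0 0 = ∑ b' ∈ Finset.range b, Y a b' ∧
      (∀ b' < b, m''.nat 50 a b' = Y a b') ∧ ∀ a' ≠ a, ∀ b, m''.nat 50 a' b = m'.nat 50 a' b)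
      (by simp) hkH ?_ ?_ ?_).mono ?_
    · simp [hm₂, NatExpr.eval]
    · intro m'' hF'
      simp [NatExpr.eval, hF'.nat 0 (by simp), hm₂, hFt.nat 0 (by simp), hk]
    · rintro b hb m'' hF' hb' ⟨g1, g2, g3, g4⟩
      have hF'' : Fr [46, 47, 48, 49, 50] m' m'' := hF₂.trans hF' (by simp)
      have hFs : Fr [45, 46, 47, 48, 49, 50] m m'' := hFt.trans hF'' (by simp)
      have ea : m''.nat 45 0 0 = a := by rw [hF''.nat 45 (by simp), ha']
      have ek : m''.nat 0 0 0 = k := by rw [hFs.nat 0 (by simp), hk]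
      have eT : m''.nat 14 0 0 = T := by rw [hFs.nat 14 (by simp), hT]
      have ex : ∀ a b, m''.nat 40 a b = x a b := by rw [hFs.nat 40 (by simp)]; exact hx
      have ee : ∀ c, m''.nat 44 0 c = e c := by rw [hFs.nat 44 (by simp)]; exact he
      have eG : ∀ c, m''.nat 34 0 c = G c := by rw [hFs.nat 34 (by simp)]; exact hG
      have et : ∀ c, m''.real 9 0 c = tab c := by rw [hFs.real 9 (by simp)]; exact htab
      refine wp_seq hH (wp_writeNat hH (wp_seq hH (wp_writeNat hH ?_)))
      simp only [NatExpr.eval, Memory.setNat_nat, ea, hb', ek, ex, ee, Nat.reduceEqDiff, false_and,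
        if_false, and_self, if_true]
      have c1 : m''.nat 49 0 0 + (x a b + e (a * k + b) - 1) = ∑ b' ∈ Finset.range (b + 1), Y a b' := by
        rw [Finset.sum_range_succ, g2]
      have c2 : ∀ b' < b + 1, (if b' = b then x a b + e (a * k + b) - 1 else m''.nat 50 a b') = Y a b' := by
        intro b' hb'
        split_ifs with h
        · rw [h]
        · exact g3 b' (by omega)
      have c3 : ∀ P : ℕ → Prop, (∀ b' < b + 1, P b') ↔ (∀ b' < b, P b') ∧ P b := by
        intro P
        refine ⟨fun h => ⟨fun b' hb => h b' (by omega), h b (by omega)⟩, fun h b' hb => ?_⟩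
        rcases Nat.lt_succ_iff_lt_or_eq.1 hb with h' | rfl
        · exact h.1 b' h'
        · exact h.2
      have hFr : Fr [47, 49, 50] m'' ((m''.setNat 50 a b (x a b + e (a * k + b) - 1)).setNat 49 0 0
          (m''.nat 49 0 0 + (x a b + e (a * k + b) - 1))) :=
        ((Fr.refl _ _).setNat (by simp) _ _ _).setNat (by simp) _ _ _
      refine wp_cond hH (fun hc => ?_) (fun hc => ?_) <;>
      simp only [Cond.Holds, NatExpr.eval, RealExpr.eval, Memory.setNat_nat, Memory.setNat_real,
        ea, hb', ek, ex, ee, eT, eG, et, Nat.reduceEqDiff, false_and, if_false, and_self,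
        if_true, not_lt] at hc
      · refine wp_skip hH ⟨hFr, ?_⟩
        simp only [Memory.setNat_nat, Nat.reduceEqDiff, false_and, if_false, and_self, if_true,
          true_and, g1, c1]
        refine ⟨?_, c2, fun a' ha'' l => ?_⟩
        · rw [c3]
          exact ⟨fun h => ⟨h.1, h.2, hc⟩, fun h => ⟨h.1, h.2.1⟩⟩
        · rw [if_neg (by simp [ha''])]; exact g4 a' ha'' l
      · refine wp_writeNat hH ⟨hFr.setNat (by simp) _ _ _, ?_⟩
        simp only [NatExpr.eval, Memory.setNat_nat, Nat.reduceEqDiff, false_and, if_false, and_self, if_true,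
          true_and, c1]
        refine ⟨?_, c2, fun a' ha'' l => ?_⟩
        · rw [c3]
          exact ⟨fun h => absurd h (lt_irrefl _), fun h => absurd h.2.2 hc⟩
        · rw [if_neg (by simp [ha''])]; exact g4 a' ha'' l
    · rintro m'' ⟨hF', g1, g2, g3, g4⟩
      have hF'' : Fr [46, 47, 48, 49, 50] m' m'' := hF₂.trans hF' (by simp)
      have hFs : Fr [45, 46, 47, 48, 49, 50] m m'' := hFt.trans hF'' (by simp)
      have ea : m''.nat 45 0 0 = a := by rw [hF''.nat 45 (by simp), ha']
      have eN : ∀ c, m''.nat 37 0 c = N c := by rw [hFs.nat 37 (by simp)]; exact hN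
      have e48 : m''.nat 48 0 0 = m'.nat 48 0 0 := by
        rw [hF'.nat 48 (by simp), hm₂, Memory.setNat_nat_ne _ (by simp)]
      have c1 : m''.nat 48 0 0 + m''.nat 49 0 0 =
          ∑ a' ∈ Finset.range (a + 1), ∑ b ∈ Finset.range k, Y a' b := by
        rw [Finset.sum_range_succ, g2, e48, h2]
      have c2 : ∀ a' < a + 1, ∀ b < k, m''.nat 50 a' b = Y a' b := by
        intro a' ha' b hb
        by_cases h : a' = a
        · rw [h]; exact g3 b hb
        · rw [g4 a' h]; exact h3 a' (by omega) b hb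
      have c3 : ∀ P : ℕ → Prop, (∀ a' < a + 1, P a') ↔ (∀ a' < a, P a') ∧ P a := by
        intro P
        refine ⟨fun h => ⟨fun b' hb => h b' (by omega), h a (by omega)⟩, fun h b' hb => ?_⟩
        rcases Nat.lt_succ_iff_lt_or_eq.1 hb with h' | rfl
        · exact h.1 b' h'
        · exact h.2
      refine wp_seq hH (wp_writeNat hH (wp_cond hH (fun hc => ?_) (fun hc => ?_))) <;>
      simp only [Cond.Holds, NatExpr.eval, Memory.setNat_nat,
        ea, eN, g2, Nat.reduceEqDiff, false_and, if_false, not_lt] at hc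
      · refine wp_writeNat hH ⟨(hF''.setNat (by simp) _ _ _).setNat (by simp) _ _ _, ?_⟩
        simp only [NatExpr.eval, Memory.setNat_nat, Nat.reduceEqDiff, false_and, if_false, and_self,
          if_true, c1]
        refine ⟨?_, trivial, c2⟩
        rw [c3]
        exact ⟨fun h => absurd h (lt_irrefl _), fun h => absurd h.2.2 (not_le.2 hc)⟩
      · refine wp_skip hH ⟨hF''.setNat (by simp) _ _ _, ?_⟩
        simp only [NatExpr.eval, Memory.setNat_nat, Nat.reduceEqDiff, false_and, if_false, and_self,
          if_true, c1]
        refine ⟨?_, trivial, c2⟩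
        rw [c3, g1, h1]
        exact ⟨fun h => ⟨h.1, h.2, hc⟩, fun h => ⟨h.1, h.2.1⟩⟩
  · rintro m' ⟨hF, h1, h2, h3⟩
    exact ⟨hF₁.trans hF (by simp), h1, h2, h3⟩

/-- Tests the bounds for the column sums of the count matrix in array `50`. -/
def colPass : Program :=
  .for 46 kE (.seq (.set 49 (.const 0))
    (.seq (.for 45 rowsE (.set 49 (.add (.var 49) (.read 50 (.var 45) (.var 46)))))
      (.cond (.natLt (.item 1 (.var 46)) (.var 49)) (.set 47 (.const 0)) .skip)))

theorem wp_colPass (hH : 2 ≤ H) (hkH : k ≤ H) {T : ℕ} (hTH : 3 * T ≤ H) {Y : ℕ → ℕ → ℕ}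
    {u : ℕ → ℕ} (hk : m.nat 0 0 0 = k) (hT : m.nat 14 0 0 = T)
    (hY : ∀ a < 3 * T, ∀ b < k, m.nat 50 a b = Y a b) (hu : ∀ b, m.nat 1 0 b = u b) :
    WP H f colPass (fun m' => Fr [45, 46, 47, 49] m m' ∧
      (0 < m'.nat 47 0 0 ↔ 0 < m.nat 47 0 0 ∧
        ∀ b < k, ∑ a ∈ Finset.range (3 * T), Y a b ≤ u b)) m := by
  refine wp_for hH [45, 47, 49] (fun b m' => 0 < m'.nat 47 0 0 ↔ 0 < m.nat 47 0 0 ∧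
    ∀ b' < b, ∑ a ∈ Finset.range (3 * T), Y a b' ≤ u b') (by simp) hkH (by simp) ?_ ?_ |>.mono ?_
  · intro m' hF
    simp [NatExpr.eval, hF.nat 0 (by simp), hk]
  · intro b hb m' hF hb' hI
    refine wp_seq hH (wp_writeNat hH (wp_seq hH ?_))
    set m₂ := m'.setNat 49 _ _ _ with hm₂
    have hF₂ : Fr [45, 49] m' m₂ := (Fr.refl _ _).setNat (by simp) _ _ _
    refine (wp_for hH [49] (fun a m'' => m''.nat 49 0 0 = ∑ a' ∈ Finset.range a, Y a' b)
      (by simp) hTH ?_ ?_ ?_).mono ?_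
    · simp [hm₂, NatExpr.eval]
    · intro m'' hF'
      simp [NatExpr.eval, hF'.nat 14 (by simp), hm₂, hF.nat 14 (by simp), hT]
    · intro a ha m'' hF' ha' h1
      have hF'' : Fr [45, 49] m' m'' := hF₂.trans hF' (by simp)
      have e46 : m''.nat 46 0 0 = b := by rw [hF''.nat 46 (by simp), hb']
      have e50 : m''.nat 50 = m.nat 50 := by rw [hF''.nat 50 (by simp), hF.nat 50 (by simp)]
      refine wp_writeNat hH ⟨(Fr.refl _ _).setNat (by simp) _ _ _, ?_⟩
      simp [NatExpr.eval, h1, ha', e46, e50, hY a ha b hb, Finset.sum_range_succ]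
    · rintro m'' ⟨hF', h1⟩
      have hF'' : Fr [45, 49] m' m'' := hF₂.trans hF' (by simp)
      have e46 : m''.nat 46 0 0 = b := by rw [hF''.nat 46 (by simp), hb']
      have e1 : ∀ b, m''.nat 1 0 b = u b := by
        rw [hF''.nat 1 (by simp), hF.nat 1 (by simp)]; exact hu
      have e47 : m''.nat 47 0 0 = m'.nat 47 0 0 := by rw [hF''.nat 47 (by simp)]
      have c3 : ∀ P : ℕ → Prop, (∀ a' < b + 1, P a') ↔ (∀ a' < b, P a') ∧ P b := by
        intro P
        refine ⟨fun h => ⟨fun b' hb => h b' (by omega), h b (by omega)⟩, fun h b' hb => ?_⟩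
        rcases Nat.lt_succ_iff_lt_or_eq.1 hb with h' | rfl
        · exact h.1 b' h'
        · exact h.2
      refine wp_cond hH (fun hc => ?_) (fun hc => ?_) <;>
      simp only [Cond.Holds, NatExpr.eval, e46, e1, h1, not_lt] at hc
      · refine wp_writeNat hH ⟨(hF''.mono (by simp)).setNat (by simp) _ _ _, ?_⟩
        simp only [NatExpr.eval, Memory.setNat_nat, Nat.reduceEqDiff, false_and, if_false, and_self,
          if_true]
        rw [c3]
        exact ⟨fun h => absurd h (lt_irrefl _), fun h => absurd h.2.2 (not_le.2 hc)⟩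
      · refine wp_skip hH ⟨hF''.mono (by simp), ?_⟩
        simp only [Memory.setNat_nat, Nat.reduceEqDiff, false_and, if_false, e47]
        rw [c3, hI]
        exact ⟨fun h => ⟨h.1, h.2, hc⟩, fun h => ⟨h.1, h.2.1⟩⟩
  · rintro m' ⟨hF, h⟩
    exact ⟨hF.mono (by simp), h⟩

end

/-! ### Solving the transportation problem -/

section

variable {H n k : ℕ} {f : (Fin n → ℝ≥0) → ℝ≥0} {m : Memory}

/-- Every vector of digits occurs, so a loop over all numbers below `b ^ N` runs through all moves
or all guesses. -/
theorem exists_digits {b : ℕ} (N : ℕ) (e : ℕ → ℕ) (he : ∀ c, e c < b) :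
    ∃ w < b ^ N, ∀ c < N, w / b ^ c % b = e c := by
  induction N generalizing e with
  | zero => exact ⟨0, by simp, by simp⟩
  | succ N ih =>
    obtain ⟨w, hw, hd⟩ := ih (fun c => e (c + 1)) fun c => he _
    have h0 := he 0
    refine ⟨e 0 + b * w, ?_, ?_⟩
    · calc e 0 + b * w < b * (w + 1) := by rw [mul_add]; omega
        _ ≤ b * b ^ N := Nat.mul_le_mul_left _ hw
        _ = _ := by rw [pow_succ, mul_comm]
    · rintro (_ | c) hc
      · simp [Nat.add_mul_mod_self_left, Nat.mod_eq_of_lt h0]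
      · rw [pow_succ, mul_comm (b ^ c), ← Nat.div_div_eq_div_mul,
          Nat.add_mul_div_left _ _ (by omega), Nat.div_eq_of_lt h0, zero_add]
        exact hd c (by omega)

theorem CountMatrix.congr {R k : ℕ} {U : ℕ → ℕ → ℕ → Prop} {N u : ℕ → ℕ} {x y : ℕ → ℕ → ℕ}
    (hx : CountMatrix R k U N u x) (h : ∀ a < R, ∀ b < k, y a b = x a b) :
    CountMatrix R k U N u y where
  entry a ha b hb := by rw [h a ha b hb]; exact hx.entry a ha b hb
  row a ha := by
    rw [Finset.sum_congr rfl fun b hb => h a ha b (Finset.mem_range.1 hb)]; exact hx.row a ha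
  col b hb := by
    rw [Finset.sum_congr rfl fun a ha => h a (Finset.mem_range.1 ha) b hb]; exact hx.col b hb

theorem total_congr {R k : ℕ} {x y : ℕ → ℕ → ℕ} (h : ∀ a < R, ∀ b < k, y a b = x a b) :
    total R k y = total R k x :=
  Finset.sum_congr rfl fun a ha => Finset.sum_congr rfl fun b hb =>
    h a (Finset.mem_range.1 ha) b (Finset.mem_range.1 hb)

/-- Fills the count matrix in array `40`. -/
def fillMatrix (e : NatExpr) : Program :=
  .for 45 rowsE (.for 46 kE (.writeNat 40 (.var 45) (.var 46) e))

theorem wp_fillMatrix (hH : 2 ≤ H) (hkH : k ≤ H) {T : ℕ} (hTH : 3 * T ≤ H) {Y : ℕ → ℕ → ℕ}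
    (hk : m.nat 0 0 0 = k) (hT : m.nat 14 0 0 = T) {e : NatExpr}
    (he : ∀ m' : Memory, Fr [40, 45, 46] m m' → m'.nat 45 0 0 < 3 * T → m'.nat 46 0 0 < k →
      e.eval m' = Y (m'.nat 45 0 0) (m'.nat 46 0 0)) :
    WP H f (fillMatrix e) (fun m' => Fr [40, 45, 46] m m' ∧
      ∀ a < 3 * T, ∀ b < k, m'.nat 40 a b = Y a b) m := by
  refine (wp_for hH [40, 46] (fun a m' => ∀ a' < a, ∀ b < k, m'.nat 40 a' b = Y a' b)
    (by simp) hTH (by simp) ?_ ?_).mono ?_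
  · intro m' hF
    simp [NatExpr.eval, hF.nat 14 (by simp), hT]
  · intro a ha m' hF ha' hI
    refine (wp_for hH [40] (fun b m'' => (∀ a' ≠ a, ∀ l, m''.nat 40 a' l = m'.nat 40 a' l) ∧
      ∀ b' < b, m''.nat 40 a b' = Y a b') (by simp) hkH (by simp) ?_ ?_).mono ?_
    · intro m'' hF'
      simp [NatExpr.eval, hF'.nat 0 (by simp), hF.nat 0 (by simp), hk]
    · rintro b hb m'' hF' hb' ⟨h1, h2⟩
      have ea : m''.nat 45 0 0 = a := by rw [hF'.nat 45 (by simp), ha']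
      refine wp_writeNat hH ⟨(Fr.refl _ _).setNat (by simp) _ _ _, ?_⟩
      rw [he m'' ((hF.mono (by simp)).trans hF' (by simp)) (by omega) (by omega)]
      simp only [NatExpr.eval, Memory.setNat_nat, Nat.reduceEqDiff, false_and, if_false, true_and,
        ea, hb']
      refine ⟨fun a' ha'' l => by rw [if_neg (by simp [ha''])]; exact h1 a' ha'' l, ?_⟩
      intro b' hb''
      split_ifs with h
      · rw [h]
      · exact h2 b' (by omega)
    · rintro m'' ⟨hF', h1, h2⟩
      refine ⟨hF'.mono (by simp), ?_⟩
      simp only [Memory.setNat_nat, Nat.reduceEqDiff, false_and, if_false]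
      intro a' ha'' b hb
      by_cases h : a' = a
      · rw [h]; exact h2 b hb
      · rw [h1 a' h]; exact hI a' (by omega) b hb
  · rintro m' ⟨hF, h⟩
    exact ⟨hF.mono (by simp), h⟩

/-- The bounds for the entries of the count matrix that come from the digits `G`. -/
def entryBound (T k : ℕ) (tab : ℕ → ℝ) (G : ℕ → ℕ) (a b v : ℕ) : Prop :=
  (v : ℝ) ≤ tab (G (T + (a * k + b)))

/-- Makes the move number `h` if it leads to a count matrix with a larger sum than `s`. -/
def attempt : Program :=
  .seq (digits 41 (.var 39) (.var 20) (.const 3)) (.seq rowPass (.seq colPass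
    (.cond (.and (.natLt (.const 0) (.var 47)) (.natLt (.var 38) (.var 48)))
      (fillMatrix (.read 50 (.var 45) (.var 46))) .skip)))

theorem wp_attempt (hH : 2 ≤ H) (hkH : k ≤ H) {T : ℕ} (hTH : 3 * T ≤ H) (hcH : 3 * T * k ≤ H)
    {x : ℕ → ℕ → ℕ} {G N u : ℕ → ℕ} {tab : ℕ → ℝ} {s w : ℕ} (hk : m.nat 0 0 0 = k)
    (hT : m.nat 14 0 0 = T) (hc : m.nat 20 0 0 = 3 * T * k) (hx : ∀ a b, m.nat 40 a b = x a b)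
    (hG : ∀ j, m.nat 34 0 j = G j) (htab : ∀ j, m.real 9 0 j = tab j)
    (hN : ∀ a, m.nat 37 0 a = N a) (hu : ∀ b, m.nat 1 0 b = u b) (hs : m.nat 38 0 0 = s)
    (hw : m.nat 39 0 0 = w) (hwH : w ≤ H) {e : ℕ → ℕ → ℕ} {Y : ℕ → ℕ → ℕ}
    (he : ∀ a b, e a b = w / 3 ^ (a * k + b) % 3) (hY : ∀ a b, Y a b = x a b + e a b - 1) :
    WP H f attempt (fun m' => Fr [40, 41, 42, 43, 44, 45, 46, 47, 48, 49, 50] m m' ∧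
      ((∀ a < 3 * T, ∀ b < k, 0 < x a b + e a b) ∧
          CountMatrix (3 * T) k (entryBound T k tab G) N u Y ∧ s < total (3 * T) k Y →
        ∀ a < 3 * T, ∀ b < k, m'.nat 40 a b = Y a b) ∧
      (¬ ((∀ a < 3 * T, ∀ b < k, 0 < x a b + e a b) ∧
          CountMatrix (3 * T) k (entryBound T k tab G) N u Y ∧ s < total (3 * T) k Y) →
        m'.nat 40 = m.nat 40)) m := by
  have hidx : ∀ a < 3 * T, ∀ b < k, a * k + b < 3 * T * k := by
    intro a ha b hb
    calc a * k + b < (a + 1) * k := by rw [add_mul]; omega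
      _ ≤ 3 * T * k := Nat.mul_le_mul_right _ ha
  refine wp_seq hH ((wp_digits (w := w) (N' := 3 * T * k) (b := 3) hH (by norm_num)
    (by simp [NatExpr.eval, hw]) hwH hcH ?_ ?_).mono ?_)
  · intro m' hF
    simp [NatExpr.eval, hF.nat 20 (by simp), hc]
  · intro m' hF
    simp [NatExpr.eval]
  rintro m₁ ⟨hF₁, h₁⟩
  set e' : ℕ → ℕ := fun c => m₁.nat 44 0 c with he'
  have hee : ∀ a < 3 * T, ∀ b < k, e' (a * k + b) = e a b := by
    intro a ha b hb
    rw [he, ← h₁ _ (hidx a ha b hb)]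
  have hYY : ∀ a < 3 * T, ∀ b < k, x a b + e' (a * k + b) - 1 = Y a b := by
    intro a ha b hb
    rw [hee a ha b hb, hY]
  refine wp_seq hH ((wp_rowPass (T := T) (x := x) (e := e') (G := G) (N := N) (tab := tab) hH hkH hTH
    (by rw [hF₁.nat 0 (by simp), hk]) (by rw [hF₁.nat 14 (by simp), hT])
    (by rw [hF₁.nat 40 (by simp)]; exact hx) (fun _ => rfl)
    (by rw [hF₁.nat 34 (by simp)]; exact hG) (by rw [hF₁.real 9 (by simp)]; exact htab)
    (by rw [hF₁.nat 37 (by simp)]; exact hN)).mono ?_)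
  rintro m₂ ⟨hF₂, h₂, h₂', h₂''⟩
  have hF₂' : Fr [41, 42, 43, 44, 45, 46, 47, 48, 49, 50] m m₂ :=
    (hF₁.mono (by simp)).trans hF₂ (by simp)
  refine wp_seq hH ((wp_colPass (T := T) (Y := Y) (u := u) hH hkH hTH
    (by rw [hF₂'.nat 0 (by simp), hk]) (by rw [hF₂'.nat 14 (by simp), hT])
    (fun a ha b hb => by rw [h₂'' a ha b hb, hYY a ha b hb])
    (by rw [hF₂'.nat 1 (by simp)]; exact hu)).mono ?_)
  rintro m₃ ⟨hF₃, h₃⟩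
  have hF₃' : Fr [41, 42, 43, 44, 45, 46, 47, 48, 49, 50] m m₃ := hF₂'.trans hF₃ (by simp)
  have htot : m₃.nat 48 0 0 = total (3 * T) k Y := by
    rw [hF₃.nat 48 (by simp), h₂']
    exact total_congr fun a ha b hb => (hYY a ha b hb)
  have hgood : (0 < m₃.nat 47 0 0 ∧ s < m₃.nat 48 0 0) ↔
      ((∀ a < 3 * T, ∀ b < k, 0 < x a b + e a b) ∧
          CountMatrix (3 * T) k (entryBound T k tab G) N u Y ∧ s < total (3 * T) k Y) := by
    rw [htot, h₃, h₂]
    have hsum : ∀ a < 3 * T, ∑ b ∈ Finset.range k, (x a b + e' (a * k + b) - 1) =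
        ∑ b ∈ Finset.range k, Y a b := fun a ha =>
      Finset.sum_congr rfl fun b hb => hYY a ha b (Finset.mem_range.1 hb)
    constructor
    · rintro ⟨⟨h1, h2⟩, h3⟩
      refine ⟨fun a ha b hb => ?_, ⟨fun a ha b hb => ?_, fun a ha => ?_, h2⟩, h3⟩
      · rw [← hee a ha b hb]; exact ((h1 a ha).1 b hb).1
      · rw [← hYY a ha b hb]; exact ((h1 a ha).1 b hb).2
      · rw [← hsum a ha]; exact (h1 a ha).2
    · rintro ⟨h1, h2, h3⟩
      refine ⟨⟨fun a ha => ⟨fun b hb => ⟨?_, ?_⟩, ?_⟩, h2.col⟩, h3⟩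
      · rw [hee a ha b hb]; exact h1 a ha b hb
      · rw [hYY a ha b hb]; exact h2.entry a ha b hb
      · rw [hsum a ha]; exact h2.row a ha
  refine wp_cond hH (fun hb => ?_) (fun hb => ?_) <;>
  simp only [Cond.Holds, NatExpr.eval, hF₃'.nat 38 (by simp), hs] at hb
  · refine (wp_fillMatrix (T := T) (Y := Y) hH hkH hTH (by rw [hF₃'.nat 0 (by simp), hk])
      (by rw [hF₃'.nat 14 (by simp), hT]) ?_).mono ?_
    · intro m' hF ha' hb'
      simp only [NatExpr.eval, hF.nat 50 (by simp), hF₃.nat 50 (by simp)]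
      rw [h₂'' _ ha' _ hb', hYY _ ha' _ hb']
    · rintro m' ⟨hF, h⟩
      exact ⟨(hF₃'.mono (by simp)).trans hF (by simp), fun _ => h, fun hn => absurd (hgood.1 hb) hn⟩
  · exact wp_skip hH ⟨hF₃'.mono (by simp), fun hg => absurd (hgood.2 hg) hb,
      fun _ => hF₃'.nat 40 (by simp)⟩

/-- Computes a count matrix that respects all bounds and has the largest sum. -/
def flow : Program :=
  .seq (fillMatrix (.const 0)) (.for 38 nE (.for 39 (.var 24) attempt))

/-- If some admissible matrix has sum at least `n`, then after `s` rounds the sum is at least `s`.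
Otherwise the current sum would be exactly `s`, with every move tried in vain, which contradicts
`CountMatrix.exists_augmentation`. -/
theorem wp_flow (hH : 2 ≤ H) (hkH : k ≤ H) (hnH : n ≤ H) {T : ℕ} (hTH : 3 * T ≤ H)
    (hcH : 3 * T * k ≤ H) (h3H : 3 ^ (3 * T * k) ≤ H) {G N u : ℕ → ℕ} {tab : ℕ → ℝ}
    (hk : m.nat 0 0 0 = k) (hn : m.nat 0 0 1 = n) (hT : m.nat 14 0 0 = T)
    (hc : m.nat 20 0 0 = 3 * T * k) (h3 : m.nat 24 0 0 = 3 ^ (3 * T * k))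
    (hG : ∀ j, m.nat 34 0 j = G j) (htab : ∀ j, m.real 9 0 j = tab j)
    (hN : ∀ a, m.nat 37 0 a = N a) (hu : ∀ b, m.nat 1 0 b = u b)
    (h0 : ∀ a < 3 * T, ∀ b < k, 0 ≤ tab (G (T + (a * k + b)))) :
    WP H f flow (fun m' => Fr [38, 39, 40, 41, 42, 43, 44, 45, 46, 47, 48, 49, 50] m m' ∧
      CountMatrix (3 * T) k (entryBound T k tab G) N u (m'.nat 40) ∧
      ∀ y, CountMatrix (3 * T) k (entryBound T k tab G) N u y → n ≤ total (3 * T) k y →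
        n ≤ total (3 * T) k (m'.nat 40)) m := by
  have hU : ∀ a b v w, v ≤ w → entryBound T k tab G a b w → entryBound T k tab G a b v :=
    fun a b v w hvw h => le_trans (by exact_mod_cast hvw) h
  refine wp_seq hH ((wp_fillMatrix (T := T) (Y := fun _ _ => 0) hH hkH hTH hk hT
    (by simp [NatExpr.eval])).mono ?_)
  rintro m₁ ⟨hF₁, h₁⟩
  have hx₁ : CountMatrix (3 * T) k (entryBound T k tab G) N u (m₁.nat 40) :=
    CountMatrix.congr (x := fun _ _ => 0) ⟨by simpa [entryBound] using h0, by simp, by simp⟩ h₁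
  refine (wp_for hH [39, 40, 41, 42, 43, 44, 45, 46, 47, 48, 49, 50] (fun s m' =>
      CountMatrix (3 * T) k (entryBound T k tab G) N u (m'.nat 40) ∧
      ∀ y, CountMatrix (3 * T) k (entryBound T k tab G) N u y → n ≤ total (3 * T) k y →
        s ≤ total (3 * T) k (m'.nat 40)) (by simp) hnH ?_ ?_ ?_).mono ?_
  · simpa [Memory.setNat_nat_ne] using hx₁
  · intro m' hF
    simp [NatExpr.eval, hF.nat 0 (by simp), hF₁.nat 0 (by simp), hn]
  · rintro s hs m₂ hF₂ hs₂ ⟨g1, g2⟩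
    have hF₂' : Fr [38, 39, 40, 41, 42, 43, 44, 45, 46, 47, 48, 49, 50] m m₂ :=
      (hF₁.mono (by simp)).trans hF₂ (by simp)
    let Y : (ℕ → ℕ → ℕ) → ℕ → ℕ → ℕ → ℕ := fun x w a b => x a b + w / 3 ^ (a * k + b) % 3 - 1
    let Good : (ℕ → ℕ → ℕ) → ℕ → Prop := fun x w =>
      (∀ a < 3 * T, ∀ b < k, 0 < x a b + w / 3 ^ (a * k + b) % 3) ∧
        CountMatrix (3 * T) k (entryBound T k tab G) N u (Y x w) ∧ s < total (3 * T) k (Y x w)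
    -- Moves may still be made after the first success of a round. They do no harm, since a move is
    -- made only if its result has a sum above `s`.
    refine (wp_for hH [40, 41, 42, 43, 44, 45, 46, 47, 48, 49, 50] (fun w m' =>
      CountMatrix (3 * T) k (entryBound T k tab G) N u (m'.nat 40) ∧
      (s < total (3 * T) k (m'.nat 40) ∨ m'.nat 40 = m₂.nat 40 ∧ ∀ w' < w, ¬ Good (m₂.nat 40) w'))
      (by simp) h3H ?_ ?_ ?_).mono ?_
    · simpa [Memory.setNat_nat_ne] using g1
    · intro m' hF
      simp [NatExpr.eval, hF.nat 24 (by simp), hF₂'.nat 24 (by simp), h3]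
    · rintro w hw m₃ hF₃ hw₃ ⟨k1, k2⟩
      have hF₃' : Fr [38, 39, 40, 41, 42, 43, 44, 45, 46, 47, 48, 49, 50] m m₃ :=
        hF₂'.trans hF₃ (by simp)
      refine (wp_attempt (T := T) (x := m₃.nat 40) (G := G) (N := N) (u := u) (tab := tab) (s := s)
        (w := w) (e := fun a b => w / 3 ^ (a * k + b) % 3) (Y := Y (m₃.nat 40) w) hH hkH hTH hcH
        (by rw [hF₃'.nat 0 (by simp), hk]) (by rw [hF₃'.nat 14 (by simp), hT])
        (by rw [hF₃'.nat 20 (by simp), hc]) (fun _ _ => rfl)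
        (by rw [hF₃'.nat 34 (by simp)]; exact hG) (by rw [hF₃'.real 9 (by simp)]; exact htab)
        (by rw [hF₃'.nat 37 (by simp)]; exact hN) (by rw [hF₃'.nat 1 (by simp)]; exact hu)
        (by rw [hF₃.nat 38 (by simp), hs₂]) hw₃ (hw.le.trans h3H) (fun _ _ => rfl)
        (fun _ _ => rfl)).mono ?_
      rintro m₄ ⟨hF₄, e1, e2⟩
      refine ⟨hF₄, ?_⟩
      rw [Memory.setNat_nat_ne _ (by simp)]
      by_cases hg : Good (m₃.nat 40) w
      · refine ⟨hg.2.1.congr (e1 hg), .inl ?_⟩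
        rw [total_congr (e1 hg)]
        exact hg.2.2
      · rw [e2 hg]
        refine ⟨k1, k2.imp_right fun k2 => ⟨k2.1, fun w' hw' => ?_⟩⟩
        rcases Nat.lt_succ_iff_lt_or_eq.1 hw' with h | rfl
        · exact k2.2 w' h
        · rw [← k2.1]; exact hg
    · rintro m₃ ⟨hF₃, k1, k2⟩
      refine ⟨hF₃, ?_⟩
      rw [Memory.setNat_nat_ne _ (by simp)]
      refine ⟨k1, fun y hy hny => ?_⟩
      rcases k2 with k2 | ⟨k2, k3⟩
      · exact k2
      by_contra! hlt
      have hge := g2 y hy hny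
      rw [k2] at hlt
      obtain ⟨e, he3, he1, he2, he4⟩ := g1.exists_augmentation hU hy (by omega)
      obtain ⟨w, hw, hd⟩ := exists_digits (b := 3) (3 * T * k) (fun c => e (c / k) (c % k))
        fun c => he3 _ _
      have hdig : ∀ a < 3 * T, ∀ b < k, w / 3 ^ (a * k + b) % 3 = e a b := by
        intro a ha b hb
        have hlt : a * k + b < 3 * T * k := by
          calc a * k + b < (a + 1) * k := by rw [add_mul]; omega
            _ ≤ 3 * T * k := Nat.mul_le_mul_right _ ha
        have hk0 : 0 < k := by omega
        rw [hd _ hlt, mul_comm a k, Nat.mul_add_div hk0, Nat.div_eq_of_lt hb, Nat.mul_add_mod,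
          Nat.mod_eq_of_lt hb, add_zero]
      have hYY : ∀ a < 3 * T, ∀ b < k, Y (m₂.nat 40) w a b = m₂.nat 40 a b + e a b - 1 := by
        intro a ha b hb
        simp only [Y]
        rw [hdig a ha b hb]
      refine k3 w hw ⟨fun a ha b hb => ?_, he2.congr hYY, ?_⟩
      · rw [hdig a ha b hb]; exact he1 a ha b hb
      · rw [total_congr hYY]; omega
  · rintro m' ⟨hF, h⟩
    exact ⟨(hF₁.mono (by simp)).trans hF (by simp), h⟩

end

/-! ### From a count matrix to an assignment -/

section

variable {H n k : ℕ} {f : (Fin n → ℝ≥0) → ℝ≥0} {m : Memory}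

/-- Assigns client `j` to a facility for which the count matrix in array `40` has a positive entry
in the row of `j`. -/
def assignClient (j : NatExpr) : Program :=
  .seq (.set 53 (.const 0))
    (.for 52 kE (.cond (.and (.natLt (.var 53) (.const 1))
        (.natLt (.const 0) (.read 40 (.item 36 j) (.var 52))))
      (.seq (.setItem 54 j (.var 52)) (.seq (.set 53 (.const 1))
        (.writeNat 40 (.item 36 j) (.var 52)
          (.sub (.read 40 (.item 36 j) (.var 52)) (.const 1)))))
      .skip))

theorem wp_assignClient (hH : 2 ≤ H) (hkH : k ≤ H) {jE : NatExpr} {j ρ : ℕ}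
    (hk : m.nat 0 0 0 = k) (hρ : m.nat 36 0 j = ρ)
    (hj : ∀ m', Fr [40, 52, 53, 54] m m' → jE.eval m' = j) :
    WP H f (assignClient jE) (fun m' => Fr [40, 52, 53, 54] m m' ∧
      ((m'.nat 53 0 0 = 0 ∧ ∀ b < k, m.nat 40 ρ b = 0) ∨
        (m'.nat 53 0 0 = 1 ∧ ∃ i < k, 0 < m.nat 40 ρ i ∧
          (∀ l, m'.nat 54 0 l = if l = j then i else m.nat 54 0 l) ∧
          ∀ a b, m'.nat 40 a b = if a = ρ ∧ b = i then m.nat 40 a b - 1 else m.nat 40 a b))) m := by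
  refine wp_seq hH (wp_writeNat hH ?_)
  set m₁ := m.setNat 53 _ _ _ with hm₁
  have hF₁ : Fr [40, 52, 53, 54] m m₁ := (Fr.refl _ _).setNat (by simp) _ _ _
  refine (wp_for hH [40, 53, 54] (fun b m' =>
      (m'.nat 53 0 0 = 0 ∧ (∀ b' < b, m.nat 40 ρ b' = 0) ∧ m'.nat 40 = m.nat 40 ∧
          m'.nat 54 = m.nat 54) ∨
        (m'.nat 53 0 0 = 1 ∧ ∃ i < k, 0 < m.nat 40 ρ i ∧
          (∀ l, m'.nat 54 0 l = if l = j then i else m.nat 54 0 l) ∧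
          ∀ a b, m'.nat 40 a b = if a = ρ ∧ b = i then m.nat 40 a b - 1 else m.nat 40 a b))
      (by simp) hkH ?_ ?_ ?_).mono ?_
  · refine .inl ⟨?_, by simp, ?_, ?_⟩
    · simp [hm₁, NatExpr.eval]
    · rw [Memory.setNat_nat_ne _ (by simp), hm₁, Memory.setNat_nat_ne _ (by simp)]
    · rw [Memory.setNat_nat_ne _ (by simp), hm₁, Memory.setNat_nat_ne _ (by simp)]
  · intro m' hF
    simp [NatExpr.eval, (hF₁.trans hF (by simp)).nat 0 (by simp), hk]
  · rintro b hb m' hF hb' hI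
    have hFt : Fr [40, 52, 53, 54] m m' := hF₁.trans hF (by simp)
    have ej := hj _ hFt
    have eρ : m'.nat 36 0 j = ρ := by rw [hFt.nat 36 (by simp), hρ]
    refine wp_cond hH (fun hc => ?_) (fun hc => ?_) <;>
    simp only [Cond.Holds, NatExpr.eval, ej, eρ, hb'] at hc
    · rcases hI with ⟨h1, h2, h3, h4⟩ | ⟨h1, -⟩
      swap
      · omega
      rw [h3] at hc
      refine wp_seq hH (wp_writeNat hH (wp_seq hH (wp_writeNat hH (wp_writeNat hH
        ⟨((((Fr.refl _ _).setNat (by simp) _ _ _).setNat (by simp) _ _ _).setNat (by simp) _ _ _),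
          .inr ?_⟩))))
      have ej' : ∀ a v, jE.eval ((m'.setNat 54 0 j a).setNat 53 0 0 v) = j := fun a v =>
        hj _ ((hFt.setNat (by simp) _ _ _).setNat (by simp) _ _ _)
      simp only [NatExpr.eval, ej, ej', hb', Memory.setNat_nat, Nat.reduceEqDiff, false_and,
        if_false, and_self, if_true, eρ, true_and, h3, h4]
      refine ⟨b, hb, hc.2, fun l => rfl, fun a b' => ?_⟩
      split_ifs with h
      · rw [h.1, h.2]
      · rfl
    · refine wp_skip hH ⟨Fr.refl _ _, ?_⟩
      rw [Memory.setNat_nat_ne _ (by simp), Memory.setNat_nat_ne _ (by simp),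
        Memory.setNat_nat_ne _ (by simp)]
      refine hI.imp_left fun ⟨h1, h2, h3, h4⟩ => ⟨h1, fun b' hb' => ?_, h3, h4⟩
      rw [h1, h3] at hc
      rcases Nat.lt_succ_iff_lt_or_eq.1 hb' with h | rfl
      · exact h2 b' h
      · omega
  · rintro m' ⟨hF, h⟩
    exact ⟨hF₁.trans hF (by simp), h.imp_left fun h => ⟨h.1, h.2.1⟩⟩

/-- Turns the count matrix into an assignment in array `54` with the vector of connection distances
in array `55`. The variable `57` becomes positive if this fails. -/
def extract : Program :=
  .seq (.set 57 (.const 0))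
    (.for 51 nE (.seq (assignClient (.var 51))
      (.seq (.cond (.natLt (.var 53) (.const 1)) (.set 57 (.const 1)) .skip)
        (.setRItem 55 (.var 51) (distE (.var 51) (.item 54 (.var 51)))))))

theorem card_filter_cell_succ (row sig sig' : ℕ → ℕ) (j i a b : ℕ)
    (hs : ∀ l, sig' l = if l = j then i else sig l) :
    ((Finset.range (j + 1)).filter fun l => row l = a ∧ sig' l = b).card =
      ((Finset.range j).filter fun l => row l = a ∧ sig l = b).card +
        if a = row j ∧ b = i then 1 else 0 := by
  have hlt : (Finset.range j).filter (fun l => row l = a ∧ sig' l = b) =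
      (Finset.range j).filter fun l => row l = a ∧ sig l = b := by
    refine Finset.filter_congr fun l hl => ?_
    rw [hs, if_neg (Finset.mem_range.1 hl).ne]
  rw [Finset.range_add_one, Finset.filter_insert, hlt, hs, if_pos rfl]
  by_cases h : row j = a ∧ i = b
  · rw [if_pos h, if_pos ⟨h.1.symm, h.2.symm⟩, Finset.card_insert_of_notMem (by simp)]
  · rw [if_neg h, if_neg fun h' => h ⟨h'.1.symm, h'.2.symm⟩, add_zero]

/-- What is left of the matrix plus the clients already assigned is the original matrix, cell by
cell. This bounds the cell counts from above and shows that no row runs out of units if its sum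
suffices for all its clients. -/
theorem wp_extract (hH : 2 ≤ H) (hkH : k ≤ H) (hnH : n ≤ H) {row : ℕ → ℕ} {c : ℕ → ℕ → ℝ}
    (hk : m.nat 0 0 0 = k) (hn : m.nat 0 0 1 = n) (hc : ∀ j i, m.real 1 (k + j) i = c j i)
    (hrow : ∀ j < n, m.nat 36 0 j = row j) :
    WP H f extract (fun m' => Fr [40, 51, 52, 53, 54, 55, 57] m m' ∧
      (m'.nat 57 0 0 = 0 →
        (∀ j < n, m'.nat 54 0 j < k ∧ m'.real 55 0 j = c j (m'.nat 54 0 j)) ∧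
        ∀ a b, ((Finset.range n).filter fun l => row l = a ∧ m'.nat 54 0 l = b).card ≤
          m.nat 40 a b) ∧
      ((∀ j < n, ((Finset.range n).filter fun l => row l = row j).card ≤
        ∑ b ∈ Finset.range k, m.nat 40 (row j) b) → m'.nat 57 0 0 = 0)) m := by
  refine wp_seq hH (wp_writeNat hH ?_)
  set m₁ := m.setNat 57 _ _ _ with hm₁
  have hF₁ : Fr [40, 51, 52, 53, 54, 55, 57] m m₁ := (Fr.refl _ _).setNat (by simp) _ _ _
  refine (wp_for hH [40, 52, 53, 54, 55, 57] (fun a m' =>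
      (m'.nat 57 0 0 = 0 →
        (∀ j < a, m'.nat 54 0 j < k ∧ m'.real 55 0 j = c j (m'.nat 54 0 j)) ∧
        ∀ ρ b, m'.nat 40 ρ b +
          ((Finset.range a).filter fun l => row l = ρ ∧ m'.nat 54 0 l = b).card = m.nat 40 ρ b) ∧
      ((∀ j < n, ((Finset.range n).filter fun l => row l = row j).card ≤
        ∑ b ∈ Finset.range k, m.nat 40 (row j) b) → m'.nat 57 0 0 = 0)) (by simp) hnH ?_ ?_ ?_).mono ?_
  · simp [hm₁, NatExpr.eval]
  · intro m' hF
    simp [NatExpr.eval, (hF₁.trans hF (by simp)).nat 0 (by simp), hn]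
  · rintro j hj m₂ hF₂ hj₂ ⟨g2, g3⟩
    have hF₂' : Fr [40, 51, 52, 53, 54, 55, 57] m m₂ := hF₁.trans hF₂ (by simp)
    refine wp_seq hH ((wp_assignClient (j := j) (ρ := row j) hH hkH
      (by rw [hF₂'.nat 0 (by simp), hk]) (by rw [hF₂'.nat 36 (by simp), hrow j hj]) ?_).mono ?_)
    · intro m' hF
      simp [NatExpr.eval, hF.nat 51 (by simp), hj₂]
    rintro m₃ ⟨hF₃, h₃⟩
    have e51 : m₃.nat 51 0 0 = j := by rw [hF₃.nat 51 (by simp), hj₂]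
    have e57 : m₃.nat 57 0 0 = m₂.nat 57 0 0 := by rw [hF₃.nat 57 (by simp)]
    have e55 : m₃.real 55 = m₂.real 55 := hF₃.real 55 (by simp)
    have ek : m₃.nat 0 0 0 = k := by rw [hF₃.nat 0 (by simp), hF₂'.nat 0 (by simp), hk]
    have ec : ∀ j i, m₃.real 1 (k + j) i = c j i := by
      rw [hF₃.real 1 (by simp), hF₂'.real 1 (by simp)]; exact hc
    refine wp_seq hH (wp_cond hH (fun hb => ?_) (fun hb => ?_)) <;>
    simp only [Cond.Holds, NatExpr.eval] at hb
    · rcases h₃ with ⟨h3, h4⟩ | ⟨h3, -⟩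
      swap
      · omega
      refine wp_writeNat hH (wp_writeReal hH ⟨((hF₃.mono (by simp)).setNat (by simp) _ _ _).setReal
        (by simp) _ _ _, ?_⟩)
      simp only [NatExpr.eval, RealExpr.eval, Memory.setNat_nat, Memory.setNat_real,
        Memory.setReal_nat, Memory.setReal_real, Nat.reduceEqDiff, false_and, if_false, and_self,
        if_true, true_and, e51, ek, ec]
      refine ⟨fun h => absurd h (by simp), fun hall => ?_⟩
      · exfalso
        obtain ⟨h5, h6⟩ := g2 (g3 hall)
        have h7 := hall j hj
        -- The row of `j` is used up, so its original sum counts precisely the earlier clients of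
        -- the row, and `j` itself is one client too many.
        have h8 : ∑ b ∈ Finset.range k, m.nat 40 (row j) b =
            ((Finset.range j).filter fun l => row l = row j).card := by
          rw [Finset.card_eq_sum_card_fiberwise (f := fun l => m₂.nat 54 0 l) (t := Finset.range k)]
          · refine Finset.sum_congr rfl fun b hb => ?_
            rw [← h6, h4 b (Finset.mem_range.1 hb), zero_add, Finset.filter_filter]
          · intro l hl
            simp only [Finset.coe_filter, Finset.mem_range, Set.mem_ofPred_eq] at hl
            exact Finset.mem_coe.2 (Finset.mem_range.2 (h5 l hl.1).1)
        have h9 : ((Finset.range (j + 1)).filter fun l => row l = row j).card ≤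
            ((Finset.range n).filter fun l => row l = row j).card :=
          Finset.card_le_card (Finset.filter_subset_filter _ (Finset.range_subset_range.2 hj))
        rw [card_filter_range_succ, if_pos rfl] at h9
        omega
    · rcases h₃ with ⟨h3, -⟩ | ⟨h3, i, hi, h4, h5, h6⟩
      · omega
      refine wp_skip hH (wp_writeReal hH ⟨(hF₃.mono (by simp)).setReal (by simp) _ _ _, ?_⟩)
      simp only [NatExpr.eval, RealExpr.eval, Memory.setNat_nat, Memory.setNat_real,
        Memory.setReal_nat, Memory.setReal_real, Nat.reduceEqDiff, false_and, if_false,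
        true_and, e51, ek, ec, e57]
      refine ⟨fun h => ?_, g3⟩
      · obtain ⟨g4, g5⟩ := g2 h
        refine ⟨fun l hl => ?_, fun ρ b => ?_⟩
        · rw [h5]
          split_ifs with h'
          · exact ⟨hi, by rw [h', h5, if_pos rfl]⟩
          · rw [e55]
            exact g4 l (by omega)
        · rw [card_filter_cell_succ row (m₂.nat 54 0) _ j i ρ b h5, h6, ← g5 ρ b]
          split_ifs with h'
          · obtain ⟨rfl, rfl⟩ := h'
            omega
          · omega
  · rintro m' ⟨hF, h2, h3⟩
    refine ⟨hF₁.trans hF (by simp), fun h => ⟨(h2 h).1, fun a b => ?_⟩, h3⟩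
    rw [← (h2 h).2 a b]
    exact Nat.le_add_left _ _

end

/-! ### Treatment of one guess -/

section

variable {H n k : ℕ} {f : (Fin n → ℝ≥0) → ℝ≥0} {m : Memory} {I : Inst k n}

/-- The best assignment so far stands in array `29`, its cost in real array `28`. -/
def Best (I : Inst k n) (f : (Fin n → ℝ≥0) → ℝ≥0) (m : Memory) : Prop :=
  0 < m.nat 28 0 0 → ∃ σ, I.Feasible σ ∧ (∀ j : Fin n, m.nat 29 0 j = (σ j : ℕ)) ∧
    m.real 28 0 0 = f (I.connection σ)

/-- The best assignment in `m'` is at least as good as the best assignment in `m`. -/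
def Improves (m m' : Memory) : Prop :=
  0 < m.nat 28 0 0 → 0 < m'.nat 28 0 0 ∧ m'.real 28 0 0 ≤ m.real 28 0 0

theorem Improves.trans {m m' m'' : Memory} (h : Improves m m') (h' : Improves m' m'') :
    Improves m m'' := fun h0 =>
  ⟨(h' (h h0).1).1, (h' (h h0).1).2.trans (h h0).2⟩

theorem Best.congr {m m' : Memory} (h : Best I f m) (e1 : m'.nat 28 = m.nat 28)
    (e2 : m'.nat 29 = m.nat 29) (e3 : m'.real 28 = m.real 28) : Best I f m' := by
  simpa only [Best, e1, e2, e3] using h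

/-- An assignment with property `P` has been beaten. -/
def Beats (I : Inst k n) (f : (Fin n → ℝ≥0) → ℝ≥0) (P : (Fin n → Fin k) → Prop) (m : Memory) :
    Prop :=
  0 < m.nat 28 0 0 ∧ ∃ σ, P σ ∧ m.real 28 0 0 ≤ f (I.connection σ)

theorem Beats.improves {P : (Fin n → Fin k) → Prop} {m m' : Memory} (h : Beats I f P m)
    (h' : Improves m m') : Beats I f P m' := by
  obtain ⟨h0, σ, h1, h2⟩ := h
  exact ⟨(h' h0).1, σ, h1, (h' h0).2.trans h2⟩

/-- Compares the assignment in array `54` with the best assignment so far. -/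
def evaluate : Program :=
  .cond (.natLt (.var 57) (.const 1))
    (.seq (.query 56 (.const 0) (.const 0) 55 (.const 0))
      (.cond (.not (.and (.natLt (.const 0) (.var 28)) (.not (.realLt (.var 56) (.var 28)))))
        (.seq (.setR 28 (.var 56)) (.seq (.set 28 (.const 1))
          (.for 52 nE (.setItem 29 (.var 52) (.item 54 (.var 52))))))
        .skip))
    .skip

theorem wp_evaluate (hH : 2 ≤ H) (hnH : n + 1 ≤ H) (hn : m.nat 0 0 1 = n)
    {P : (Fin n → Fin k) → Prop} (hbest : Best I f m)
    (hσ : m.nat 57 0 0 = 0 → ∃ σ, I.Feasible σ ∧ (∀ j : Fin n, m.nat 54 0 j = (σ j : ℕ)) ∧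
      (∀ j : Fin n, m.real 55 0 j = I.connection σ j) ∧ P σ) :
    WP H f evaluate (fun m' => Fr [28, 29, 52, 56] m m' ∧ Best I f m' ∧ Improves m m' ∧
      (m.nat 57 0 0 = 0 → Beats I f P m')) m := by
  refine wp_cond hH (fun hb => ?_) (fun hb => ?_) <;>
  simp only [Cond.Holds, NatExpr.eval] at hb
  · have h57 : m.nat 57 0 0 = 0 := by omega
    obtain ⟨σ, h1, h2, h3, h4⟩ := hσ h57
    refine wp_seq hH (wp_query hH hnH ?_)
    have hval : (f fun l => (m.real 55 ((NatExpr.const 0).eval m) (l : ℕ)).toNNReal) =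
        f (I.connection σ) := by
      congr 1
      funext l
      simp [NatExpr.eval, h3]
    rw [hval]
    set m₁ := m.setReal 56 _ _ _ with hm₁
    have hF₁ : Fr [28, 29, 52, 56] m m₁ := (Fr.refl _ _).setReal (by simp) _ _ _
    have e56 : m₁.real 56 0 0 = f (I.connection σ) := by simp [hm₁, NatExpr.eval]
    have e28 : m₁.nat 28 = m.nat 28 := by simp [hm₁]
    have e28r : m₁.real 28 = m.real 28 := by rw [hm₁, Memory.setReal_real_ne _ (by simp)]
    refine wp_cond hH (fun hc => ?_) (fun hc => ?_) <;>
    simp only [Cond.Holds, NatExpr.eval, RealExpr.eval, e28, e56, e28r] at hc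
    · refine wp_seq hH (wp_writeReal hH (wp_seq hH (wp_writeNat hH ?_)))
      set m₂ := (m₁.setReal 28 _ _ _).setNat 28 _ _ _ with hm₂
      have hF₂ : Fr [28, 29, 52, 56] m m₂ :=
        (hF₁.setReal (by simp) _ _ _).setNat (by simp) _ _ _
      have e54 : ∀ j : Fin n, m₂.nat 54 0 j = σ j := by
        rw [hF₂.nat 54 (by simp)]; exact h2
      refine (wp_for (N := n) hH [29] (fun a m' => ∀ j < a, m'.nat 29 0 j = m₂.nat 54 0 j) (by simp)
        (by omega) (by simp) ?_ ?_).mono ?_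
      · intro m' hF
        simp [NatExpr.eval, hF.nat 0 (by simp), hF₂.nat 0 (by simp), hn]
      · intro j hj m' hF hj' hI
        refine wp_writeNat hH ⟨(Fr.refl _ _).setNat (by simp) _ _ _, fun l hl => ?_⟩
        simp only [NatExpr.eval, hj', Memory.setNat_nat, Nat.reduceEqDiff, false_and, if_false,
          true_and]
        split_ifs with h
        · rw [h, hF.nat 54 (by simp)]
        · exact hI l (by omega)
      · rintro m' ⟨hF, h5⟩
        have k1 : m'.nat 28 0 0 = 1 := by simp [hF.nat 28 (by simp), hm₂, NatExpr.eval]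
        have k2 : m'.real 28 0 0 = f (I.connection σ) := by
          rw [hF.real 28 (by simp)]
          simp [hm₂, NatExpr.eval, RealExpr.eval, e56]
        refine ⟨hF₂.trans hF (by simp), fun _ => ⟨σ, h1, fun j => ?_, k2⟩, fun h0 => ⟨by omega, ?_⟩,
          fun _ => ⟨by omega, σ, h4, k2.le⟩⟩
        · rw [h5 j j.2, e54]
        · rw [k2]
          by_contra! hcon
          exact hc ⟨h0, not_lt.2 hcon.le⟩
    · rw [not_not] at hc
      refine wp_skip hH ⟨hF₁, hbest.congr e28 rfl e28r, fun h0 => ?_, fun _ => ?_⟩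
      · rw [e28, e28r]; exact ⟨h0, le_rfl⟩
      · refine ⟨by rw [e28]; exact hc.1, σ, h4, ?_⟩
        rw [e28r]; exact not_lt.1 hc.2
  · exact wp_skip hH ⟨Fr.refl _ _, hbest, fun h0 => ⟨h0, le_rfl⟩, fun h => by omega⟩

/-- The contents of the memory after the preparations. -/
structure Ctx (I : Inst k n) (q : ℝ) (T S : ℕ) (typ : ℕ → ℕ) (c : ℕ → ℕ → ℝ) (r tab : ℕ → ℝ)
    (m : Memory) : Prop where
  facilities : m.nat 0 0 0 = k
  clients : m.nat 0 0 1 = n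
  cap : ∀ b : Fin k, m.nat 1 0 b = I.cap b
  dist : ∀ j i, m.real 1 (k + j) i = c j i
  ratio : m.real 4 0 0 = q
  minDist : ∀ j, m.real 8 0 j = r j
  table : ∀ u, m.real 9 0 u = tab u
  types : m.nat 14 0 0 = T
  typeOf : ∀ j, m.nat 16 0 j = typ j
  digits : m.nat 18 0 0 = T + 3 * T * k
  base : m.nat 19 0 0 = S + 2
  cells : m.nat 20 0 0 = 3 * T * k
  guesses : m.nat 22 0 0 = (S + 2) ^ (T + 3 * T * k)
  moves : m.nat 24 0 0 = 3 ^ (3 * T * k)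

theorem Ctx.fr {q : ℝ} {T S : ℕ} {typ : ℕ → ℕ} {c : ℕ → ℕ → ℝ} {r tab : ℕ → ℝ} {m m' : Memory}
    (h : Ctx I q T S typ c r tab m) {L : List ℕ} (hF : Fr L m m') (hL : ∀ a ∈ L, 25 ≤ a) :
    Ctx I q T S typ c r tab m' := by
  have key : ∀ a < 25, m'.nat a = m.nat a ∧ m'.real a = m.real a := fun a ha =>
    hF a fun h => by have := hL a h; omega
  constructor
  · rw [(key 0 (by norm_num)).1, h.facilities]
  · rw [(key 0 (by norm_num)).1, h.clients]
  · rw [(key 1 (by norm_num)).1]; exact h.cap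
  · rw [(key 1 (by norm_num)).2]; exact h.dist
  · rw [(key 4 (by norm_num)).2, h.ratio]
  · rw [(key 8 (by norm_num)).2]; exact h.minDist
  · rw [(key 9 (by norm_num)).2]; exact h.table
  · rw [(key 14 (by norm_num)).1, h.types]
  · rw [(key 16 (by norm_num)).1]; exact h.typeOf
  · rw [(key 18 (by norm_num)).1, h.digits]
  · rw [(key 19 (by norm_num)).1, h.base]
  · rw [(key 20 (by norm_num)).1, h.cells]
  · rw [(key 22 (by norm_num)).1, h.guesses]
  · rw [(key 24 (by norm_num)).1, h.moves]

/-- The row of client `j`, as the program computes it. -/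
def rowAt (typ : ℕ → ℕ) (r tab : ℕ → ℝ) (q M : ℝ) (G : ℕ → ℕ) (j : ℕ) : ℕ :=
  open Classical in
  3 * typ j + if r j * (tab (G (typ j) + 1) * q) ≤ M then 0
    else if r j * tab (G (typ j) + 1) ≤ M then 1 else 2

theorem rowAt_lt {typ : ℕ → ℕ} {r tab : ℕ → ℝ} {q M : ℝ} {G : ℕ → ℕ} {j T : ℕ} (h : typ j < T) :
    rowAt typ r tab q M G j < 3 * T := by
  unfold rowAt
  split_ifs <;> omega

/-- The numbers of clients in the cells respect the bounds that are given by the digits `G`. -/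
def FitsGuess (T : ℕ) (row : ℕ → ℕ) (tab : ℕ → ℝ) (G : ℕ → ℕ) (σ : Fin n → Fin k) : Prop :=
  ∀ a < 3 * T, ∀ b : Fin k,
    ((Finset.univ.filter fun j : Fin n => row j = a ∧ σ j = b).card : ℝ) ≤
      tab (G (T + (a * k + b)))

theorem card_filter_range_eq (p : ℕ → Prop) [DecidablePred p] :
    ((Finset.range n).filter p).card = (Finset.univ.filter fun j : Fin n => p j).card := by
  rw [Finset.card_filter, Finset.card_filter, Finset.sum_range]

theorem sum_card_cells (row : ℕ → ℕ) (T : ℕ) (hrow : ∀ j < n, row j < 3 * T) (σ : Fin n → Fin k)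
    (b : Fin k) :
    ∑ a ∈ Finset.range (3 * T), (Finset.univ.filter fun j : Fin n => row j = a ∧ σ j = b).card =
      (Finset.univ.filter fun j => σ j = b).card := by
  rw [Finset.card_eq_sum_card_fiberwise (f := fun j : Fin n => row j) (t := Finset.range (3 * T))]
  · refine Finset.sum_congr rfl fun a _ => ?_
    rw [Finset.filter_filter]
    simp only [and_comm]
  · intro j _
    exact Finset.mem_coe.2 (Finset.mem_range.2 (hrow j j.2))

/-- The cell counts of the assignment are the matrix: its column sums are loads of facilities, its
row sums are the numbers of clients in the rows. -/
theorem countMatrix_of_fits {T : ℕ} {row : ℕ → ℕ} (hrow : ∀ j < n, row j < 3 * T) {tab : ℕ → ℝ}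
    {G N u : ℕ → ℕ} (hN : ∀ a < 3 * T, N a = ((Finset.range n).filter fun l => row l = a).card)
    (hu : ∀ b : Fin k, u b = I.cap b) {o : Fin n → Fin k} (ho : I.Feasible o)
    (hfit : FitsGuess T row tab G o) :
    ∃ y, CountMatrix (3 * T) k (entryBound T k tab G) N u y ∧ n ≤ total (3 * T) k y := by
  have hrows : ∀ a < 3 * T, ∑ b ∈ Finset.range k,
      (Finset.univ.filter fun j : Fin n => row j = a ∧ (o j : ℕ) = b).card = N a := by
    intro a ha
    rw [hN a ha, card_filter_range_eq, Finset.card_eq_sum_card_fiberwise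
      (f := fun j : Fin n => (o j : ℕ)) (t := Finset.range k)]
    · refine Finset.sum_congr rfl fun b _ => ?_
      rw [Finset.filter_filter]
    · intro j _
      exact Finset.mem_coe.2 (Finset.mem_range.2 (o j).2)
  refine ⟨fun a b => (Finset.univ.filter fun j : Fin n => row j = a ∧ (o j : ℕ) = b).card,
    ⟨fun a ha b hb => ?_, fun a ha => (hrows a ha).le, fun b hb => ?_⟩, ?_⟩
  · have := hfit a ha ⟨b, hb⟩
    simpa only [entryBound, Fin.ext_iff] using this
  · have h1 := sum_card_cells row T hrow o ⟨b, hb⟩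
    have h2 := ho ⟨b, hb⟩
    simp only [Fin.ext_iff] at h1 h2
    rw [h1]
    exact h2.trans (hu ⟨b, hb⟩).ge
  · have h1 : total (3 * T) k (fun a b =>
        (Finset.univ.filter fun j : Fin n => row j = a ∧ (o j : ℕ) = b).card) =
        ∑ a ∈ Finset.range (3 * T), N a :=
      Finset.sum_congr rfl fun a ha => hrows a (Finset.mem_range.1 ha)
    rw [h1, Finset.sum_congr rfl fun a ha => hN a (Finset.mem_range.1 ha),
      ← Finset.card_eq_sum_card_fiberwise (f := row)]
    · simp
    · intro j hj
      exact Finset.mem_coe.2 (Finset.mem_range.2 (hrow j (Finset.mem_range.1 (Finset.mem_coe.1 hj))))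

/-- The row bounds add up to `n`, so a matrix of sum at least `n` attains each of them. -/
theorem CountMatrix.row_eq {R k n : ℕ} {U : ℕ → ℕ → ℕ → Prop} {N u : ℕ → ℕ} {x : ℕ → ℕ → ℕ}
    (hx : CountMatrix R k U N u x) (hn : n ≤ total R k x) (hN : ∑ a ∈ Finset.range R, N a = n)
    {a : ℕ} (ha : a < R) : ∑ b ∈ Finset.range k, x a b = N a := by
  by_contra hne
  have h1 : ∑ a ∈ Finset.range R, ∑ b ∈ Finset.range k, x a b < ∑ a ∈ Finset.range R, N a :=
    Finset.sum_lt_sum (fun a ha => hx.row a (Finset.mem_range.1 ha))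
      ⟨a, Finset.mem_range.2 ha, lt_of_le_of_ne (hx.row a ha) hne⟩
  unfold total at hn
  omega

/-- Computes and compares the assignment that belongs to guess number `g`. -/
def candidate : Program :=
  .seq (digits 31 (.var 27) (.var 18) (.var 19)) (.seq rows (.seq flow (.seq extract evaluate)))

/-- A guess that no feasible assignment fits may fail, or may yield a useless assignment, but never
an infeasible one; it cannot spoil the best assignment. If a feasible assignment fits, then the flow
has sum `n`, the extraction succeeds, and the result fits the same guess, though it may be a
different assignment. -/
theorem wp_candidate (hH : 2 ≤ H) (hkH : k ≤ H) (hnH : n + 1 ≤ H) {q M : ℝ} {T S w : ℕ}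
    {typ : ℕ → ℕ} {c : ℕ → ℕ → ℝ} {r tab : ℕ → ℝ} (hTH : T + 3 * T ≤ H) (hdH : T + 3 * T * k ≤ H)
    (h3H : 3 ^ (3 * T * k) ≤ H) (hctx : Ctx I q T S typ c r tab m) (htypT : ∀ j < n, typ j < T)
    (hcI : ∀ (j : Fin n) (i : Fin k), c j i = I.d (Sum.inr j) (Sum.inl i))
    (htab0 : ∀ u < S + 2, 0 ≤ tab u) (hM : m.real 30 0 0 = M) (hw : m.nat 27 0 0 = w)
    (hwH : w ≤ H) (hbest : Best I f m) {G : ℕ → ℕ} (hG : ∀ c, G c = w / (S + 2) ^ c % (S + 2)) :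
    WP H f candidate (fun m' => Fr [28, 29, 31, 32, 33, 34, 35, 36, 37, 38, 39, 40, 41, 42, 43, 44,
        45, 46, 47, 48, 49, 50, 51, 52, 53, 54, 55, 56, 57] m m' ∧ Best I f m' ∧ Improves m m' ∧
      ∀ o, I.Feasible o → FitsGuess T (rowAt typ r tab q M G) tab G o →
        Beats I f (FitsGuess T (rowAt typ r tab q M G) tab G) m') m := by
  have hidx : ∀ a < 3 * T, ∀ b < k, T + (a * k + b) < T + 3 * T * k := by
    intro a ha b hb
    have : a * k + b < 3 * T * k :=
      calc a * k + b < (a + 1) * k := by rw [add_mul]; omega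
        _ ≤ 3 * T * k := Nat.mul_le_mul_right _ ha
    omega
  set row := rowAt typ r tab q M G with hrowdef
  have hrow3 : ∀ j < n, row j < 3 * T := fun j hj => rowAt_lt (htypT j hj)
  refine wp_seq hH ((wp_digits (w := w) (N' := T + 3 * T * k) (b := S + 2) hH (by omega)
    (by simp [NatExpr.eval, hw]) hwH hdH ?_ ?_).mono ?_)
  · intro m' hF
    simp [NatExpr.eval, (hctx.fr hF (by simp)).digits]
  · intro m' hF
    simp [NatExpr.eval, (hctx.fr hF (by simp)).base]
  rintro m₁ ⟨hF₁, h₁⟩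
  have hctx₁ := hctx.fr hF₁ (by simp)
  -- The array agrees with `G` only at the digits that are written; these are the only ones that the
  -- rows and the bounds of relevant cells consult.
  set G₁ : ℕ → ℕ := m₁.nat 34 0 with hG₁
  have hGG : ∀ c < T + 3 * T * k, G₁ c = G c := fun c hc => by rw [hG, hG₁, ← h₁ c hc]
  refine wp_seq hH ((wp_rows (T := T) (typ := typ) (G := G₁) (row := row) (r := r) (tab := tab)
    (q := q) (M := M) hH (by omega) (by omega) hctx₁.clients hctx₁.types hctx₁.typeOf (fun _ => rfl) hctx₁.minDist
    hctx₁.table hctx₁.ratio (by rw [hF₁.real 30 (by simp), hM]) ?_).mono ?_)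
  · intro j hj
    have e : G₁ (typ j) = G (typ j) := hGG _ (by have := htypT j hj; omega)
    rw [e]
    simp only [hrowdef, rowAt]
    refine ⟨fun h => ?_, fun h h' => ?_, fun h h' => ?_⟩
    · rw [if_pos h, add_zero]
    · rw [if_neg (not_le.2 h), if_pos h']
    · rw [if_neg (not_le.2 h), if_neg (not_le.2 h')]
  rintro m₂ ⟨hF₂, h₂, h₂'⟩
  have hctx₂ := hctx₁.fr hF₂ (by simp)
  have hF₂' : Fr [31, 32, 33, 34, 35, 36, 37] m m₂ := (hF₁.mono (by simp)).trans hF₂ (by simp)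
  refine wp_seq hH ((wp_flow (T := T) (G := G₁) (N := m₂.nat 37 0) (u := m₂.nat 1 0) (tab := tab)
    hH hkH (by omega) (by omega) (by omega) h3H hctx₂.facilities hctx₂.clients hctx₂.types hctx₂.cells hctx₂.moves
    (fun j => by rw [hF₂.nat 34 (by simp)]) hctx₂.table (fun _ => rfl) (fun _ => rfl) ?_).mono ?_)
  · intro a ha b hb
    rw [hGG _ (hidx a ha b hb), hG]
    exact htab0 _ (Nat.mod_lt _ (by omega))
  rintro m₃ ⟨hF₃, hx, hmax⟩
  have hctx₃ := hctx₂.fr hF₃ (by simp)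
  have hF₃' : Fr [31, 32, 33, 34, 35, 36, 37, 38, 39, 40, 41, 42, 43, 44,
        45, 46, 47, 48, 49, 50] m m₃ := (hF₂'.mono (by simp)).trans hF₃ (by simp)
  have hsumN : ∑ a ∈ Finset.range (3 * T), m₂.nat 37 0 a = n := by
    rw [Finset.sum_congr rfl fun a ha => h₂' a (Finset.mem_range.1 ha),
      ← Finset.card_eq_sum_card_fiberwise (f := row)]
    · simp
    · intro j hj
      exact Finset.mem_coe.2 (Finset.mem_range.2 (hrow3 j (Finset.mem_range.1 (Finset.mem_coe.1 hj))))
  refine wp_seq hH ((wp_extract (row := row) (c := c) hH hkH (by omega) hctx₃.facilities hctx₃.clients hctx₃.dist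
    (by rw [hF₃.nat 36 (by simp)]; exact h₂)).mono ?_)
  rintro m₄ ⟨hF₄, h₄, h₄'⟩
  have hctx₄ := hctx₃.fr hF₄ (by simp)
  have hF₄' : Fr [31, 32, 33, 34, 35, 36, 37, 38, 39, 40, 41, 42, 43, 44,
        45, 46, 47, 48, 49, 50, 51, 52, 53, 54, 55, 57] m m₄ :=
    (hF₃'.mono (by simp)).trans hF₄ (by simp)
  refine (wp_evaluate (I := I) (P := FitsGuess T row tab G) hH hnH hctx₄.clients
    (hbest.congr (hF₄'.nat 28 (by simp)) (hF₄'.nat 29 (by simp)) (hF₄'.real 28 (by simp)))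
    ?_).mono ?_
  · intro h57
    obtain ⟨g1, g2⟩ := h₄ h57
    refine ⟨fun j => ⟨m₄.nat 54 0 j, (g1 j j.2).1⟩, fun b => ?_, fun j => rfl, fun j => ?_, ?_⟩
    · rw [← sum_card_cells row T hrow3]
      refine le_trans (Finset.sum_le_sum fun a ha => ?_) ((hx.col b b.2).trans ?_)
      · have := g2 a b
        rw [card_filter_range_eq] at this
        simpa only [Fin.ext_iff] using this
      · rw [hctx₂.cap]
    · rw [(g1 j j.2).2]
      exact hcI j ⟨_, (g1 j j.2).1⟩
    · intro a ha b
      have h1 := g2 a b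
      rw [card_filter_range_eq] at h1
      have h2 := hx.entry a ha b b.2
      rw [entryBound, hGG _ (hidx a ha b b.2)] at h2
      refine le_trans ?_ h2
      simp only [Fin.ext_iff]
      exact_mod_cast h1
  · rintro m₅ ⟨hF₅, h5, h6, h7⟩
    refine ⟨(hF₄'.mono (by simp)).trans hF₅ (by simp), h5, ?_, fun o ho hfit => h7 (h₄' ?_)⟩
    · intro h0
      have := h6 (by rw [hF₄'.nat 28 (by simp)]; exact h0)
      rwa [hF₄'.real 28 (by simp)] at this
    · have hfit' : FitsGuess T row tab G₁ o := fun a ha b => by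
        rw [hGG _ (hidx a ha b b.2)]; exact hfit a ha b
      obtain ⟨y, hy, hny⟩ := countMatrix_of_fits hrow3 h₂' hctx₂.cap ho hfit'
      have hnx := hmax y hy hny
      intro j hj
      rw [hx.row_eq hnx hsumN (hrow3 j hj), h₂' _ (hrow3 j hj)]

end

/-! ### The search over all guesses -/

section

variable {H n k : ℕ} {f : (Fin n → ℝ≥0) → ℝ≥0} {m : Memory} {I : Inst k n}

theorem improves_of_eq {m m' : Memory} (e : m'.nat 28 = m.nat 28) (e' : m'.real 28 = m.real 28) :
    Improves m m' := fun h => by rw [e, e']; exact ⟨h, le_rfl⟩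

/-- A loop whose rounds improve the best assignment and establish properties that survive
improvements. -/
theorem wp_for_improves (hH : 2 ≤ H) {v : ℕ} {e : NatExpr} {p : Program} {N : ℕ} (L : List ℕ)
    (hv : v ∉ L) (hv' : v < 28) (hN : N ≤ H) (he : ∀ m', Fr (v :: L) m m' → e.eval m' = N)
    (hbest : Best I f m) (P : ℕ → Memory → Prop)
    (hP : ∀ i m m', P i m → Improves m m' → P i m')
    (hs : ∀ i < N, ∀ m', Fr (v :: L) m m' → m'.nat v 0 0 = i → Best I f m' →
      WP H f p (fun m'' => Fr L m' m'' ∧ Best I f m'' ∧ Improves m' m'' ∧ P i m'') m') :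
    WP H f (.for v e p) (fun m' => Fr (v :: L) m m' ∧ Best I f m' ∧ Improves m m' ∧
      ∀ i < N, P i m') m := by
  have e28 : ∀ (m : Memory) x, (m.setNat v 0 0 x).nat 28 = m.nat 28 := fun m x =>
    (Fr.refl [v] m |>.setNat (by simp) 0 0 x).nat 28 (by simp; omega)
  have e29 : ∀ (m : Memory) x, (m.setNat v 0 0 x).nat 29 = m.nat 29 := fun m x =>
    (Fr.refl [v] m |>.setNat (by simp) 0 0 x).nat 29 (by simp; omega)
  refine wp_for hH L (fun a m' => Best I f m' ∧ Improves m m' ∧ ∀ i < a, P i m') hv hN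
    ⟨hbest.congr (e28 _ _) (e29 _ _) rfl, improves_of_eq (e28 _ _) rfl, by simp⟩ he ?_
  rintro i hi m' hF hi' ⟨h1, h2, h3⟩
  refine (hs i hi m' hF hi' h1).mono ?_
  rintro m'' ⟨hF', h4, h5, h6⟩
  have h7 : Improves m'' (m''.setNat v 0 0 (i + 1)) := improves_of_eq (e28 _ _) rfl
  refine ⟨hF', h4.congr (e28 _ _) (e29 _ _) rfl, h2.trans (h5.trans h7), fun l hl => ?_⟩
  rcases Nat.lt_succ_iff_lt_or_eq.1 hl with h | rfl
  · exact hP _ _ _ (h3 l h) (h5.trans h7)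
  · exact hP _ _ _ h6 h7

/-- If a feasible assignment fits the guess `w`, then an assignment that fits it has been beaten. -/
def Tried (I : Inst k n) (f : (Fin n → ℝ≥0) → ℝ≥0) (q : ℝ) (T S : ℕ) (typ : ℕ → ℕ)
    (r tab : ℕ → ℝ) (M : ℝ) (w : ℕ) (m : Memory) : Prop :=
  ∀ o, I.Feasible o →
    FitsGuess T (rowAt typ r tab q M fun c => w / (S + 2) ^ c % (S + 2)) tab
      (fun c => w / (S + 2) ^ c % (S + 2)) o →
    Beats I f (FitsGuess T (rowAt typ r tab q M fun c => w / (S + 2) ^ c % (S + 2)) tab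
      (fun c => w / (S + 2) ^ c % (S + 2))) m

/-- Tries all guesses of a connection distance and of the digits. -/
def search : Program :=
  .seq (.set 28 (.const 0)) (.for 25 nE (.for 26 kE
    (.seq (.setR 30 (distE (.var 25) (.var 26))) (.for 27 (.var 22) candidate))))

/-- The arrays that are modified in the treatment of a candidate. -/
abbrev candidateArrays : List ℕ := [28, 29, 31, 32, 33, 34, 35, 36, 37, 38, 39, 40, 41, 42, 43, 44,
  45, 46, 47, 48, 49, 50, 51, 52, 53, 54, 55, 56, 57]

/-- `Tried` only asks for an upper bound on the best cost, so it survives later improvements, and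
after the nested loops it holds for all guesses simultaneously. -/
theorem wp_search (hH : 2 ≤ H) (hkH : k ≤ H) (hnH : n + 1 ≤ H) {q : ℝ} {T S : ℕ}
    {typ : ℕ → ℕ} {c : ℕ → ℕ → ℝ} {r tab : ℕ → ℝ} (hTH : T + 3 * T ≤ H) (hdH : T + 3 * T * k ≤ H)
    (h3H : 3 ^ (3 * T * k) ≤ H) (hWH : (S + 2) ^ (T + 3 * T * k) ≤ H)
    (hctx : Ctx I q T S typ c r tab m) (htypT : ∀ j < n, typ j < T)
    (hcI : ∀ (j : Fin n) (i : Fin k), c j i = I.d (Sum.inr j) (Sum.inl i))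
    (htab0 : ∀ u < S + 2, 0 ≤ tab u) :
    WP H f search (fun m' => Fr (25 :: 26 :: 27 :: 30 :: candidateArrays) m m' ∧ Best I f m' ∧
      ∀ j < n, ∀ i < k, ∀ w < (S + 2) ^ (T + 3 * T * k),
        Tried I f q T S typ r tab (c j i) w m') m := by
  have hT : ∀ M w m m', Tried I f q T S typ r tab M w m → Improves m m' →
      Tried I f q T S typ r tab M w m' := fun M w m m' h h' o ho hfit => (h o ho hfit).improves h'
  refine wp_seq hH (wp_writeNat hH ?_)
  set m₁ := m.setNat 28 _ _ _ with hm₁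
  have hF₁ : Fr (25 :: 26 :: 27 :: 30 :: candidateArrays) m m₁ :=
    (Fr.refl _ _).setNat (by simp) _ _ _
  have hctx₁ := hctx.fr hF₁ (by simp)
  have hbest : Best I f m₁ := fun h => by simp [hm₁, NatExpr.eval] at h
  refine (wp_for_improves (N := n) hH (26 :: 27 :: 30 :: candidateArrays) (by simp) (by norm_num)
    (by omega) ?_ hbest (fun j m' => ∀ i < k, ∀ w < (S + 2) ^ (T + 3 * T * k),
      Tried I f q T S typ r tab (c j i) w m') ?_ ?_).mono ?_
  · intro m' hF
    simpa [NatExpr.eval] using (hctx₁.fr hF (by simp)).clients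
  · exact fun j m m' h h' i hi w hw => hT _ _ _ _ (h i hi w hw) h'
  · intro j hj m₂ hF₂ hj' hb₂
    have hctx₂ := hctx₁.fr hF₂ (by simp)
    refine wp_for_improves (N := k) hH (27 :: 30 :: candidateArrays) (by simp) (by norm_num)
      hkH ?_ hb₂ (fun i m' => ∀ w < (S + 2) ^ (T + 3 * T * k),
        Tried I f q T S typ r tab (c j i) w m') ?_ ?_
    · intro m' hF
      simpa [NatExpr.eval] using (hctx₂.fr hF (by simp)).facilities
    · exact fun i m m' h h' w hw => hT _ _ _ _ (h w hw) h'
    · intro i hi m₃ hF₃ hi' hb₃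
      have hctx₃ := hctx₂.fr hF₃ (by simp)
      refine wp_seq hH (wp_writeReal hH ?_)
      have ev : (distE (.var 25) (.var 26)).eval m₃ = c j i := by
        have h1 := hctx₃.facilities
        have h2 : m₃.nat 25 0 0 = j := by rw [hF₃.nat 25 (by simp), hj']
        simp [RealExpr.eval, NatExpr.eval, h1, h2, hi', hctx₃.dist]
      rw [ev]
      set m₄ := m₃.setReal 30 _ _ _ with hm₄
      have hF₄ : Fr (27 :: 30 :: candidateArrays) m₃ m₄ := (Fr.refl _ _).setReal (by simp) _ _ _
      have hctx₄ := hctx₃.fr hF₄ (by simp)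
      have hI₄ : Improves m₃ m₄ := improves_of_eq rfl (by rw [hm₄, Memory.setReal_real_ne _ (by simp)])
      have hb₄ : Best I f m₄ :=
        hb₃.congr rfl rfl (by rw [hm₄, Memory.setReal_real_ne _ (by simp)])
      have e30 : m₄.real 30 0 0 = c j i := by simp [hm₄, NatExpr.eval]
      refine (wp_for_improves (N := (S + 2) ^ (T + 3 * T * k)) hH candidateArrays (by simp)
        (by norm_num) hWH ?_ hb₄ (fun w m' => Tried I f q T S typ r tab (c j i) w m')
        (fun w => hT _ w) ?_).mono ?_
      · intro m' hF
        simpa [NatExpr.eval] using (hctx₄.fr hF (by simp)).guesses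
      · intro w hw m₅ hF₅ hw' hb₅
        exact wp_candidate hH hkH hnH hTH hdH h3H (hctx₄.fr hF₅ (by simp)) htypT hcI htab0
          (by rw [hF₅.real 30 (by simp), e30]) hw' (by omega) hb₅ fun c => rfl
      · rintro m' ⟨hF, h1, h2, h3⟩
        exact ⟨hF₄.trans hF (by simp), h1, hI₄.trans h2, h3⟩
  · rintro m' ⟨hF, h1, -, h3⟩
    exact ⟨hF₁.trans hF (by simp), h1, h3⟩

/-- The output is the best assignment. -/
def output : Program := .for 6 nE (.setItem 2 (.var 6) (.item 29 (.var 6)))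

theorem wp_output (hH : 2 ≤ H) (hnH : n ≤ H) (hn : m.nat 0 0 1 = n) :
    WP H f output (fun m' => ∀ j < n, m'.nat 2 0 j = m.nat 29 0 j) m := by
  refine (wp_for (N := n) hH [2] (fun a m' => ∀ j < a, m'.nat 2 0 j = m.nat 29 0 j) (by simp)
    hnH (by simp) ?_ ?_).mono fun m' h => h.2
  · intro m' hF
    simpa [NatExpr.eval, hF.nat 0 (by simp)] using hn
  · intro j hj m' hF hj' hI
    refine wp_writeNat hH ⟨(Fr.refl _ _).setNat (by simp) _ _ _, fun l hl => ?_⟩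
    simp only [NatExpr.eval, hj', Memory.setNat_nat, Nat.reduceEqDiff, false_and, if_false,
      true_and]
    split_ifs with h
    · rw [h, hF.nat 29 (by simp)]
    · exact hI l (by omega)

end

/-! ### The correct guess -/

section

variable {n k : ℕ} {f : (Fin n → ℝ≥0) → ℝ≥0}

/-- The least power of `q` that is at least `x` overshoots by a factor at most `q`. The extra level
`0` is needed for empty cells, where no factor is allowed. -/
theorem exists_level {q : ℝ} (hq : 1 ≤ q) {S : ℕ} {tab : ℕ → ℝ} (h0 : tab 0 = 0)
    (htab : ∀ u ≤ S, tab (u + 1) = q ^ u) {x : ℕ} (hx : (x : ℝ) ≤ q ^ S) :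
    ∃ v < S + 2, (x : ℝ) ≤ tab v ∧ tab v ≤ q * x := by
  classical
  rcases Nat.eq_zero_or_pos x with rfl | hx0
  · exact ⟨0, by omega, by simp [h0]⟩
  have hx1 : (1 : ℝ) ≤ x := by exact_mod_cast hx0
  have hex : ∃ u, (x : ℝ) ≤ q ^ u := ⟨S, hx⟩
  have hu : Nat.find hex ≤ S := Nat.find_le hx
  refine ⟨Nat.find hex + 1, by omega, ?_, ?_⟩
  · rw [htab _ hu]; exact Nat.find_spec hex
  · rw [htab _ hu]
    rcases hv : Nat.find hex with _ | v
    · rw [pow_zero]; nlinarith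
    · have := Nat.find_min hex (m := v) (by omega)
      rw [pow_succ']
      exact mul_le_mul_of_nonneg_left (not_le.1 this).le (by linarith)

/-- The table starts with the level `0`, so a threshold `u`, which stands for `q ^ u`, is looked up
at `u + 1`. -/
theorem rowAt_eq_rowOf {typ : ℕ → ℕ} {r' tab : ℕ → ℝ} {r : Fin n → ℝ≥0} (hr : ∀ j : Fin n, r' j = r j)
    {q M : ℝ≥0} {S : ℕ} (htab : ∀ u ≤ S, tab (u + 1) = (q : ℝ) ^ u) {G s : ℕ → ℕ}
    (hs : ∀ t, s t ≤ S) {j : Fin n} (hG : G (typ j) = s (typ j)) :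
    rowAt typ r' tab q M G j = rowOf r q M (fun j => typ j) s j := by
  have e : tab (G (typ j) + 1) = ((q ^ s (typ j) : ℝ≥0) : ℝ) := by
    rw [hG, htab _ (hs _)]; push_cast; rfl
  simp only [rowAt, rowOf, e, hr, ← NNReal.coe_mul, NNReal.coe_le_coe]

/-- The guess encodes the guide `o` of `Inst.exists_guide`: its thresholds and its cell counts,
rounded up to levels. Then `o` fits, and whatever fits has at most `q` times as many clients as `o`
in each cell. -/
theorem Inst.exists_guess (I : Inst k n) (hf : IsMonotoneSymmetricNorm f) (hn : 0 < n)
    (hI : ∃ τ, I.Feasible τ) {c : Fin n → Fin k → ℝ≥0} {r : Fin n → ℝ≥0} {q h δ : ℝ≥0}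
    {P : Fin n → Fin n} (hq : 1 ≤ q) (hh : 1 ≤ h) (hδ : δ ≤ 1)
    (hc : ∀ j i, c j i = I.d (Sum.inr j) (Sum.inl i)) (hr : ∀ j i, r j ≤ c j i)
    {T : ℕ} {typ : ℕ → ℕ} (htypT : ∀ j < n, typ j < T)
    (htyp : ∀ j l : Fin n, typ j = typ l → P j = P l) (hsim : ∀ j, Similar c r q h j (P j))
    {S : ℕ} (hS : (n : ℝ≥0) ≤ q ^ S * δ) {r' tab : ℕ → ℝ} (hr' : ∀ j : Fin n, r' j = r j)
    (h0 : tab 0 = 0) (htab : ∀ u ≤ S, tab (u + 1) = (q : ℝ) ^ u) :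
    ∃ (j₀ : Fin n) (i₀ : Fin k), ∃ w < (S + 2) ^ (T + 3 * T * k), ∀ G : ℕ → ℕ,
      (∀ c, G c = w / (S + 2) ^ c % (S + 2)) →
      (∃ o, I.Feasible o ∧ FitsGuess T (rowAt typ r' tab q (c j₀ i₀) G) tab G o) ∧
      ∀ σ, FitsGuess T (rowAt typ r' tab q (c j₀ i₀) G) tab G σ → ∀ τ, I.Feasible τ →
        f (I.connection σ) ≤ h * (h * (q * q + δ * h)) * f (I.connection τ) := by
  classical
  obtain ⟨j₀, i₀, s, o, hs, ho, hmain⟩ := I.exists_guide hf hn hI (typ := fun j => typ j) hq hh hc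
    hr htyp hsim hS
  set row := rowOf r q (c j₀ i₀) (fun j => typ j) s with hrow
  let cnt : ℕ → ℕ → ℕ := fun a b =>
    (Finset.univ.filter fun j => row j = a ∧ (o j : ℕ) = b).card
  have hq' : (1 : ℝ) ≤ q := by exact_mod_cast hq
  have hnS : (n : ℝ) ≤ (q : ℝ) ^ S := by
    have : (n : ℝ≥0) ≤ q ^ S := hS.trans (mul_le_of_le_one_right' hδ)
    exact_mod_cast this
  have hlev : ∀ a b, ∃ v < S + 2, (cnt a b : ℝ) ≤ tab v ∧ tab v ≤ q * cnt a b := by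
    intro a b
    refine exists_level hq' h0 htab (le_trans ?_ hnS)
    have := Finset.card_filter_le (Finset.univ : Finset (Fin n)) fun j => row j = a ∧ (o j : ℕ) = b
    rw [Finset.card_univ, Fintype.card_fin] at this
    exact_mod_cast this
  choose v hv hv1 hv2 using hlev
  obtain ⟨w, hw, hdig⟩ := exists_digits (b := S + 2) (T + 3 * T * k)
    -- The first `T` digits are the thresholds of the types, the others are the levels of the cells,
    -- row by row.
    (fun c => if c < T then s c else v ((c - T) / k) ((c - T) % k)) fun c => by
      split_ifs
      · have := hs c; omega
      · exact hv _ _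
  refine ⟨j₀, i₀, w, hw, fun G hG => ?_⟩
  have hGs : ∀ t < T, G t = s t := fun t ht => by
    rw [hG, hdig t (by omega), if_pos ht]
  have hGv : ∀ a < 3 * T, ∀ b < k, G (T + (a * k + b)) = v a b := by
    intro a ha b hb
    have : a * k + b < 3 * T * k :=
      calc a * k + b < (a + 1) * k := by rw [add_mul]; omega
        _ ≤ 3 * T * k := Nat.mul_le_mul_right _ ha
    rw [hG, hdig _ (by omega), if_neg (by omega), Nat.add_sub_cancel_left]
    congr 1
    · rw [mul_comm, Nat.mul_add_div (by omega), Nat.div_eq_of_lt hb, add_zero]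
    · rw [mul_comm, Nat.mul_add_mod, Nat.mod_eq_of_lt hb]
  have hrowAt : ∀ j : Fin n, rowAt typ r' tab q (c j₀ i₀) G j = row j := fun j =>
    rowAt_eq_rowOf hr' htab hs (hGs _ (htypT j j.2))
  refine ⟨⟨o, ho, fun a ha b => ?_⟩, fun σ hσ => hmain σ fun ρ i => ?_⟩
  · rw [hGv a ha b b.2]
    refine le_trans (le_of_eq ?_) (hv1 a b)
    simp only [cnt, hrowAt, Fin.ext_iff]
  · by_cases hρ : ρ < 3 * T
    · have h1 := hσ ρ hρ i
      rw [hGv ρ hρ i i.2] at h1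
      replace h1 := h1.trans (hv2 ρ i)
      simp only [cnt, hrowAt, ← Fin.ext_iff] at h1
      exact_mod_cast h1
    · have : (Finset.univ.filter fun j => row j = ρ ∧ σ j = i) = ∅ := by
        refine Finset.filter_eq_empty_iff.2 fun j _ hj => hρ ?_
        rw [← hj.1, ← hrowAt]
        exact rowAt_lt (htypT j j.2)
      rw [this]
      simp

end

/-! ### Correctness of the whole algorithm -/

section

variable {H n k : ℕ} {f : (Fin n → ℝ≥0) → ℝ≥0}

theorem Inst.input_dist (I : Inst k n) (ε : ℝ) (j : Fin n) (i : Fin k) :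
    (I.input ε).real 1 (k + j) i = I.d (Sum.inr j) (Sum.inl i) := by
  have h1 : point k n (k + j) = some (Sum.inr j) := by
    have hlt : k + (j : ℕ) < k + n := by omega
    rw [point, dif_pos hlt]
    congr 1
    rw [Equiv.symm_apply_eq, finSumFinEquiv_apply_right]
    rfl
  have h2 : point k n i = some (Sum.inl i) := by
    have hlt : (i : ℕ) < k + n := by omega
    rw [point, dif_pos hlt]
    congr 1
    rw [Equiv.symm_apply_eq, finSumFinEquiv_apply_left]
    rfl
  simp only [Inst.input, h1, h2]

/-- Everything that is done before the search. -/
def prepare : Program :=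
  .seq parameters (.seq minima (.seq powerTable (.seq types sizes)))

/-- What the preparations have found. -/
structure Prepared (I : Inst k n) (δ : ℝ≥0) (T S : ℕ) (typ : ℕ → ℕ) (c' : ℕ → ℕ → ℝ)
    (r' tab : ℕ → ℝ) (r : Fin n → ℝ≥0) (P : Fin n → Fin n) : Prop where
  dist (j : Fin n) (i : Fin k) : c' j i = I.d (Sum.inr j) (Sum.inl i)
  typ_lt : ∀ j < n, typ j < T
  tab_zero : tab 0 = 0
  tab_succ : ∀ u ≤ S, tab (u + 1) = ((1 + δ : ℝ≥0) : ℝ) ^ u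
  le_pow : (n : ℝ≥0) ≤ (1 + δ) ^ S * δ
  -- Without facilities the stored minimum has no meaning, hence the condition that a facility
  -- exists.
  coe_r (j : Fin n) (_ : Fin k) : r' j = r j
  r_le (j : Fin n) (i : Fin k) : r j ≤ I.d (Sum.inr j) (Sum.inl i)
  rep_congr (j l : Fin n) : typ j = typ l → P j = P l
  similar (j : Fin n) : Similar (fun j i => I.d (Sum.inr j) (Sum.inl i)) r (1 + δ)
    ((1 + δ) * (1 + δ) * (1 + δ)) j (P j)

theorem similarAt_iff {c : Fin n → Fin k → ℝ≥0} {r : Fin n → ℝ≥0} {c' : ℕ → ℕ → ℝ} {r' : ℕ → ℝ}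
    (hc : ∀ (j : Fin n) (i : Fin k), c' j i = c j i) (hr : ∀ (j : Fin n) (_ : Fin k), r' j = r j)
    {q h : ℝ≥0} {j p : Fin n} : (∀ i < k, SimilarAt c' r' q h j p i) ↔ Similar c r q h j p := by
  have key : ∀ i : Fin k, SimilarAt c' r' q h j p i ↔ (c p i ≤ q * r p → c j i ≤ h * r j) ∧
      (¬ c p i ≤ q * r p → c j i ≤ h * c p i ∧ c p i ≤ h * c j i) := by
    intro i
    simp only [SimilarAt, hc, hr _ i, ← NNReal.coe_mul, NNReal.coe_le_coe]
  exact ⟨fun h i => (key i).1 (h i i.2), fun h i hi => (key ⟨i, hi⟩).2 (h _)⟩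

theorem similar_refl {c : Fin n → Fin k → ℝ≥0} {r : Fin n → ℝ≥0} {q h : ℝ≥0} (hqh : q ≤ h)
    (hh : 1 ≤ h) (j : Fin n) : Similar c r q h j j := fun _ =>
  ⟨fun h' => h'.trans (by gcongr), fun _ => ⟨le_mul_of_one_le_left' hh, le_mul_of_one_le_left' hh⟩⟩

theorem wp_prepare (hH : 2 ≤ H) (hkH : k ≤ H) (hnH : n ≤ H) (I : Inst k n) {ε : ℝ} {δ : ℝ≥0}
    (hδ : (δ : ℝ) = ε / (32 * (1 + ε))) (hδ0 : 0 < δ) (hδ1 : (δ : ℝ) ≤ 1 / 16) {W S₀ R : ℕ}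
    (hW : 1 ≤ δ * W) (hS₀ : (n : ℝ≥0) ≤ (1 + δ) ^ S₀ * δ) (hSH : S₀ ≤ H)
    (hR : 2 ^ (k * k * (16 * W ^ 3 + 1)) ≤ R) (hRH : R + 3 * R * k ≤ H) :
    WP H f prepare (fun m' => ∃ T S typ c' r' tab r P, T ≤ R ∧ S ≤ S₀ ∧
      Ctx I ((1 + δ : ℝ≥0) : ℝ) T S typ c' r' tab m' ∧ Prepared I δ T S typ c' r' tab r P)
      (I.input ε) := by
  classical
  set m := I.input ε with hm
  have hk0 : m.nat 0 0 0 = k := by simp [hm, Inst.input]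
  have hn0 : m.nat 0 0 1 = n := by simp [hm, Inst.input]
  set c' : ℕ → ℕ → ℝ := fun j i => m.real 1 (k + j) i with hc'
  set c : Fin n → Fin k → ℝ≥0 := fun j i => I.d (Sum.inr j) (Sum.inl i) with hc
  have hcc : ∀ (j : Fin n) (i : Fin k), c' j i = c j i := fun j i => I.input_dist ε j i
  set q : ℝ≥0 := 1 + δ with hq
  have hqR : (q : ℝ) = 1 + ε / (32 * (1 + ε)) := by rw [hq, ← hδ]; push_cast; rfl
  set h : ℝ≥0 := q * q * q with hh
  have hq1 : 1 ≤ q := le_self_add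
  have hqh : q ≤ h := le_mul_of_one_le_left' (one_le_mul hq1 hq1)
  refine wp_seq hH ((wp_parameters (ε := ε) hH (by simp [hm, Inst.input])).mono ?_)
  rintro m₁ ⟨hF₁, h3, h4, h5⟩
  replace h3 : m₁.real 3 0 0 = δ := h3.trans hδ.symm
  replace h4 : m₁.real 4 0 0 = q := h4.trans hqR.symm
  replace h5 : m₁.real 5 0 0 = h := by rw [h5, hh]; push_cast; rw [hqR]
  refine wp_seq hH ((wp_minima (k := k) (n := n) (c := c') hH hnH hkH
    (by rw [hF₁.nat 0 (by simp), hk0]) (by rw [hF₁.nat 0 (by simp), hn0])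
    (by rw [hF₁.real 1 (by simp)]; exact fun _ _ => rfl)).mono ?_)
  rintro m₂ ⟨hF₂, h8⟩
  set r' : ℕ → ℝ := m₂.real 8 0 with hr'
  set r : Fin n → ℝ≥0 := fun j => (r' j).toNNReal with hr
  have hF₂' : Fr [3, 4, 5, 6, 7, 8] m m₂ := (hF₁.mono (by simp)).trans hF₂ (by simp)
  have hmin : ∀ (j : Fin n) (_ : Fin k), ∃ l, r' j = c j l := fun j i => by
    obtain ⟨l, hl, e⟩ := (h8 j j.2).2 (by have := i.2; omega)
    exact ⟨⟨l, hl⟩, e.trans (hcc j ⟨l, hl⟩)⟩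
  have hrr : ∀ (j : Fin n) (_ : Fin k), r' j = r j := fun j i => by
    obtain ⟨l, hl⟩ := hmin j i
    simp only [hr]
    rw [hl, Real.toNNReal_coe]
  have hrc : ∀ j i, r j ≤ c j i := fun j i => by
    have := (h8 j j.2).1 i i.2
    rw [hcc, hrr j i] at this
    exact_mod_cast this
  have hrmin : ∀ (j : Fin n) (_ : Fin k), ∃ l, r j = c j l := fun j i => by
    obtain ⟨l, hl⟩ := hmin j i
    exact ⟨l, by simp only [hr]; rw [hl, Real.toNNReal_coe]⟩
  refine wp_seq hH ((wp_powerTable (n := n) (δ := δ) (q := q) (S₀ := S₀) hH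
    (by rw [hF₂.real 3 (by simp), h3]) (by rw [hF₂.real 4 (by simp), h4])
    (by rw [hF₂'.nat 0 (by simp), hn0]) (by exact_mod_cast hS₀) hSH).mono ?_)
  rintro m₃ ⟨hF₃, h90, hS, h9, hn⟩
  have hF₃' : Fr [3, 4, 5, 6, 7, 8, 9, 10] m m₃ := (hF₂'.mono (by simp)).trans hF₃ (by simp)
  refine wp_seq hH ((wp_types (k := k) (n := n) (c := c') (r := r') (q := q) (h := h) hH hkH hnH
    (by rw [hF₃'.nat 0 (by simp), hk0]) (by rw [hF₃'.nat 0 (by simp), hn0])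
    (by rw [hF₃'.real 1 (by simp)]; exact fun _ _ => rfl)
    (by rw [hF₃.real 8 (by simp)]; exact fun _ => rfl)
    (by rw [hF₃.real 4 (by simp), hF₂.real 4 (by simp), h4])
    (by rw [hF₃.real 5 (by simp), hF₂.real 5 (by simp), h5])
    (fun j hj => (similarAt_iff (j := ⟨j, hj⟩) (p := ⟨j, hj⟩) hcc hrr).2
      (similar_refl hqh (hq1.trans hqh) _))).mono ?_)
  rintro m₄ ⟨hF₄, hTn, hrep, htyp, hsep⟩
  set T := m₄.nat 14 0 0 with hT
  have hF₄' : Fr [3, 4, 5, 6, 7, 8, 9, 10, 11, 12, 13, 14, 15, 16, 17] m m₄ :=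
    (hF₃'.mono (by simp)).trans hF₄ (by simp)
  have hTR : T ≤ R := by
    -- A client is needed as a default value for representatives; without clients there are no
    -- types.
    rcases Nat.eq_zero_or_pos n with h0 | h0
    · omega
    refine le_trans (I.card_types_le (c := c) (r := r) (fun _ _ => rfl) hδ0 hδ1 hW hrc hrmin
      (rep := fun t => if ht : m₄.nat 15 0 t < n then ⟨m₄.nat 15 0 t, ht⟩ else ⟨0, h0⟩)
      fun t t' htt ht' => ?_) hR
    rw [dif_pos (hrep t' ht'), dif_pos (hrep t (by omega)), ← similarAt_iff hcc hrr]
    exact hsep t t' htt ht'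
  have hTH : T + 3 * T * k ≤ H := le_trans (by gcongr) hRH
  refine (wp_sizes (k := k) (T := T) (S := m₃.nat 10 0 0) hH (by rw [hF₄'.nat 0 (by simp), hk0])
    rfl (by rw [hF₄.nat 10 (by simp)]) hTH).mono ?_
  rintro m₅ ⟨hF₅, h18, h19, h20, h22, h24⟩
  have hF₅' : Fr [3, 4, 5, 6, 7, 8, 9, 10, 11, 12, 13, 14, 15, 16, 17, 18, 19, 20, 21, 22, 23, 24]
    m m₅ := (hF₄'.mono (by simp)).trans hF₅ (by simp)
  have hrepn : ∀ j : Fin n, m₄.nat 15 0 (m₄.nat 16 0 j) < n := fun j => hrep _ (htyp j j.2).1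
  refine ⟨T, m₃.nat 10 0 0, m₄.nat 16 0, c', r', m₃.real 9 0, r, fun j => ⟨_, hrepn j⟩, hTR, hS,
    ⟨?_, ?_, ?_, ?_, ?_, ?_, ?_, ?_, ?_, h18, h19, h20, h22, h24⟩,
    ⟨hcc, fun j hj => (htyp j hj).1, h90, h9, by exact_mod_cast hn, hrr, hrc, ?_, ?_⟩⟩
  · rw [hF₅'.nat 0 (by simp), hk0]
  · rw [hF₅'.nat 0 (by simp), hn0]
  · rw [hF₅'.nat 1 (by simp)]; simp [hm, Inst.input]
  · rw [hF₅'.real 1 (by simp)]; exact fun _ _ => rfl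
  · rw [hF₅.real 4 (by simp), hF₄.real 4 (by simp), hF₃.real 4 (by simp), hF₂.real 4 (by simp), h4]
  · rw [hF₅.real 8 (by simp), hF₄.real 8 (by simp), hF₃.real 8 (by simp)]; exact fun _ => rfl
  · rw [hF₅.real 9 (by simp), hF₄.real 9 (by simp)]; exact fun _ => rfl
  · rw [hF₅.nat 14 (by simp)]
  · rw [hF₅.nat 16 (by simp)]; exact fun _ => rfl
  · intro j l e
    simp only [e]
  · exact fun j => (similarAt_iff (p := ⟨_, hrepn j⟩) hcc hrr).1 (htyp j j.2).2

/-- The left side is the factor `h * (h * (q * q + δ * h))` of `Inst.exists_guess` at `δ = x`, that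
is `(1 + x) ^ 8 + x * (1 + x) ^ 9`. Repeated squaring keeps it linear for small `x`. -/
theorem guarantee_le {x : ℝ} (h0 : 0 ≤ x) (h1 : x ≤ 1 / 32) :
    (1 + x) * (1 + x) * (1 + x) * ((1 + x) * (1 + x) * (1 + x) * ((1 + x) * (1 + x) +
      x * ((1 + x) * (1 + x) * (1 + x)))) ≤ 1 + 32 * x := by
  have e2 : (1 + x) ^ 2 ≤ 1 + 2.04 * x := by nlinarith
  have e4 : (1 + x) ^ 4 ≤ 1 + 4.25 * x := by
    calc (1 + x) ^ 4 = ((1 + x) ^ 2) ^ 2 := by ring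
      _ ≤ (1 + 2.04 * x) ^ 2 := by gcongr
      _ ≤ _ := by nlinarith
  have e8 : (1 + x) ^ 8 ≤ 1 + 9.5 * x := by
    calc (1 + x) ^ 8 = ((1 + x) ^ 4) ^ 2 := by ring
      _ ≤ (1 + 4.25 * x) ^ 2 := by gcongr
      _ ≤ _ := by nlinarith
  have e9 : (1 + x) ^ 8 * (1 + x) ≤ 2 := by
    calc (1 + x) ^ 8 * (1 + x) ≤ (1 + 9.5 * (1 / 32)) * (1 + 1 / 32) := by
          refine mul_le_mul (e8.trans (by linarith)) (by linarith) (by linarith) (by norm_num)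
      _ ≤ 2 := by norm_num
  calc _ = (1 + x) ^ 8 + x * ((1 + x) ^ 8 * (1 + x)) := by ring
    _ ≤ (1 + 9.5 * x) + x * 2 := by gcongr
    _ ≤ _ := by linarith

/-- The approximation algorithm. -/
def algorithm : Program := .seq prepare (.seq search output)

theorem wp_algorithm (hH : 2 ≤ H) (hkH : k ≤ H) (hnH : n + 1 ≤ H) (I : Inst k n)
    (hf : IsMonotoneSymmetricNorm f) {ε : ℝ} (hε : 0 < ε) {δ : ℝ≥0}
    (hδ : (δ : ℝ) = ε / (32 * (1 + ε))) {W S₀ R : ℕ} (hW : 1 ≤ δ * W)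
    (hS₀ : (n : ℝ≥0) ≤ (1 + δ) ^ S₀ * δ) (hSH : S₀ ≤ H)
    (hR : 2 ^ (k * k * (16 * W ^ 3 + 1)) ≤ R) (hRH : R + 3 * R * (k + 1) ≤ H)
    (h3H : 3 ^ (3 * R * k) ≤ H) (hSR : (S₀ + 2) ^ (R + 3 * R * k) ≤ H) :
    WP H f algorithm (fun m' => (∃ τ, I.Feasible τ) →
      ∃ σ, Outputs m' σ ∧ I.IsApprox f (1 + ε) σ) (I.input ε) := by
  have hδ0 : 0 < δ := by
    rw [← NNReal.coe_pos, hδ]; positivity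
  have hδ32 : (δ : ℝ) ≤ 1 / 32 := by
    rw [hδ, div_le_div_iff₀ (by positivity) (by norm_num)]; linarith
  have hRk : R + 3 * R * k ≤ H := le_trans (by gcongr; omega) hRH
  refine wp_seq hH ((wp_prepare hH hkH (by omega) I hδ hδ0 (by linarith) hW hS₀ hSH hR
    hRk).mono ?_)
  rintro m₁ ⟨T, S, typ, c', r', tab, r, P, hT, hS, hctx, hp⟩
  have htab0 : ∀ u < S + 2, 0 ≤ tab u := by
    rintro (_ | u) hu
    · rw [hp.tab_zero]
    · rw [hp.tab_succ u (by omega)]; positivity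
  refine wp_seq hH ((wp_search hH hkH hnH
    ((Nat.add_le_add hT ((Nat.mul_le_mul_left 3 hT).trans
      (Nat.le_mul_of_pos_right _ (Nat.succ_pos k)))).trans hRH)
    (le_trans (by gcongr) hRk) (le_trans (Nat.pow_le_pow_right (by norm_num) (by gcongr)) h3H)
    (le_trans (Nat.pow_le_pow_left (by omega) _) (le_trans
      (Nat.pow_le_pow_right (by omega) (by gcongr)) hSR)) hctx hp.typ_lt hp.dist htab0).mono ?_)
  rintro m₂ ⟨hF₂, hbest, htried⟩
  have hctx₂ := hctx.fr hF₂ (by simp)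
  refine (wp_output hH (by omega) hctx₂.clients).mono ?_
  intro m₃ hout hI
  rcases Nat.eq_zero_or_pos n with rfl | hn
  · obtain ⟨τ, hτ⟩ := hI
    refine ⟨τ, fun j => j.elim0, hτ, fun τ' _ => ?_⟩
    rw [Subsingleton.elim τ' τ]
    exact le_mul_of_one_le_left (NNReal.coe_nonneg _) (by linarith)
  -- The facility that serves some client in a feasible assignment shows that the minimum distances
  -- are meaningful.
  have hk : Fin k := hI.choose ⟨0, hn⟩
  obtain ⟨j₀, i₀, w, hw, hguess⟩ := I.exists_guess hf hn hI (q := 1 + δ) (δ := δ) le_self_add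
    (h := (1 + δ) * (1 + δ) * (1 + δ)) (one_le_mul (one_le_mul le_self_add le_self_add) le_self_add)
    (by rw [← NNReal.coe_le_coe]; push_cast; linarith) (fun _ _ => rfl) hp.r_le hp.typ_lt
    hp.rep_congr hp.similar hp.le_pow (fun j => hp.coe_r j hk) hp.tab_zero hp.tab_succ
  obtain ⟨⟨o, ho, hfit⟩, hgood⟩ := hguess _ fun _ => rfl
  obtain ⟨hpos, σ₁, hσ₁, hle⟩ := htried j₀ j₀.2 i₀ i₀.2 w hw o ho (by rw [hp.dist]; exact hfit)
  rw [hp.dist] at hσ₁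
  obtain ⟨σ, hσ, hσ29, hcost⟩ := hbest hpos
  refine ⟨σ, fun j => by rw [hout j j.2, hσ29], hσ, fun τ hτ => ?_⟩
  have h1 := hgood σ₁ hσ₁ τ hτ
  rw [hcost] at hle
  refine hle.trans ((NNReal.coe_le_coe.2 h1).trans ?_)
  push_cast
  refine mul_le_mul_of_nonneg_right ?_ (NNReal.coe_nonneg _)
  have hx : 32 * (δ : ℝ) ≤ ε := by
    rw [hδ, mul_div_assoc', mul_div_mul_left _ _ (by norm_num)]
    exact div_le_self hε.le (by linarith)
  exact (guarantee_le (NNReal.coe_nonneg _) hδ32).trans (by linarith)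

end

/-! ### The running time -/

/-- Since `x + 1 ≤ 2 ^ x`, the number `l` is at most `N * 2 ^ (l / N)`; raising this to the power
`N` turns a power of a logarithm into a parameter times a linear term. -/
theorem pow_le_pow_self_mul_two_pow {N : ℕ} (hN : 0 < N) (l : ℕ) : l ^ N ≤ N ^ N * 2 ^ l := by
  have h1 : l ≤ N * 2 ^ (l / N) :=
    calc l ≤ N * (l / N + 1) := (Nat.lt_mul_div_succ l hN).le
      _ ≤ N * 2 ^ (l / N) := Nat.mul_le_mul_left _ Nat.lt_two_pow_self
  calc l ^ N ≤ (N * 2 ^ (l / N)) ^ N := Nat.pow_le_pow_left h1 _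
    _ = N ^ N * 2 ^ (l / N * N) := by rw [mul_pow, pow_mul]
    _ ≤ N ^ N * 2 ^ l := Nat.mul_le_mul_left _
      (Nat.pow_le_pow_right (by norm_num) (Nat.div_mul_le_self _ _))

/-- A bound for the number of types. -/
def typeBound (k W : ℕ) : ℕ := 2 ^ (k * k * (16 * W ^ 3 + 1))

/-- A bound for the number of digits of a guess. -/
def digitBound (k W : ℕ) : ℕ := typeBound k W + 3 * typeBound k W * k

/-- The factor of the running time that depends on the parameters only. -/
def parameterBound (k W : ℕ) : ℕ :=
  2 + k + (typeBound k W + 3 * typeBound k W * (k + 1)) + 3 ^ (3 * typeBound k W * k) +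
    (W + 2) ^ digitBound k W * digitBound k W ^ digitBound k W * (2 * (W + 1))

theorem le_parameterBound (k W : ℕ) : 2 + k ≤ parameterBound k W ∧
    typeBound k W + 3 * typeBound k W * (k + 1) ≤ parameterBound k W ∧
    3 ^ (3 * typeBound k W * k) ≤ parameterBound k W := by
  unfold parameterBound
  generalize 3 ^ (3 * typeBound k W * k) = a
  generalize (W + 2) ^ digitBound k W * digitBound k W ^ digitBound k W * (2 * (W + 1)) = b
  omega

/-- For `l = Nat.log 2 (n * W) + 1` the factor `2 ^ l` is linear in `n`, so `(W * l + 2) ^ N` costs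
only one factor `n + 1` besides the parameters. -/
theorem guesses_le (k W n : ℕ) :
    (W * (Nat.log 2 (n * W) + 1) + 2) ^ digitBound k W ≤ parameterBound k W * (n + 1) := by
  set N := digitBound k W with hN
  set l := Nat.log 2 (n * W) + 1 with hl
  have hN0 : 0 < N := by
    rw [hN, digitBound]
    exact Nat.add_pos_left (by unfold typeBound; positivity) _
  have h2l : 2 ^ l ≤ 2 * (W + 1) * (n + 1) := by
    have := Nat.pow_log_le_add_one 2 (n * W)
    rw [hl, pow_succ]
    nlinarith
  calc (W * l + 2) ^ N ≤ ((W + 2) * l) ^ N :=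
        Nat.pow_le_pow_left (by rw [add_mul]; omega) _
    _ = (W + 2) ^ N * l ^ N := mul_pow _ _ _
    _ ≤ (W + 2) ^ N * (N ^ N * 2 ^ l) :=
        Nat.mul_le_mul_left _ (pow_le_pow_self_mul_two_pow hN0 l)
    _ ≤ (W + 2) ^ N * (N ^ N * (2 * (W + 1) * (n + 1))) := by gcongr
    _ = (W + 2) ^ N * N ^ N * (2 * (W + 1)) * (n + 1) := by ring
    _ ≤ _ := Nat.mul_le_mul_right _ (Nat.le_add_left _ _)

/-! ### Computability of the parameter bound -/

section

open Primrec

variable {α : Type*} [Primcodable α]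

theorem primrec_pow {a b : α → ℕ} (ha : Primrec a) (hb : Primrec b) :
    Primrec fun x => a x ^ b x :=
  (Primrec₂.unpaired'.1 Nat.Primrec.pow).comp ha hb

theorem primrec_typeBound {k W : α → ℕ} (hk : Primrec k) (hW : Primrec W) :
    Primrec fun x => typeBound (k x) (W x) :=
  primrec_pow (const 2) (nat_mul.comp (nat_mul.comp hk hk)
    (nat_add.comp (nat_mul.comp (const 16) (primrec_pow hW (const 3))) (const 1)))

theorem primrec_digitBound {k W : α → ℕ} (hk : Primrec k) (hW : Primrec W) :
    Primrec fun x => digitBound (k x) (W x) :=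
  nat_add.comp (primrec_typeBound hk hW)
    (nat_mul.comp (nat_mul.comp (const 3) (primrec_typeBound hk hW)) hk)

theorem primrec_parameterBound {k W : α → ℕ} (hk : Primrec k) (hW : Primrec W) :
    Primrec fun x => parameterBound (k x) (W x) := by
  have hT := primrec_typeBound hk hW
  have hN := primrec_digitBound hk hW
  refine nat_add.comp (nat_add.comp (nat_add.comp (nat_add.comp (const 2) hk) (nat_add.comp hT
    (nat_mul.comp (nat_mul.comp (const 3) hT) (nat_add.comp hk (const 1)))))
    (primrec_pow (const 3) (nat_mul.comp (nat_mul.comp (const 3) hT) hk)))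
    (nat_mul.comp (nat_mul.comp (primrec_pow (nat_add.comp hW (const 2)) hN)
      (primrec_pow hN hN)) (nat_mul.comp (const 2) (nat_add.comp hW (const 1))))

end

/-- The dependence of the running time on `k` and `⌈1 / ε⌉`. -/
def timeBound (k E : ℕ) : ℕ := parameterBound k (32 * (E + 1)) ^ algorithm.deg

theorem computable_timeBound : Computable₂ timeBound :=
  Primrec.to_comp (primrec_pow (primrec_parameterBound Primrec.fst
    (Primrec.nat_mul.comp (Primrec.const 32) (Primrec.nat_add.comp Primrec.snd (Primrec.const 1))))
      (Primrec.const _))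

/-- By Bernoulli, `W` factors `1 + δ` make at least `2`, and `n * W` is at most two to the power of
its logarithm plus one; the remaining `1 / W` is at most `δ`. -/
theorem le_pow_mul_of_log {n W : ℕ} {δ : ℝ≥0} (hW : 1 ≤ δ * W) :
    (n : ℝ≥0) ≤ (1 + δ) ^ (W * (Nat.log 2 (n * W) + 1)) * δ := by
  have h2 : (2 : ℝ≥0) ≤ (1 + δ) ^ W := by
    have := one_add_mul_le_pow (a := (δ : ℝ)) (by linarith [δ.coe_nonneg]) W
    have hW' : (1 : ℝ) ≤ δ * W := by exact_mod_cast hW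
    have h3 : (2 : ℝ) ≤ (1 + δ) ^ W := by linarith
    exact_mod_cast h3
  have h4 : ((n * W : ℕ) : ℝ≥0) ≤ 2 ^ (Nat.log 2 (n * W) + 1) := by
    exact_mod_cast (Nat.lt_pow_succ_log_self (by norm_num) (n * W)).le
  calc (n : ℝ≥0) ≤ n * (δ * W) := le_mul_of_one_le_right' hW
    _ = ((n * W : ℕ) : ℝ≥0) * δ := by push_cast; ring
    _ ≤ 2 ^ (Nat.log 2 (n * W) + 1) * δ := by gcongr
    _ ≤ ((1 + δ) ^ W) ^ (Nat.log 2 (n * W) + 1) * δ := by gcongr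
    _ = _ := by rw [pow_mul]

theorem exec_algorithm {k n : ℕ} (I : Inst k n) {f : (Fin n → ℝ≥0) → ℝ≥0}
    (hf : IsMonotoneSymmetricNorm f) {ε : ℝ} (hε : 0 < ε) :
    ∃ t m, Exec f algorithm (I.input ε) t m ∧
      t ≤ timeBound k ⌈1 / ε⌉₊ * ((Polynomial.X + 1) ^ algorithm.deg : Polynomial ℕ).eval n ∧
      ((∃ τ, I.Feasible τ) → ∃ σ, Outputs m σ ∧ I.IsApprox f (1 + ε) σ) := by
  set E := ⌈1 / ε⌉₊ with hE
  set W := 32 * (E + 1) with hWdef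
  -- This value is below `1 / 32` for every `ε`, satisfies `32 * δ ≤ ε`, and has `1 ≤ δ * W` because
  -- `1 ≤ ε * E` implies `1 + ε ≤ ε * (E + 1)`.
  set δ : ℝ≥0 := ⟨ε / (32 * (1 + ε)), by positivity⟩ with hδ
  have hW : 1 ≤ δ * W := by
    have h1 : 1 ≤ ε * E := by
      have := mul_le_mul_of_nonneg_left (Nat.le_ceil (1 / ε)) hε.le
      rwa [mul_one_div_cancel hε.ne'] at this
    rw [← NNReal.coe_le_coe]
    push_cast
    change (1 : ℝ) ≤ ε / (32 * (1 + ε)) * (W : ℝ)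
    rw [hWdef, div_mul_eq_mul_div, le_div_iff₀ (by positivity)]
    push_cast
    nlinarith
  set G := parameterBound k W with hG
  have hle : ∀ x, x ≤ G → x ≤ G * (n + 1) := fun x hx =>
    hx.trans (Nat.le_mul_of_pos_right _ (Nat.succ_pos n))
  have hguess := guesses_le k W n
  have hS : W * (Nat.log 2 (n * W) + 1) ≤ G * (n + 1) := by
    refine le_trans ?_ hguess
    refine le_trans (Nat.le_add_right _ 2) (Nat.le_self_pow ?_ _)
    have : 0 < typeBound k W := by unfold typeBound; positivity
    unfold digitBound
    omega
  obtain ⟨g1, g2, g3⟩ := le_parameterBound k W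
  obtain ⟨t, m, h1, h2, h3⟩ := wp_algorithm (H := G * (n + 1)) (hle 2 (by omega))
    (hle k (by omega)) (Nat.le_mul_of_pos_left _ (by omega)) I hf hε (δ := δ) rfl hW
    (le_pow_mul_of_log hW) hS (R := typeBound k W) le_rfl (hle _ g2) (hle _ g3) hguess
  refine ⟨t, m, h1, h2.trans (le_of_eq ?_), h3⟩
  rw [mul_pow, timeBound, Polynomial.eval_pow, Polynomial.eval_add, Polynomial.eval_X,
    Polynomial.eval_one]

end CapClustering

end

theorem mainTheorem7 :
    ∃ (P : CapClustering.Program) (g : ℕ → ℕ → ℕ) (p : Polynomial ℕ),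
      Computable₂ g ∧
      ∀ (k n : ℕ) (I : CapClustering.Inst k n) (f : (Fin n → ℝ≥0) → ℝ≥0) (ε : ℝ),
        CapClustering.IsMonotoneSymmetricNorm f → 0 < ε →
        ∃ (t : ℕ) (m : CapClustering.Memory),
          CapClustering.Exec f P (I.input ε) t m ∧
          t ≤ g k ⌈1 / ε⌉₊ * p.eval n ∧
          ((∃ τ : Fin n → Fin k, I.Feasible τ) →
            ∃ σ : Fin n → Fin k,
              CapClustering.Outputs m σ ∧ I.IsApprox f (1 + ε) σ) := by
  refine ⟨CapClustering.algorithm, CapClustering.timeBound,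
    (Polynomial.X + 1) ^ CapClustering.algorithm.deg, CapClustering.computable_timeBound, ?_⟩
  intro k n I f ε hf hε
  exact CapClustering.exec_algorithm I hf hε
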